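/- **Setting.** Let $d\in\{2,3\}$, let $\Omega\subset\mathbb R^d$ be a bounded polytopal domain with Lipschitz boundary, let $\mathcal D\subset\Omega$ be finite and nonempty, let $\lambda>0$, let $\mathbf a,\mathbf b\in\mathbb R^d$ with $\mathbf a<\mathbf b$ componentwise, and let $\mathbf y_t\in\mathbb R^d$ for $t\in\mathcal D$. Put $\mathbb U_{ad}=\{\mathbf v\in L^2(\Omega)^d:\mathbf a\le\mathbf v\le\mathbf b\text{ a.e. in }\Omega\}$, $a(\mathbf w,\mathbf v)=\int_\Omega\nabla\mathbf w:\nabla\mathbf v$ and $b(\mathbf v,q)=-\int_\Omega q\,\mathrm{div}\,\mathbf v$. Let $d_{\mathcal D}=\mathrm{dist}(\mathcal D,\partial\Omega)$ if $\#\mathcal D=1$ and $d_{\mathcal D}=\min\{\mathrm{dist}(\mathcal D,\partial\Omega),\min_{t\ne t'}|t-t'|\}$ (with $t,t'\in\mathcal D$) otherwise. Let $\alpha\in(d-2,d)$ and define the weight $\rho$ as follows. If $\mathcal D=\{t\}$, then $\rho(x)=|x-t|^\alpha$. If $\#\mathcal D\ge2$, then $\rho(x)=|x-t|^\alpha$ when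 $|x-t|<d_{\mathcal D}/2$ for some $t\in\mathcal D$, and $\rho(x)=1$ when there is no such $t$. For a weight $\omega$ write $\|v\|_{L^2(\omega,G)}^2=\int_G|v|^2\omega$; $H^1_0(\omega,\Omega)$ is the closure of $C_0^\infty(\Omega)$ in $H^1(\omega,\Omega)$. Since $\alpha>d-2$, the Dirac measures $\delta_t$, $t\in\mathcal D$, extend continuously from $C_0^\infty(\Omega)^d$ to $H_0^1(\rho^{-1},\Omega)^d$. **Continuous problem.** Let $(\bar{\mathbf y},\bar p,\bar{\mathbf z},\bar r,\bar{\mathbf u})\in H_0^1(\Omega)^d\times L^2(\Omega)/\mathbb R\times H_0^1(\rho,\Omega)^d\times L^2(\rho,\Omega)/\mathbb R\times\mathbb U_{ad}$ solve the optimality system $$a(\bar{\mathbf y},\mathbf v)+b(\mathbf v,\bar p)=(\bar{\mathbf u},\mathbf v)_{L^2(\Omega)},\qquad b(\bar{\mathbf y},q)=0\qquad\forall\,\mathbf v\in H_0^1(\Omega)^d,\ q\in L^2(\Omega)/\mathbb R,$$ $$a(\mathbf w,\bar{\mathbf z})-b(\mathbf w,\bar r)=\sum_{t\in\mathcal D}\langle(\bar{\mathbf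 y}(t)-\mathbf y_t)\delta_t,\mathbf w\rangle,\qquad b(\bar{\mathbf z},s)=0\qquad\forall\,\mathbf w\in H_0^1(\rho^{-1},\Omega)^d,\ s\in L^2(\rho^{-1},\Omega)/\mathbb R,$$ $$(\bar{\mathbf z}+\lambda\bar{\mathbf u},\mathbf u-\bar{\mathbf u})_{L^2(\Omega)}\ge0\qquad\forall\,\mathbf u\in\mathbb U_{ad},$$ where $\bar{\mathbf y}$ is identified with its representative that is continuous in $\Omega$. **Discrete problem.** Let $\mathscr T$ be a conforming partition of $\overline\Omega$ into closed simplices $T$, with $h_T=\mathrm{diam}(T)$, that is shape regular with parameter $\sigma$: each $T$ contains a ball of some radius $r$ with $h_T\le\sigma r$. Let $\mathcal N_T^*=\bigcup\{T'\in\mathscr T:T\cap T'\ne\emptyset\}$ and assume $\#(\mathcal N_T^*\cap\mathcal D)\le1$ for every $T\in\mathscr T$. Let $\mathbf U(\mathscr T)$ be the space of $\mathbf v\in C(\overline\Omega)^d$ with $\mathbf v|_T\in\mathbb P_2(T)^d$ for all $T\in\mathscr T$, $\mathbf V(\mathscr T)=\mathbf U(\mathscr T)\cap H_0^1(\Omega)^d$,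 $Q(\mathscr T)$ the space of $q\in C(\overline\Omega)$ with $q|_T\in\mathbb P_1(T)$ for all $T$ and $\int_\Omega q=0$, and $\mathbb U_{ad}(\mathscr T)=\mathbf U(\mathscr T)\cap\mathbb U_{ad}$. Let $(\bar{\mathbf y}_{\mathscr T},\bar p_{\mathscr T},\bar{\mathbf z}_{\mathscr T},\bar r_{\mathscr T},\bar{\mathbf u}_{\mathscr T})\in\mathbf V(\mathscr T)\times Q(\mathscr T)\times\mathbf V(\mathscr T)\times Q(\mathscr T)\times\mathbb U_{ad}(\mathscr T)$ solve the discrete optimality system $$a(\bar{\mathbf y}_{\mathscr T},\mathbf v)+b(\mathbf v,\bar p_{\mathscr T})=(\bar{\mathbf u}_{\mathscr T},\mathbf v)_{L^2(\Omega)},\qquad b(\bar{\mathbf y}_{\mathscr T},q)=0\qquad\forall\,\mathbf v\in\mathbf V(\mathscr T),\ q\in Q(\mathscr T),$$ $$a(\mathbf w,\bar{\mathbf z}_{\mathscr T})-b(\mathbf w,\bar r_{\mathscr T})=\sum_{t\in\mathcal D}(\bar{\mathbf y}_{\mathscr T}(t)-\mathbf y_t)\cdot\mathbf w(t),\qquad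 b(\bar{\mathbf z}_{\mathscr T},s)=0\qquad\forall\,\mathbf w\in\mathbf V(\mathscr T),\ s\in Q(\mathscr T),$$ $$(\bar{\mathbf z}_{\mathscr T}+\lambda\bar{\mathbf u}_{\mathscr T},\mathbf u-\bar{\mathbf u}_{\mathscr T})_{L^2(\Omega)}\ge0\qquad\forall\,\mathbf u\in\mathbb U_{ad}(\mathscr T).$$ **Indicator.** Let $D_T=\min_{t\in\mathcal D}\max_{x\in T}|x-t|$, let $[\![\nabla\mathbf v\cdot\boldsymbol\nu]\!]=\nabla\mathbf v|_{T^+}\cdot\boldsymbol\nu^++\nabla\mathbf v|_{T^-}\cdot\boldsymbol\nu^-$ on the internal side shared by $T^+$ and $T^-$ ($\boldsymbol\nu^\pm$ being the unit normal pointing towards $T^\pm$), and, with $\mathcal E_{ad,T}\ge0$, $$\mathcal E_{ad,T}^2=h_T^2D_T^\alpha\|\Delta\bar{\mathbf z}_{\mathscr T}+\nabla\bar r_{\mathscr T}\|_{L^2(T)}^2+\|\mathrm{div}\,\bar{\mathbf z}_{\mathscr T}\|_{L^2(\rho,T)}^2+h_TD_T^\alpha\|[\![\nabla\bar{\mathbf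 z}_{\mathscr T}\cdot\boldsymbol\nu]\!]\|_{L^2(\partial T\setminus\partial\Omega)}^2+\sum_{t\in\mathcal D\cap T}h_T^{\alpha+2-d}|\bar{\mathbf y}_{\mathscr T}(t)-\mathbf y_t|^2 .$$ **Theorem (local efficiency of $\mathcal E_{ad}$).** Write $\mathbf e_{\mathbf z}=\bar{\mathbf z}-\bar{\mathbf z}_{\mathscr T}$, $e_r=\bar r-\bar r_{\mathscr T}$ and $\mathbf e_{\mathbf y}=\bar{\mathbf y}-\bar{\mathbf y}_{\mathscr T}$. There is a constant $C>0$, depending only on $d$, $\Omega$, $\mathcal D$, $\alpha$ and $\sigma$ (and so independent of $\lambda,\mathbf a,\mathbf b,\mathbf y_t$, of the continuous and discrete solutions, of the sizes of the elements and of $\#\mathscr T$), such that for every $T\in\mathscr T$ and every representative $\bar r$ of its class modulo constants $$\mathcal E_{ad,T}^2\le C\Big(\|\nabla\mathbf e_{\mathbf z}\|_{L^2(\rho,\mathcal N_T^*)}^2+\|e_r\|_{L^2(\rho,\mathcal N_T^*)}^2+\#(T\cap\mathcal D)\,h_T^{\alpha+2-d}\|\mathbf e_{\mathbf y}\|_{L^\infty(T)}^2\Big).$$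 -/

import Mathlib

open MeasureTheory Filter Topology
open scoped ENNReal NNReal InnerProductSpace

noncomputable section

namespace StokesTracking

/-- Points and vectors of `ℝ^d` with the Euclidean norm. -/
abbrev Vec (d : ℕ) := EuclideanSpace ℝ (Fin d)

/-- Tensors `A`, with `A j` standing for the partial derivative `∂_j v`. The norm is the Frobenius
norm and the inner product is the double contraction `A : B`. -/
abbrev Tens (d : ℕ) := PiLp 2 (fun _ : Fin d => Vec d)

variable {d : ℕ}

/-- The `j`-th standard basis vector. -/
def basisVec (j : Fin d) : Vec d := EuclideanSpace.single j 1

/-- The classical gradient of a vector field. -/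
def grad (v : Vec d → Vec d) (x : Vec d) : Tens d :=
  WithLp.toLp 2 fun j => fderiv ℝ v x (basisVec j)

/-- The one-sided gradient `∇(v|_S)` of a vector field on `S`. -/
def gradWithin (v : Vec d → Vec d) (S : Set (Vec d)) (x : Vec d) : Tens d :=
  WithLp.toLp 2 fun j => fderivWithin ℝ v S x (basisVec j)

/-- The trace of a tensor; `div v` is the trace of the gradient of `v`. -/
def tr (A : Tens d) : ℝ := ∑ j, (A j) j

/-! ### The domain -/

/-- A bounded Lipschitz domain: nonempty, open, connected, bounded, and near each boundary point
the strict epigraph of a Lipschitz function in some direction `e` (the function is evaluated at the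
component orthogonal to `e`). -/
structure IsLipschitzDomain (Ω : Set (Vec d)) : Prop where
  isOpen : IsOpen Ω
  isConnected : IsConnected Ω
  isBounded : Bornology.IsBounded Ω
  lipschitz_boundary : ∀ x ∈ frontier Ω, ∃ (e : Vec d) (K : ℝ≥0) (g : Vec d → ℝ) (r : ℝ),
    ‖e‖ = 1 ∧ LipschitzWith K g ∧ 0 < r ∧
      ∀ y ∈ Metric.ball x r, (y ∈ Ω ↔ g (y - ⟪e, y⟫_ℝ • e) < ⟪e, y⟫_ℝ)

/-! ### Weighted Lebesgue and Sobolev spaces -/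

/-- `‖f‖²_{L²(wt,S)}`. -/
def wL2Sq {F : Type*} [NormedAddCommGroup F] (wt : Vec d → ℝ) (S : Set (Vec d))
    (f : Vec d → F) : ℝ≥0∞ :=
  ∫⁻ x in S, ‖f x‖ₑ ^ 2 * ENNReal.ofReal (wt x)

/-- The constant weight `1`. -/
def unitWeight (_ : Vec d) : ℝ := 1

/-- `f ∈ L²(wt,Ω)`. -/
def MemL2 {F : Type*} [NormedAddCommGroup F] (wt : Vec d → ℝ) (Ω : Set (Vec d))
    (f : Vec d → F) : Prop :=
  LocallyIntegrableOn f Ω ∧ wL2Sq wt Ω f < ∞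

/-- `φ ∈ C_0^∞(Ω)`. -/
def IsTest {F : Type*} [NormedAddCommGroup F] [NormedSpace ℝ F] (Ω : Set (Vec d))
    (φ : Vec d → F) : Prop :=
  ContDiff ℝ ((⊤ : ℕ∞) : WithTop ℕ∞) φ ∧ HasCompactSupport φ ∧ tsupport φ ⊆ Ω

/-- `G` is the distributional gradient of `v` in `Ω`. -/
def IsWeakGrad (Ω : Set (Vec d)) (v : Vec d → Vec d) (G : Vec d → Tens d) : Prop :=
  ∀ φ : Vec d → ℝ, IsTest Ω φ → ∀ j : Fin d,
    ∫ x in Ω, fderiv ℝ φ x (basisVec j) • v x = - ∫ x in Ω, φ x • G x j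

/-- `v ∈ H¹(wt,Ω)^d` with weak gradient `G`. -/
def MemH1 (wt : Vec d → ℝ) (Ω : Set (Vec d)) (v : Vec d → Vec d) (G : Vec d → Tens d) : Prop :=
  MemL2 wt Ω v ∧ MemL2 wt Ω G ∧ IsWeakGrad Ω v G

/-- `φ_n ∈ C_0^∞(Ω)^d` and `φ_n → v`, `∇φ_n → G` in `L²(wt,Ω)`. -/
def TestSeqTendsto (wt : Vec d → ℝ) (Ω : Set (Vec d)) (φ : ℕ → Vec d → Vec d)
    (v : Vec d → Vec d) (G : Vec d → Tens d) : Prop :=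
  (∀ n, IsTest Ω (φ n)) ∧
  Tendsto (fun n => wL2Sq wt Ω (fun x => φ n x - v x)) atTop (𝓝 0) ∧
  Tendsto (fun n => wL2Sq wt Ω (fun x => grad (φ n) x - G x)) atTop (𝓝 0)

/-- `v ∈ H¹_0(wt,Ω)^d` with weak gradient `G`: the closure of `C_0^∞(Ω)^d` in `H¹(wt,Ω)^d`. -/
def MemH10 (wt : Vec d → ℝ) (Ω : Set (Vec d)) (v : Vec d → Vec d) (G : Vec d → Tens d) : Prop :=
  MemH1 wt Ω v G ∧ ∃ φ, TestSeqTendsto wt Ω φ v G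

/-- `c` is the value at `w ∈ H¹_0(wt,Ω)^d` of the extension by continuity of `δ_t` from
`C_0^∞(Ω)^d`: the pair `(w, c)` lies in the closure of the graph of `φ ↦ φ(t)`. -/
def IsDiracValue (wt : Vec d → ℝ) (Ω : Set (Vec d)) (t : Vec d)
    (w : Vec d → Vec d) (G : Vec d → Tens d) (c : Vec d) : Prop :=
  ∃ φ, TestSeqTendsto wt Ω φ w G ∧ Tendsto (fun n => φ n t) atTop (𝓝 c)

/-- `a(w,v) = ∫_Ω ∇w : ∇v`, in terms of the gradients. -/
def aForm (Ω : Set (Vec d)) (Gw Gv : Vec d → Tens d) : ℝ := ∫ x in Ω, ⟪Gw x, Gv x⟫_ℝ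

/-- `b(v,q) = -∫_Ω q div v`, in terms of the gradient of `v`. -/
def bForm (Ω : Set (Vec d)) (Gv : Vec d → Tens d) (q : Vec d → ℝ) : ℝ :=
  - ∫ x in Ω, q x * tr (Gv x)

/-- The `L²(Ω)^d` inner product. -/
def l2Form (Ω : Set (Vec d)) (u v : Vec d → Vec d) : ℝ := ∫ x in Ω, ⟪u x, v x⟫_ℝ

/-! ### The weight attached to the observation points -/

/-- `dist(D, ∂Ω)`. -/
def distToBoundary (Ω : Set (Vec d)) (D : Finset (Vec d)) : ℝ :=
  sInf ((fun t => Metric.infDist t (frontier Ω)) '' (D : Set (Vec d)))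

/-- `min {|t - t'| : t, t' ∈ D, t ≠ t'}`. -/
def minSeparation (D : Finset (Vec d)) : ℝ :=
  sInf {s | ∃ t ∈ D, ∃ t' ∈ D, t ≠ t' ∧ s = dist t t'}

/-- The number `d_D`. -/
def obsRadius (Ω : Set (Vec d)) (D : Finset (Vec d)) : ℝ :=
  if D.card = 1 then distToBoundary Ω D else min (distToBoundary Ω D) (minSeparation D)

/-- The weight `ρ`. If `#D = 1` it is `|x - t|^α`. Otherwise it is `|x - t|^α` if `|x - t| < d_D/2`
for a (then unique and nearest) point `t ∈ D`, and `1` if there is no such point. The distance of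
`x` to this `t` is its distance to `D`. -/
def rho (Ω : Set (Vec d)) (D : Finset (Vec d)) (α : ℝ) (x : Vec d) : ℝ :=
  if D.card = 1 ∨ Metric.infDist x (D : Set (Vec d)) < obsRadius Ω D / 2 then
    Metric.infDist x (D : Set (Vec d)) ^ α
  else 1

/-- The weight `ρ⁻¹`. -/
def rhoInv (Ω : Set (Vec d)) (D : Finset (Vec d)) (α : ℝ) (x : Vec d) : ℝ := (rho Ω D α x)⁻¹

/-! ### Meshes and finite element spaces -/

/-- The closed simplex with the given vertices. -/
def hull (T : Finset (Vec d)) : Set (Vec d) := convexHull ℝ (T : Set (Vec d))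

/-- A conforming partition of `closure Ω` into nondegenerate closed `d`-simplices, each given by
its set of vertices: two elements meet in the simplex spanned by their common vertices, which is
empty or a common face. The existence of a mesh says in particular that `Ω` is polytopal. -/
structure Mesh (Ω : Set (Vec d)) where
  elements : Finset (Finset (Vec d))
  card_eq : ∀ T ∈ elements, T.card = d + 1
  affineIndependent : ∀ T ∈ elements, AffineIndependent ℝ ((↑) : T → Vec d)
  conforming : ∀ T ∈ elements, ∀ T' ∈ elements,
    hull T ∩ hull T' = convexHull ℝ ((T : Set (Vec d)) ∩ (T' : Set (Vec d)))
  cover : ⋃ T ∈ elements, hull T = closure Ω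

variable {Ω : Set (Vec d)}

/-- `h_T = diam T`. -/
def hSize (T : Finset (Vec d)) : ℝ := Metric.diam (hull T)

/-- Shape regularity with parameter `σ`: each element `T` contains a ball whose radius `r`
satisfies `h_T ≤ σ r`. -/
def Mesh.IsShapeRegular (M : Mesh Ω) (σ : ℝ) : Prop :=
  ∀ T ∈ M.elements, ∃ c r, 0 < r ∧ Metric.ball c r ⊆ hull T ∧ hSize T ≤ σ * r

/-- The patch `N_T^*`: the union of the elements that meet `T`. -/
def Mesh.star (M : Mesh Ω) (T : Finset (Vec d)) : Set (Vec d) :=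
  ⋃ T' ∈ {T' | T' ∈ M.elements ∧ (hull T ∩ hull T').Nonempty}, hull T'

open Classical in
/-- The elements that share a side, that is, a `(d-1)`-face, with `T`. The internal sides of `T`
correspond one to one to these elements. -/
def Mesh.neighbors (M : Mesh Ω) (T : Finset (Vec d)) : Finset (Finset (Vec d)) :=
  M.elements.filter fun T' => T' ≠ T ∧ (T ∩ T').card = d

/-- The function `f` agrees on `S` with a polynomial of total degree at most `k`. -/
def IsPolyOn (k : ℕ) (S : Set (Vec d)) (f : Vec d → ℝ) : Prop :=
  ∃ p : MvPolynomial (Fin d) ℝ, p.totalDegree ≤ k ∧ ∀ x ∈ S, f x = MvPolynomial.eval (fun i => x i) p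

/-- Continuous vector fields on `closure Ω` whose components are piecewise quadratic: `U(𝒯)`. -/
def Mesh.InU (M : Mesh Ω) (v : Vec d → Vec d) : Prop :=
  ContinuousOn v (closure Ω) ∧ ∀ T ∈ M.elements, ∀ i, IsPolyOn 2 (hull T) (fun x => v x i)

/-- The Taylor-Hood velocity space `V(𝒯) = U(𝒯) ∩ H¹_0(Ω)^d`. The weak gradient of a continuous
piecewise polynomial field is its classical gradient, which exists almost everywhere. -/
def Mesh.InV (M : Mesh Ω) (v : Vec d → Vec d) : Prop :=
  M.InU v ∧ MemH10 unitWeight Ω v (grad v)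

/-- The Taylor-Hood pressure space `Q(𝒯)`: continuous, piecewise affine, with zero mean. -/
def Mesh.InQ (M : Mesh Ω) (q : Vec d → ℝ) : Prop :=
  ContinuousOn q (closure Ω) ∧ (∀ T ∈ M.elements, IsPolyOn 1 (hull T) q) ∧ ∫ x in Ω, q x = 0

/-! ### The continuous and the discrete optimality systems -/

/-- The admissible controls: `u ∈ L²(Ω)^d` with `lo ≤ u ≤ up` almost everywhere in `Ω`. -/
def InUad (Ω : Set (Vec d)) (lo up : Vec d) (u : Vec d → Vec d) : Prop :=
  MemL2 unitWeight Ω u ∧ ∀ᵐ x ∂(volume.restrict Ω), ∀ i, lo i ≤ u x i ∧ u x i ≤ up i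

/-- `(y, p, z, r, u)` solves the optimality system with observation points `D`, desired states `yd`,
regularization parameter `lam` and control bounds `lo`, `up`; `Gy` and `Gz` are the weak gradients
of `y` and `z`. The pressures `p` and `r` are arbitrary representatives of their classes modulo
constants. -/
structure IsOptimal (Ω : Set (Vec d)) (D : Finset (Vec d)) (α lam : ℝ) (lo up : Vec d)
    (yd : Vec d → Vec d) (y : Vec d → Vec d) (Gy : Vec d → Tens d) (p : Vec d → ℝ)
    (z : Vec d → Vec d) (Gz : Vec d → Tens d) (r : Vec d → ℝ) (u : Vec d → Vec d) : Prop where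
  y_mem : MemH10 unitWeight Ω y Gy
  /-- `y` is the continuous representative, through which its point values are defined. -/
  y_cont : ContinuousOn y Ω
  p_mem : MemL2 unitWeight Ω p
  z_mem : MemH10 (rho Ω D α) Ω z Gz
  r_mem : MemL2 (rho Ω D α) Ω r
  u_mem : InUad Ω lo up u
  state_momentum : ∀ v Gv, MemH10 unitWeight Ω v Gv →
    aForm Ω Gy Gv + bForm Ω Gv p = l2Form Ω u v
  state_div : ∀ q, MemL2 unitWeight Ω q → bForm Ω Gy q = 0
  adjoint_momentum : ∀ w Gw, MemH10 (rhoInv Ω D α) Ω w Gw →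
    ∀ c : Vec d → Vec d, (∀ t ∈ D, IsDiracValue (rhoInv Ω D α) Ω t w Gw (c t)) →
      aForm Ω Gw Gz - bForm Ω Gw r = ∑ t ∈ D, ⟪y t - yd t, c t⟫_ℝ
  adjoint_div : ∀ s, MemL2 (rhoInv Ω D α) Ω s → bForm Ω Gz s = 0
  variational_ineq : ∀ u', InUad Ω lo up u' →
    0 ≤ l2Form Ω (fun x => z x + lam • u x) (fun x => u' x - u x)

/-- The discrete optimality system. -/
structure Mesh.IsDiscreteOptimal (M : Mesh Ω) (D : Finset (Vec d)) (lam : ℝ) (lo up : Vec d)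
    (yd : Vec d → Vec d) (y : Vec d → Vec d) (p : Vec d → ℝ)
    (z : Vec d → Vec d) (r : Vec d → ℝ) (u : Vec d → Vec d) : Prop where
  y_mem : M.InV y
  p_mem : M.InQ p
  z_mem : M.InV z
  r_mem : M.InQ r
  u_mem : M.InU u ∧ InUad Ω lo up u
  state_momentum : ∀ v, M.InV v →
    aForm Ω (grad y) (grad v) + bForm Ω (grad v) p = l2Form Ω u v
  state_div : ∀ q, M.InQ q → bForm Ω (grad y) q = 0
  adjoint_momentum : ∀ w, M.InV w →
    aForm Ω (grad w) (grad z) - bForm Ω (grad w) r = ∑ t ∈ D, ⟪y t - yd t, w t⟫_ℝ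
  adjoint_div : ∀ s, M.InQ s → bForm Ω (grad z) s = 0
  variational_ineq : ∀ u', M.InU u' → InUad Ω lo up u' →
    0 ≤ l2Form Ω (fun x => z x + lam • u x) (fun x => u' x - u x)

/-! ### The error indicator -/

/-- `D_T = min_{t ∈ D} max_{x ∈ T} |x - t|`. -/
def obsDist (D : Finset (Vec d)) (T : Finset (Vec d)) : ℝ :=
  sInf ((fun t => sSup ((fun x => dist x t) '' hull T)) '' (D : Set (Vec d)))

/-- The unit normal on the side `S` of the element `T` that points towards `T`: the direction of
the component orthogonal to `S` of the vector from the centroid of `S` to the centroid of `T`. -/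
def sideNormal (S T : Finset (Vec d)) : Vec d :=
  let n := (vectorSpan ℝ (S : Set (Vec d)))ᗮ.starProjection
    (T.centroid ℝ id - S.centroid ℝ id)
  ‖n‖⁻¹ • n

open Classical in
/-- The jump `⟦∇v · ν⟧ = ∇v|_T · ν_T + ∇v|_{T'} · ν_{T'}` on the side shared by `T` and `T'`. -/
def normalJump (v : Vec d → Vec d) (T T' : Finset (Vec d)) (x : Vec d) : Vec d :=
  fderivWithin ℝ v (hull T) x (sideNormal (T ∩ T') T) +
    fderivWithin ℝ v (hull T') x (sideNormal (T ∩ T') T')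

open Classical in
/-- `‖⟦∇v · ν⟧‖²` in `L²(∂T ∖ ∂Ω)`: the sum over the internal sides of `T`, with respect to the
`(d-1)`-dimensional surface measure. -/
def Mesh.jumpSq (M : Mesh Ω) (v : Vec d → Vec d) (T : Finset (Vec d)) : ℝ≥0∞ :=
  ∑ T' ∈ M.neighbors T, ∫⁻ x in hull (T ∩ T'), ‖normalJump v T T' x‖ₑ ^ 2 ∂μHE[d - 1]

open Classical in
/-- The local error indicator `ℰ_{ad,T}(z, r, y)` of the adjoint equations. -/
def Mesh.adIndicator (M : Mesh Ω) (D : Finset (Vec d)) (α : ℝ) (yd z : Vec d → Vec d)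
    (r : Vec d → ℝ) (y : Vec d → Vec d) (T : Finset (Vec d)) : ℝ≥0∞ :=
  (ENNReal.ofReal (hSize T ^ 2 * obsDist D T ^ α) *
      wL2Sq unitWeight (hull T) (fun x =>
        InnerProductSpace.laplacianWithin z (hull T) x + gradientWithin r (hull T) x) +
    wL2Sq (rho Ω D α) (hull T) (fun x => tr (gradWithin z (hull T) x)) +
    ENNReal.ofReal (hSize T * obsDist D T ^ α) * M.jumpSq z T +
    ∑ t ∈ D, if t ∈ hull T then
      ENNReal.ofReal (hSize T ^ (α + 2 - d)) * ‖y t - yd t‖ₑ ^ 2 else 0) ^ (1 / 2 : ℝ)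

end StokesTracking

end

/-! This is residual-based efficiency, with smooth radial bumps in place of polynomial bubble
functions. For w in C_0^∞(Ω)^d, the load Σ_t ⟨ȳ(t) - y_t, w(t)⟩ minus the weak residual of the
discrete pair equals an integral of ∇w against the errors (`residual_identity`); such w are
admissible because α < d makes ρ⁻¹ integrable. If w is a bump of radius s comparable to h_T times a
constant vector, the weak residual of a piecewise quadratic velocity and piecewise affine pressure
can be integrated exactly. Inside an element the odd part cancels and only Δz + ∇r is left
(`weakResidual_interior`); at a side a multiple of the normal jump is added (`weakResidual_side`).
By weighted Cauchy-Schwarz, every bump that keeps away from 𝒟 bounds these quantities by one number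
n, where n² h_T^d D_T^α is a constant times the squared weighted error E² (`control_sq`). This is
the scaling of the residual and jump terms of the indicator.

Bumps near an observation point are not usable in this way, since the load enters and the weight
degenerates. But the star of T contains at most one such point, so of two bumps with distant centres
at least one is good (`IsErrorPair.isPatchControlled`), and hence two of any three well spaced
collinear centres. The strong residual is constant on an element, while the divergence and the
normal jump are affine along lines, so two good centres suffice to bound them everywhere.

For the load at t in T the test function is a bump of radius comparable to h_T centred at t. Its
support may cross many elements, so the weak residual is compared with that of the polynomials of T
alone, extended to the whole space (`weakResidual_sub_le`). This requires the polynomials of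
neighbouring elements to be close off their common side as well. Purely tangential derivatives agree
by continuity, mixed second derivatives are slopes of the normal jump, and the second normal
derivative is recovered from the divergence (its normal component) and from the strong residuals
(its tangential component), together with the jump of the pressure gradient
(`IsSidePair.second_normal_le`). The differences are then summed along paths of elements that share
sides.

The mesh geometry behind this is that boundedly many elements touch T, that sizes are comparable
along such paths, and that a ball about t of radius comparable to h_T is covered by the elements
they reach (`Mesh.ball_subset_patch`). The divergence term is pointwise, because div z̄ = 0 almost
everywhere (`tr_eq_zero_ae`). -/

noncomputable section

namespace StokesTracking

variable {d : ℕ}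

section

/-! ### A radial bump function -/

/-- A smooth radial bump function supported in the closed unit ball. -/
def bump (y : Vec d) : ℝ := Real.smoothTransition (1 - ‖y‖ ^ 2)

/-- The kernel with `∇ bump y = - bumpKer y • y`. -/
def bumpKer (y : Vec d) : ℝ := 2 * deriv Real.smoothTransition (1 - ‖y‖ ^ 2)

lemma contDiff_bump : ContDiff ℝ ((⊤ : ℕ∞) : WithTop ℕ∞) (bump : Vec d → ℝ) :=
  Real.smoothTransition.contDiff.comp (contDiff_const.sub (contDiff_norm_sq ℝ))

lemma bump_zero : bump (0 : Vec d) = 1 := by simp [bump]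

lemma bump_nonneg (y : Vec d) : 0 ≤ bump y := Real.smoothTransition.nonneg _

lemma bump_le_one (y : Vec d) : bump y ≤ 1 := Real.smoothTransition.le_one _

lemma bump_eq_zero {y : Vec d} (hy : 1 ≤ ‖y‖) : bump y = 0 :=
  Real.smoothTransition.zero_of_nonpos (by nlinarith)

lemma bumpKer_neg (y : Vec d) : bumpKer (-y) = bumpKer y := by simp [bumpKer]

lemma bumpKer_nonneg (y : Vec d) : 0 ≤ bumpKer y := by
  unfold bumpKer
  have := Real.smoothTransition.monotone.deriv_nonneg (x := 1 - ‖y‖ ^ 2)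
  positivity

lemma continuous_bumpKer : Continuous (bumpKer : Vec d → ℝ) := by
  unfold bumpKer
  have : Continuous (deriv Real.smoothTransition) :=
    (Real.smoothTransition.contDiff (n := 1)).continuous_deriv le_rfl
  fun_prop

lemma bumpKer_eq_zero {y : Vec d} (hy : 1 ≤ ‖y‖) : bumpKer y = 0 := by
  have hcont : Continuous (deriv Real.smoothTransition) :=
    (Real.smoothTransition.contDiff (n := 1)).continuous_deriv le_rfl
  have h0 : ∀ x ∈ Set.Iio (0 : ℝ), deriv Real.smoothTransition x = 0 := by
    intro x hx
    have : Real.smoothTransition =ᶠ[𝓝 x] fun _ => 0 := by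
      filter_upwards [Iio_mem_nhds hx] with y hy
      exact Real.smoothTransition.zero_of_nonpos (le_of_lt hy)
    rw [this.deriv_eq]; simp
  have h1 : ∀ x ∈ Set.Iic (0 : ℝ), deriv Real.smoothTransition x = 0 := by
    have hcl : IsClosed {x : ℝ | deriv Real.smoothTransition x = 0} :=
      isClosed_eq hcont continuous_const
    have := hcl.closure_subset_iff.2 (show Set.Iio (0 : ℝ) ⊆ _ from h0)
    rwa [closure_Iio] at this
  rw [bumpKer, h1 _ (by simp only [Set.mem_Iic]; nlinarith), mul_zero]

lemma hasFDerivAt_bump (y : Vec d) : HasFDerivAt bump (-(bumpKer y) • innerSL ℝ y) y := by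
  have h1 : HasFDerivAt (fun y : Vec d => 1 - ‖y‖ ^ 2) (-(2 • innerSL ℝ y)) y := by
    simpa using ((hasStrictFDerivAt_norm_sq y).hasFDerivAt.const_sub 1)
  have h2 : HasDerivAt Real.smoothTransition (deriv Real.smoothTransition (1 - ‖y‖ ^ 2))
      (1 - ‖y‖ ^ 2) :=
    ((Real.smoothTransition.contDiff (n := 1)).differentiable (by simp) _).hasDerivAt
  refine (h2.comp_hasFDerivAt y h1).congr_fderiv ?_
  ext v
  simp [bumpKer]
  ring

lemma hasCompactSupport_bump : HasCompactSupport (bump : Vec d → ℝ) :=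
  HasCompactSupport.of_support_subset_isCompact (isCompact_closedBall (0 : Vec d) 1) fun y hy => by
    by_contra h
    exact hy (bump_eq_zero (by simpa using le_of_not_ge (by simpa using h)))

lemma hasCompactSupport_bumpKer : HasCompactSupport (bumpKer : Vec d → ℝ) :=
  HasCompactSupport.of_support_subset_isCompact (isCompact_closedBall (0 : Vec d) 1) fun y hy => by
    by_contra h
    exact hy (bumpKer_eq_zero (by simpa using le_of_not_ge (by simpa using h)))

lemma integrable_bump : Integrable (bump : Vec d → ℝ) :=
  contDiff_bump.continuous.integrable_of_hasCompactSupport hasCompactSupport_bump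

lemma integrable_bumpKer_mul {g : Vec d → ℝ} (hg : Continuous g) :
    Integrable fun y => bumpKer y * g y :=
  (continuous_bumpKer.mul hg).integrable_of_hasCompactSupport hasCompactSupport_bumpKer.mul_right

/-- The integral of the bump function. -/
def bumpInt (d : ℕ) : ℝ := ∫ y : Vec d, bump y

lemma bumpInt_pos : 0 < bumpInt d := by
  refine (contDiff_bump.continuous.integral_pos_of_hasCompactSupport_nonneg_nonzero
    hasCompactSupport_bump bump_nonneg (x := 0) ?_)
  rw [bump_zero]; norm_num

lemma integral_eq_zero_of_odd {f : Vec d → ℝ} (hf : ∀ y, f (-y) = - f y) : ∫ y, f y = 0 := by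
  have h := integral_neg_eq_self f (volume : Measure (Vec d))
  simp only [hf, integral_neg] at h
  linarith

/-- Integration by parts: `bumpKer y * ⟪v, y⟫` is minus the derivative of `bump` along v, and the
derivative moves onto the coordinate y_i. This is why second moments produce traces, so that bumps
detect the Laplacian. -/
lemma integral_bumpKer_mul_inner (i : Fin d) (v : Vec d) :
    ∫ y : Vec d, bumpKer y * (y i * ⟪v, y⟫_ℝ) = v i * bumpInt d := by
  have hc : Continuous fun y : Vec d => y i := by fun_prop
  have hd : ∀ y : Vec d, HasFDerivAt (fun y : Vec d => y i)
      (EuclideanSpace.proj i : Vec d →L[ℝ] ℝ) y :=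
    fun y => (EuclideanSpace.proj i : Vec d →L[ℝ] ℝ).hasFDerivAt
  have h := integral_bilinear_hasFDerivAt_right_eq_neg_left_of_integrable (μ := volume)
    (B := ContinuousLinearMap.mul ℝ ℝ) (f := fun y : Vec d => y i) (g := bump) (v := v)
    (f' := fun _ => (EuclideanSpace.proj i : Vec d →L[ℝ] ℝ)) (g' := fun y => -(bumpKer y) • innerSL ℝ y)
    ?_ ?_ ?_ (fun y _ => hd y) (fun y _ => hasFDerivAt_bump y)
  · simp only [ContinuousLinearMap.mul_apply', _root_.smul_apply,
      EuclideanSpace.coe_proj, innerSL_apply_apply, smul_eq_mul] at h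
    rw [integral_const_mul] at h
    have h2 : ∀ y : Vec d, y i * (-bumpKer y * ⟪y, v⟫_ℝ) = -(bumpKer y * (y i * ⟪v, y⟫_ℝ)) := by
      intro y; rw [real_inner_comm]; ring
    simp only [h2, integral_neg, neg_inj] at h
    exact h
  · simpa using integrable_bump.const_mul (v i)
  · have := integrable_bumpKer_mul (g := fun y : Vec d => -(y i * ⟪y, v⟫_ℝ)) (by fun_prop)
    refine this.congr (Eventually.of_forall fun y => ?_)
    simp; ring
  · exact (hc.mul contDiff_bump.continuous).integrable_of_hasCompactSupport
      hasCompactSupport_bump.mul_left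

lemma sum_smul_basisVec (y : Vec d) : ∑ i, y i • basisVec i = y := by
  ext j
  simp [basisVec, Pi.single_apply]

lemma inner_basisVec (y : Vec d) (i : Fin d) : ⟪y, basisVec i⟫_ℝ = y i := by
  simp [basisVec, EuclideanSpace.inner_single_right]

lemma norm_basisVec (i : Fin d) : ‖(basisVec i : Vec d)‖ = 1 := by simp [basisVec]

/-- Second moments of the kernel. -/
lemma integral_bumpKer_mul_bilin (Q : Vec d →L[ℝ] Vec d →L[ℝ] ℝ) :
    ∫ y : Vec d, bumpKer y * Q y y = (∑ i, Q (basisVec i) (basisVec i)) * bumpInt d := by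
  have h : ∀ y : Vec d, bumpKer y * Q y y =
      ∑ i, bumpKer y * (y i * ⟪(InnerProductSpace.toDual ℝ (Vec d)).symm (Q (basisVec i)), y⟫_ℝ) := by
    intro y
    have hy : Q y y = ∑ i, y i * Q (basisVec i) y := by
      have h1 := congrArg (fun L : Vec d →L[ℝ] ℝ => L y) (congrArg Q (sum_smul_basisVec y))
      simpa using h1.symm
    rw [hy, Finset.mul_sum]
    simp
  simp_rw [h]
  rw [integral_finsetSum]
  · rw [Finset.sum_mul]
    refine Finset.sum_congr rfl fun i _ => ?_
    rw [integral_bumpKer_mul_inner, ← inner_basisVec, InnerProductSpace.toDual_symm_apply]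
  · intro i _
    exact integrable_bumpKer_mul (by fun_prop)

/-- The bounded quantity is the norm of the gradient of `bump`, continuous and supported in the unit
ball. -/
lemma exists_bumpKer_le : ∃ C : ℝ, 0 < C ∧ ∀ y : Vec d, bumpKer y * ‖y‖ ≤ C := by
  obtain ⟨C, hC⟩ := (isCompact_closedBall (0 : Vec d) 1).exists_bound_of_continuousOn
    (f := fun y => bumpKer y * ‖y‖) ((continuous_bumpKer.mul continuous_norm).continuousOn)
  refine ⟨|C| + 1, by positivity, fun y => ?_⟩
  by_cases hy : ‖y‖ ≤ 1
  · have := hC y (by simpa using hy)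
    have h1 := le_abs_self C
    have h2 := Real.le_norm_self (bumpKer y * ‖y‖)
    linarith
  · rw [bumpKer_eq_zero (le_of_not_ge hy)]
    simp; positivity

/-- The first absolute moment of the kernel in a unit direction. -/
lemma bumpInt_le_integral_abs {ν : Vec d} (hν : ‖ν‖ = 1) :
    bumpInt d ≤ ∫ y : Vec d, bumpKer y * |⟪ν, y⟫_ℝ| := by
  have h := integral_bumpKer_mul_bilin ((innerSL ℝ ν).smulRight (innerSL ℝ ν))
  have hs : ∑ i, ((innerSL ℝ ν).smulRight (innerSL ℝ ν)) (basisVec i) (basisVec i) = 1 := by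
    have h1 : ∀ i, ((innerSL ℝ ν).smulRight (innerSL ℝ ν)) (basisVec i) (basisVec i) = ν i ^ 2 := by
      intro i
      simp only [ContinuousLinearMap.smulRight_apply, innerSL_apply_apply,
        _root_.smul_apply, smul_eq_mul, inner_basisVec]
      ring
    simp_rw [h1]
    have := EuclideanSpace.norm_sq_eq ν
    rw [hν] at this
    simpa using this.symm
  rw [hs, one_mul] at h
  rw [← h]
  refine integral_mono (integrable_bumpKer_mul (by fun_prop)) (integrable_bumpKer_mul (by fun_prop))
    fun y => ?_
  -- On the unit ball |⟪ν, y⟫| ≤ 1, so the first absolute moment dominates the second moment, which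
  -- is `bumpInt d`.
  by_cases hy : ‖y‖ ≤ 1
  · refine mul_le_mul_of_nonneg_left ?_ (bumpKer_nonneg y)
    have h1 : |⟪ν, y⟫_ℝ| ≤ 1 := by
      refine (abs_real_inner_le_norm ν y).trans ?_
      rw [hν]; linarith
    simp only [ContinuousLinearMap.smulRight_apply, innerSL_apply_apply,
        _root_.smul_apply, smul_eq_mul]
    nlinarith [abs_nonneg (⟪ν, y⟫_ℝ), abs_mul_abs_self (⟪ν, y⟫_ℝ)]
  · simp [bumpKer_eq_zero (le_of_not_ge hy)]

end

section

/-! ### Piecewise polynomial fields on an element -/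

lemma exists_eq_single_add {m : Fin d →₀ ℕ} (hm : m ≠ 0) :
    ∃ i m', m = Finsupp.single i 1 + m' ∧ m.degree = m'.degree + 1 := by
  obtain ⟨i, hi⟩ := Finsupp.ne_iff.1 hm
  have h : m = Finsupp.single i 1 + (m - Finsupp.single i 1) :=
    (add_tsub_cancel_of_le (by
      rw [Finsupp.single_le_iff]; simp only [Finsupp.coe_zero, Pi.zero_apply] at hi; omega)).symm
  refine ⟨i, _, h, ?_⟩
  conv_lhs => rw [h]
  rw [map_add, Finsupp.degree_single, add_comm]

/-- Reduces a claim about polynomials to sums and monomials. The function is first replaced by one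
defined by the polynomial everywhere, since `IsPolyOn` says nothing off `S`. -/
lemma isPolyOn_induction {k : ℕ} {S : Set (Vec d)} {f : Vec d → ℝ} (hf : IsPolyOn k S f)
    {p : (Vec d → ℝ) → Prop} (h0 : p 0) (hadd : ∀ g h, p g → p h → p (g + h))
    (hmon : ∀ (m : Fin d →₀ ℕ) (c : ℝ), m.degree ≤ k → p fun x => c * m.prod fun i e => x i ^ e) :
    ∃ g, p g ∧ Set.EqOn f g S := by
  obtain ⟨q, hq, hfq⟩ := hf
  refine ⟨fun x => MvPolynomial.eval (fun i => x i) q, ?_, hfq⟩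
  have hsum : (fun x : Vec d => MvPolynomial.eval (fun i => x i) q) =
      ∑ m ∈ q.support, fun x : Vec d => q.coeff m * m.prod fun i e => x i ^ e := by
    ext x
    rw [MvPolynomial.eval_eq, Finset.sum_apply]
    refine Finset.sum_congr rfl fun m _ => rfl
  rw [hsum]
  refine Finset.sum_induction _ p hadd h0 fun m hm => hmon m _ ?_
  refine le_trans ?_ hq
  have := MvPolynomial.le_totalDegree hm
  simpa only [Finsupp.degree_apply, Finsupp.sum] using this

lemma monomial_degree_zero {m : Fin d →₀ ℕ} (hm : m.degree ≤ 0) :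
    (fun x : Vec d => m.prod fun i e => x i ^ e) = fun _ => 1 := by
  have : m = 0 := (Finsupp.degree_eq_zero_iff m).1 (by omega)
  subst this; simp

lemma monomial_succ (i : Fin d) (m : Fin d →₀ ℕ) (x : Vec d) :
    ((Finsupp.single i 1 + m).prod fun i e => x i ^ e) = x i * m.prod fun i e => x i ^ e := by
  rw [Finsupp.prod_add_index' (by simp) (by intros; rw [pow_add])]
  simp

lemma monomial_degree_one {m : Fin d →₀ ℕ} (hm : m.degree ≤ 1) :
    ∃ (c : ℝ) (L : Vec d →L[ℝ] ℝ), ∀ x : Vec d, (m.prod fun i e => x i ^ e) = c + L x := by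
  by_cases h0 : m = 0
  · exact ⟨1, 0, by subst h0; simp⟩
  obtain ⟨i, m', rfl, hd⟩ := exists_eq_single_add h0
  have h1 := monomial_degree_zero (m := m') (by omega)
  refine ⟨0, EuclideanSpace.proj i, fun x => ?_⟩
  rw [monomial_succ, congrFun h1 x]
  simp

lemma monomial_degree_two {m : Fin d →₀ ℕ} (hm : m.degree ≤ 2) :
    ∃ (c : ℝ) (L : Vec d →L[ℝ] ℝ) (Q : Vec d →L[ℝ] Vec d →L[ℝ] ℝ),
      ∀ x : Vec d, (m.prod fun i e => x i ^ e) = c + L x + Q x x := by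
  by_cases h0 : m = 0
  · exact ⟨1, 0, 0, by subst h0; simp⟩
  obtain ⟨i, m', rfl, hd⟩ := exists_eq_single_add h0
  obtain ⟨c, L, h1⟩ := monomial_degree_one (m := m') (by omega)
  refine ⟨0, c • EuclideanSpace.proj i, ContinuousLinearMap.smulRight
    (EuclideanSpace.proj i : Vec d →L[ℝ] ℝ) L, fun x => ?_⟩
  rw [monomial_succ, h1 x]
  simp; ring

lemma IsPolyOn.exists_affine {S : Set (Vec d)} {f : Vec d → ℝ} (hf : IsPolyOn 1 S f) :
    ∃ (c : ℝ) (b : Vec d), ∀ x ∈ S, f x = c + ⟪b, x⟫_ℝ := by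
  obtain ⟨g, ⟨c, L, hg⟩, hfg⟩ := isPolyOn_induction hf
    (p := fun g => ∃ (c : ℝ) (L : Vec d →L[ℝ] ℝ), ∀ x, g x = c + L x)
    ⟨0, 0, by simp⟩
    (by
      rintro g h ⟨c, L, hg⟩ ⟨c', L', hh⟩
      exact ⟨c + c', L + L', fun x => by simp [hg, hh]; ring⟩)
    (by
      intro m a hm
      obtain ⟨c, L, h⟩ := monomial_degree_one hm
      exact ⟨a * c, a • L, fun x => by simp [h]; ring⟩)
  refine ⟨c, (InnerProductSpace.toDual ℝ (Vec d)).symm L, fun x hx => ?_⟩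
  rw [hfg hx, hg, InnerProductSpace.toDual_symm_apply]

lemma IsPolyOn.exists_quadratic {S : Set (Vec d)} {f : Vec d → ℝ} (hf : IsPolyOn 2 S f) :
    ∃ (c : ℝ) (L : Vec d →L[ℝ] ℝ) (Q : Vec d →L[ℝ] Vec d →L[ℝ] ℝ),
      ∀ x ∈ S, f x = c + L x + Q x x := by
  obtain ⟨g, ⟨c, L, Q, hg⟩, hfg⟩ := isPolyOn_induction hf
    (p := fun g => ∃ (c : ℝ) (L : Vec d →L[ℝ] ℝ) (Q : Vec d →L[ℝ] Vec d →L[ℝ] ℝ),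
      ∀ x, g x = c + L x + Q x x)
    ⟨0, 0, 0, by simp⟩
    (by
      rintro g h ⟨c, L, Q, hg⟩ ⟨c', L', Q', hh⟩
      exact ⟨c + c', L + L', Q + Q', fun x => by simp [hg, hh]; ring⟩)
    (by
      intro m a hm
      obtain ⟨c, L, Q, h⟩ := monomial_degree_two hm
      exact ⟨a * c, a • L, a • Q, fun x => by simp [h]; ring⟩)
  exact ⟨c, L, Q, fun x hx => by rw [hfg hx, hg]⟩

/-- On `S` the field `v` is given by `P`, whose derivative at `x` is `A + B x`. -/
structure IsQuadOn (S : Set (Vec d)) (v P : Vec d → Vec d) (A : Vec d →L[ℝ] Vec d)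
    (B : Vec d →L[ℝ] Vec d →L[ℝ] Vec d) : Prop where
  hasFDerivAt : ∀ x, HasFDerivAt P (A + B x) x
  symm : ∀ x u, B x u = B u x
  eqOn : Set.EqOn v P S

/-- The form `Q x x` has derivative `Q x + Q.flip x`, so taking B = Q + Qᵗ componentwise makes it
symmetric; B is the constant second derivative. -/
lemma exists_isQuadOn {S : Set (Vec d)} {v : Vec d → Vec d}
    (hv : ∀ i, IsPolyOn 2 S (fun x => v x i)) : ∃ P A B, IsQuadOn S v P A B := by
  choose c L Q h using fun i => (hv i).exists_quadratic
  refine ⟨fun x => ∑ i, (c i + L i x + Q i x x) • basisVec i, ∑ i, (L i).smulRight (basisVec i),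
    ∑ i, ((ContinuousLinearMap.smulRightL ℝ (Vec d) (Vec d)).flip (basisVec i)).comp
      (Q i + (Q i).flip), fun x => ?_, fun x u => ?_, fun x hx => ?_⟩
  · have h1 : ∀ i, HasFDerivAt (fun x => (c i + L i x + Q i x x) • (basisVec i : Vec d))
        ((L i + (Q i + (Q i).flip) x).smulRight (basisVec i)) x := by
      intro i
      have h2 : HasFDerivAt (fun x => Q i x x) ((Q i + (Q i).flip) x) x := by
        refine ((Q i).hasFDerivAt.clm_apply (hasFDerivAt_id x)).congr_fderiv ?_
        ext u; simp
      exact ((((L i).hasFDerivAt).const_add (c i)).add h2).smul_const (basisVec i)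
    refine (HasFDerivAt.fun_sum fun i _ => h1 i).congr_fderiv ?_
    ext u j
    simp [Finset.sum_add_distrib, add_smul]
  · simp [add_comm]
  · ext j
    have := h j x hx
    simp only at this
    simp [this, basisVec, Pi.single_apply]

namespace IsQuadOn

variable {S : Set (Vec d)} {v P : Vec d → Vec d} {A : Vec d →L[ℝ] Vec d}
  {B : Vec d →L[ℝ] Vec d →L[ℝ] Vec d}

lemma fderiv_eq (h : IsQuadOn S v P A B) : fderiv ℝ P = fun x => A + B x :=
  funext fun x => (h.hasFDerivAt x).fderiv

lemma contDiff (h : IsQuadOn S v P A B) : ContDiff ℝ 2 P := by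
  rw [show (2 : WithTop ℕ∞) = 1 + 1 by norm_num, contDiff_succ_iff_fderiv]
  refine ⟨fun x => (h.hasFDerivAt x).differentiableAt, by simp, ?_⟩
  rw [h.fderiv_eq]
  exact contDiff_const.add B.contDiff

lemma fderivWithin_eq (h : IsQuadOn S v P A B) (hS : UniqueDiffOn ℝ S) {x : Vec d} (hx : x ∈ S) :
    fderivWithin ℝ v S x = A + B x := by
  rw [fderivWithin_congr h.eqOn (h.eqOn hx)]
  exact (h.hasFDerivAt x).hasFDerivWithinAt.fderivWithin (hS x hx)

lemma fderiv_eq_of_mem_interior (h : IsQuadOn S v P A B) {x : Vec d} (hx : x ∈ interior S) :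
    fderiv ℝ v x = A + B x := by
  have : v =ᶠ[𝓝 x] P := by
    filter_upwards [mem_interior_iff_mem_nhds.1 hx] with y hy using h.eqOn hy
  rw [this.fderiv_eq, h.fderiv_eq]

lemma laplacianWithin_eq (h : IsQuadOn S v P A B) (hS : UniqueDiffOn ℝ S) {x : Vec d}
    (hx : x ∈ S) :
    InnerProductSpace.laplacianWithin v S x = ∑ i, B (basisVec i) (basisVec i) := by
  rw [InnerProductSpace.laplacianWithin_eq_iteratedFDerivWithin_orthonormalBasis v hS hx
    (EuclideanSpace.basisFun (Fin d) ℝ)]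
  refine Finset.sum_congr rfl fun i _ => ?_
  rw [iteratedFDerivWithin_congr h.eqOn hx,
    iteratedFDerivWithin_eq_iteratedFDeriv hS h.contDiff.contDiffAt hx, iteratedFDeriv_two_apply,
    h.fderiv_eq, fderiv_const_add, B.fderiv]
  simp [basisVec]

end IsQuadOn

lemma gradientWithin_eq_of_affine {S : Set (Vec d)} {q : Vec d → ℝ} {c : ℝ} {b : Vec d}
    (h : ∀ x ∈ S, q x = c + ⟪b, x⟫_ℝ) (hS : UniqueDiffOn ℝ S) {x : Vec d} (hx : x ∈ S) :
    gradientWithin q S x = b := by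
  have h1 : fderivWithin ℝ q S x = innerSL ℝ b := by
    rw [fderivWithin_congr (f := fun x => c + ⟪b, x⟫_ℝ) h (h x hx)]
    exact (((innerSL ℝ b).hasFDerivAt).const_add c).hasFDerivWithinAt.fderivWithin (hS x hx)
  rw [gradientWithin, h1]
  exact (InnerProductSpace.toDual ℝ (Vec d)).symm_apply_apply b

end

section

/-! ### Testing the residual with scaled bump functions -/

/-- The field `bump ((x - x₀) / s) • a`. -/
def bumpField (x₀ : Vec d) (s : ℝ) (a x : Vec d) : Vec d := bump (s⁻¹ • (x - x₀)) • a

/-- The tensor of a linear map: the gradient of a field with that derivative. -/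
def tensOf (L : Vec d →L[ℝ] Vec d) : Tens d := WithLp.toLp 2 fun j => L (basisVec j)

lemma grad_eq_tensOf (v : Vec d → Vec d) (x : Vec d) : grad v x = tensOf (fderiv ℝ v x) := rfl

lemma inner_tens (A B : Tens d) : ⟪A, B⟫_ℝ = ∑ j, ⟪A j, B j⟫_ℝ := PiLp.inner_apply A B

lemma norm_sq_tens (A : Tens d) : ‖A‖ ^ 2 = ∑ j, ‖A j‖ ^ 2 := PiLp.norm_sq_eq_of_L2 _ A

lemma norm_tensOf_le {L : Vec d →L[ℝ] Vec d} {M : ℝ} (hM : 0 ≤ M) (h : ∀ u, ‖L u‖ ≤ M * ‖u‖) :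
    ‖tensOf L‖ ≤ d * M := by
  have h1 : ‖tensOf L‖ ^ 2 ≤ (d * M) ^ 2 := by
    rw [norm_sq_tens]
    have h2 : ∀ j ∈ Finset.univ, ‖tensOf L j‖ ^ 2 ≤ M ^ 2 := by
      intro j _
      have := h (basisVec j)
      rw [norm_basisVec, mul_one] at this
      exact pow_le_pow_left₀ (norm_nonneg _) this 2
    refine (Finset.sum_le_card_nsmul _ _ _ h2).trans ?_
    rw [Finset.card_univ, Fintype.card_fin, nsmul_eq_mul, mul_pow]
    refine mul_le_mul_of_nonneg_right ?_ (by positivity)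
    norm_cast
    exact Nat.le_self_pow two_ne_zero d
  exact (sq_le_sq₀ (norm_nonneg _) (by positivity)).1 h1

lemma abs_tr_le (A : Tens d) : |tr A| ≤ d * ‖A‖ := by
  unfold tr
  refine (Finset.abs_sum_le_sum_abs _ _).trans ?_
  have h : ∀ j ∈ Finset.univ, |(A j) j| ≤ ‖A‖ := by
    intro j _
    have h1 : ‖(A j) j‖ ≤ ‖A j‖ := PiLp.norm_apply_le (A j) j
    have h2 : ‖A j‖ ≤ ‖A‖ := PiLp.norm_apply_le A j
    exact h1.trans h2
  refine (Finset.sum_le_card_nsmul _ _ _ h).trans ?_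
  simp

lemma tr_sub (A B : Tens d) : tr (A - B) = tr A - tr B := by
  simp [tr, Finset.sum_sub_distrib]

lemma continuous_tr : Continuous (tr : Tens d → ℝ) := by
  unfold tr; fun_prop

/-! ### Scaled bump fields and their gradients. -/

section bumpField

variable {x₀ : Vec d} {s : ℝ} {a : Vec d}

lemma hasFDerivAt_bumpField (x₀ : Vec d) (s : ℝ) (a x : Vec d) :
    HasFDerivAt (bumpField x₀ s a)
      ((-(s⁻¹ * bumpKer (s⁻¹ • (x - x₀))) • innerSL ℝ (s⁻¹ • (x - x₀))).smulRight a) x := by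
  have h1 : HasFDerivAt (fun x => s⁻¹ • (x - x₀)) (s⁻¹ • ContinuousLinearMap.id ℝ (Vec d)) x :=
    ((hasFDerivAt_id x).sub_const x₀).const_smul s⁻¹
  refine (((hasFDerivAt_bump _).comp x h1).smul_const a).congr_fderiv ?_
  ext u
  simp
  left
  ring

lemma grad_bumpField (x₀ : Vec d) (s : ℝ) (a x : Vec d) :
    grad (bumpField x₀ s a) x = WithLp.toLp 2 fun j =>
      (-(s⁻¹ * bumpKer (s⁻¹ • (x - x₀))) * (s⁻¹ • (x - x₀)) j) • a := by
  rw [grad, (hasFDerivAt_bumpField x₀ s a x).fderiv]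
  ext j
  simp [basisVec, EuclideanSpace.inner_single_right]

lemma inner_grad_bumpField (L : Vec d →L[ℝ] Vec d) (x : Vec d) :
    ⟪grad (bumpField x₀ s a) x, tensOf L⟫_ℝ =
      -(s⁻¹ * bumpKer (s⁻¹ • (x - x₀))) * ⟪a, L (s⁻¹ • (x - x₀))⟫_ℝ := by
  rw [grad_bumpField, inner_tens]
  set y := s⁻¹ • (x - x₀)
  have hy : ⟪a, L y⟫_ℝ = ∑ j, y j * ⟪a, L (basisVec j)⟫_ℝ := by
    conv_lhs => rw [← sum_smul_basisVec y]
    simp only [map_sum, inner_sum, map_smul, inner_smul_right]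
  rw [hy, Finset.mul_sum]
  refine Finset.sum_congr rfl fun j _ => ?_
  simp only [tensOf, inner_smul_left]
  simp
  ring

lemma tr_grad_bumpField (x : Vec d) :
    tr (grad (bumpField x₀ s a) x) =
      -(s⁻¹ * bumpKer (s⁻¹ • (x - x₀))) * ⟪a, s⁻¹ • (x - x₀)⟫_ℝ := by
  rw [grad_bumpField, tr, PiLp.inner_apply, Finset.mul_sum]
  refine Finset.sum_congr rfl fun j _ => ?_
  simp
  ring

lemma norm_grad_bumpField (hs : 0 < s) (x : Vec d) :
    ‖grad (bumpField x₀ s a) x‖ =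
      s⁻¹ * (bumpKer (s⁻¹ • (x - x₀)) * ‖s⁻¹ • (x - x₀)‖) * ‖a‖ := by
  have hk := bumpKer_nonneg (s⁻¹ • (x - x₀))
  refine (sq_eq_sq₀ (norm_nonneg _) (by positivity)).1 ?_
  rw [grad_bumpField, norm_sq_tens]
  set y := s⁻¹ • (x - x₀)
  rw [mul_pow, mul_pow, mul_pow, EuclideanSpace.norm_sq_eq y]
  simp only [norm_smul, mul_pow, norm_mul, Finset.mul_sum, Finset.sum_mul, Real.norm_eq_abs,
    sq_abs, neg_sq]
  refine Finset.sum_congr rfl fun j _ => ?_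
  ring

lemma norm_grad_bumpField_le (hs : 0 < s) {C : ℝ} (hC : ∀ y : Vec d, bumpKer y * ‖y‖ ≤ C)
    (x : Vec d) : ‖grad (bumpField x₀ s a) x‖ ≤ C * ‖a‖ / s := by
  rw [norm_grad_bumpField hs]
  have := hC (s⁻¹ • (x - x₀))
  calc s⁻¹ * (bumpKer (s⁻¹ • (x - x₀)) * ‖s⁻¹ • (x - x₀)‖) * ‖a‖ ≤ s⁻¹ * C * ‖a‖ := by gcongr
    _ = C * ‖a‖ / s := by ring

lemma one_le_norm_of_notMem_ball (hs : 0 < s) {x : Vec d} (hx : x ∉ Metric.ball x₀ s) :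
    1 ≤ ‖s⁻¹ • (x - x₀)‖ := by
  rw [Metric.mem_ball, dist_eq_norm, not_lt] at hx
  rw [norm_smul, Real.norm_of_nonneg (by positivity)]
  rw [inv_mul_eq_div, le_div_iff₀ hs]; linarith

lemma bumpField_eq_zero (hs : 0 < s) {x : Vec d} (hx : x ∉ Metric.ball x₀ s) :
    bumpField x₀ s a x = 0 := by
  rw [bumpField, bump_eq_zero (one_le_norm_of_notMem_ball hs hx), zero_smul]

lemma grad_bumpField_eq_zero (hs : 0 < s) {x : Vec d} (hx : x ∉ Metric.ball x₀ s) :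
    grad (bumpField x₀ s a) x = 0 := by
  rw [← norm_eq_zero, norm_grad_bumpField hs,
    bumpKer_eq_zero (one_le_norm_of_notMem_ball hs hx)]
  simp

lemma bumpField_center : bumpField x₀ s a x₀ = a := by simp [bumpField, bump_zero]

lemma tsupport_bumpField_subset (hs : 0 < s) :
    tsupport (bumpField x₀ s a) ⊆ Metric.closedBall x₀ s := by
  refine closure_minimal (fun x hx => ?_) Metric.isClosed_closedBall
  by_contra h
  exact hx (bumpField_eq_zero hs fun h' => h (Metric.ball_subset_closedBall h'))

lemma isTest_bumpField (hs : 0 < s) {Ω : Set (Vec d)} (h : Metric.closedBall x₀ s ⊆ Ω) :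
    IsTest Ω (bumpField x₀ s a) := by
  refine ⟨?_, ?_, (tsupport_bumpField_subset hs).trans h⟩
  · have h1 : ContDiff ℝ ((⊤ : ℕ∞) : WithTop ℕ∞) fun x : Vec d => s⁻¹ • (x - x₀) :=
      (contDiff_id.sub contDiff_const).const_smul s⁻¹
    exact (contDiff_bump.comp h1).smul contDiff_const
  · exact (isCompact_closedBall x₀ s).of_isClosed_subset (isClosed_tsupport _)
      (tsupport_bumpField_subset hs)

end bumpField

/-! ### Exact values of the weak residual. -/

/-- The weak residual of the pair `(z, r)` in the adjoint momentum equation, tested with `w`. -/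
def weakResidual (Ω : Set (Vec d)) (z : Vec d → Vec d) (r : Vec d → ℝ) (w : Vec d → Vec d) : ℝ :=
  ∫ x in Ω, (⟪grad w x, grad z x⟫_ℝ + r x * tr (grad w x))

lemma integral_comp_scale (f : Vec d → ℝ) (x₀ : Vec d) {s : ℝ} (hs : 0 < s) :
    ∫ x, f (s⁻¹ • (x - x₀)) = s ^ d * ∫ y, f y := by
  rw [integral_sub_right_eq_self (fun x => f (s⁻¹ • x)) x₀,
    Measure.integral_comp_inv_smul_of_nonneg _ _ hs.le]
  simp

/-- The bilinear form `(y, y') ↦ ⟪a, B y y'⟫ + ⟪b, y⟫ ⟪a, y'⟫`. -/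
def residualForm (a : Vec d) (B : Vec d →L[ℝ] Vec d →L[ℝ] Vec d) (b : Vec d) :
    Vec d →L[ℝ] Vec d →L[ℝ] ℝ :=
  ((ContinuousLinearMap.compL ℝ (Vec d) (Vec d) ℝ) (innerSL ℝ a)).comp B +
    (innerSL ℝ b).smulRight (innerSL ℝ a)

lemma residualForm_apply (a : Vec d) (B : Vec d →L[ℝ] Vec d →L[ℝ] Vec d) (b y y' : Vec d) :
    residualForm a B b y y' = ⟪a, B y y'⟫_ℝ + ⟪b, y⟫_ℝ * ⟪a, y'⟫_ℝ := by
  simp [residualForm]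

/-- The strong residual `Δz + ∇r` of a quadratic field and an affine function. -/
def strongResidual (B : Vec d →L[ℝ] Vec d →L[ℝ] Vec d) (b : Vec d) : Vec d :=
  ∑ i, B (basisVec i) (basisVec i) + b

lemma sum_residualForm (a : Vec d) (B : Vec d →L[ℝ] Vec d →L[ℝ] Vec d) (b : Vec d) :
    ∑ i, residualForm a B b (basisVec i) (basisVec i) = ⟪a, strongResidual B b⟫_ℝ := by
  simp only [residualForm_apply, inner_basisVec, strongResidual, inner_add_right, inner_sum,
    Finset.sum_add_distrib]
  congr 1

lemma integral_bumpKer_residualForm (a : Vec d) (B : Vec d →L[ℝ] Vec d →L[ℝ] Vec d) (b : Vec d) :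
    ∫ y, bumpKer y * residualForm a B b y y = ⟪a, strongResidual B b⟫_ℝ * bumpInt d := by
  rw [integral_bumpKer_mul_bilin, sum_residualForm]

lemma integral_bumpKer_odd (L : Vec d →L[ℝ] ℝ) : ∫ y, bumpKer y * L y = 0 :=
  integral_eq_zero_of_odd fun y => by simp [bumpKer_neg]

/-- The integrand of the weak residual on an element, in scaled coordinates. -/
lemma residual_integrand {S : Set (Vec d)} {z P : Vec d → Vec d} {A : Vec d →L[ℝ] Vec d}
    {B : Vec d →L[ℝ] Vec d →L[ℝ] Vec d} (hz : IsQuadOn S z P A B) {r : Vec d → ℝ} {c : ℝ}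
    {b : Vec d} (hr : ∀ x ∈ S, r x = c + ⟪b, x⟫_ℝ) {x₀ : Vec d} {s : ℝ} (hs : 0 < s) (a : Vec d)
    {x : Vec d} (hx : x ∈ interior S) :
    ⟪grad (bumpField x₀ s a) x, grad z x⟫_ℝ + r x * tr (grad (bumpField x₀ s a) x) =
      -s⁻¹ * (bumpKer (s⁻¹ • (x - x₀)) * (⟪a, (A + B x₀) (s⁻¹ • (x - x₀))⟫_ℝ +
        (c + ⟪b, x₀⟫_ℝ) * ⟪a, s⁻¹ • (x - x₀)⟫_ℝ +
        s * residualForm a B b (s⁻¹ • (x - x₀)) (s⁻¹ • (x - x₀)))) := by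
  rw [grad_eq_tensOf z, hz.fderiv_eq_of_mem_interior hx, inner_grad_bumpField, tr_grad_bumpField,
    hr x (interior_subset hx), residualForm_apply]
  have hx' : x = x₀ + s • (s⁻¹ • (x - x₀)) := by
    rw [smul_smul, mul_inv_cancel₀ hs.ne']; simp
  generalize s⁻¹ • (x - x₀) = y at *
  subst hx'
  simp [inner_add_right, inner_smul_right]
  ring

/-- The gradient of the bump vanishes off the ball, so the integral extends to the whole space and
the substitution y = (x - x₀)/s applies. The formula for the integrand is required only almost
everywhere, because at a side it is not available on the hyperplane. -/
lemma integral_residual_eq {Ω : Set (Vec d)} {x₀ : Vec d} {s : ℝ} (hs : 0 < s) (a : Vec d)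
    (hΩ : Metric.ball x₀ s ⊆ Ω) (z : Vec d → Vec d) (r : Vec d → ℝ) (g : Vec d → ℝ)
    (hg : ∀ᵐ x, x ∈ Metric.ball x₀ s →
      ⟪grad (bumpField x₀ s a) x, grad z x⟫_ℝ + r x * tr (grad (bumpField x₀ s a) x) =
        -s⁻¹ * (bumpKer (s⁻¹ • (x - x₀)) * g (s⁻¹ • (x - x₀)))) :
    weakResidual Ω z r (bumpField x₀ s a) = -(s ^ d * s⁻¹) * ∫ y, bumpKer y * g y := by
  rw [weakResidual, setIntegral_eq_integral_of_forall_compl_eq_zero]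
  · have : ∀ᵐ x, ⟪grad (bumpField x₀ s a) x, grad z x⟫_ℝ + r x * tr (grad (bumpField x₀ s a) x) =
        -s⁻¹ * (bumpKer (s⁻¹ • (x - x₀)) * g (s⁻¹ • (x - x₀))) := by
      filter_upwards [hg] with x hx
      by_cases h : x ∈ Metric.ball x₀ s
      · exact hx h
      · rw [grad_bumpField_eq_zero hs h, bumpKer_eq_zero (one_le_norm_of_notMem_ball hs h)]
        simp [tr]
    rw [integral_congr_ae this, integral_const_mul,
      integral_comp_scale (fun y => bumpKer y * g y) x₀ hs]
    ring
  · intro x hx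
    rw [grad_bumpField_eq_zero hs fun h => hx (hΩ h)]
    simp [tr]

/-- The weak residual for a bump inside one element. -/
lemma weakResidual_interior {Ω S : Set (Vec d)} {z P : Vec d → Vec d} {A : Vec d →L[ℝ] Vec d}
    {B : Vec d →L[ℝ] Vec d →L[ℝ] Vec d} (hz : IsQuadOn S z P A B) {r : Vec d → ℝ} {c : ℝ}
    {b : Vec d} (hr : ∀ x ∈ S, r x = c + ⟪b, x⟫_ℝ) {x₀ : Vec d} {s : ℝ} (hs : 0 < s) (a : Vec d)
    (hS : Metric.ball x₀ s ⊆ S) (hΩ : Metric.ball x₀ s ⊆ Ω) :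
    weakResidual Ω z r (bumpField x₀ s a) = -(s ^ d * bumpInt d) * ⟪a, strongResidual B b⟫_ℝ := by
  rw [integral_residual_eq hs a hΩ z r (fun y => ⟪a, (A + B x₀) y⟫_ℝ +
        (c + ⟪b, x₀⟫_ℝ) * ⟪a, y⟫_ℝ + s * residualForm a B b y y)
    (Eventually.of_forall fun x hx => residual_integrand hz hr hs a
      (interior_maximal hS Metric.isOpen_ball hx))]
  -- The linear part is odd against an even kernel and integrates to zero; the quadratic part
  -- contributes its trace.
  have h1 : ∀ y, bumpKer y * (⟪a, (A + B x₀) y⟫_ℝ + (c + ⟪b, x₀⟫_ℝ) * ⟪a, y⟫_ℝ +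
      s * residualForm a B b y y) =
      bumpKer y * ((innerSL ℝ a).comp (A + B x₀) + (c + ⟪b, x₀⟫_ℝ) • innerSL ℝ a) y +
        s * (bumpKer y * residualForm a B b y y) := by
    intro y; simp [inner_add_right]; ring
  simp_rw [h1]
  rw [integral_add, integral_bumpKer_odd, integral_const_mul, integral_bumpKer_residualForm]
  · field_simp
    ring
  · exact integrable_bumpKer_mul (by fun_prop)
  · exact (integrable_bumpKer_mul (by fun_prop)).const_mul s

lemma volume_hyperplane {ν : Vec d} (hν : ‖ν‖ = 1) (x₀ : Vec d) :
    ∀ᵐ x : Vec d, ⟪ν, x - x₀⟫_ℝ ≠ 0 := by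
  have h : ∀ᵐ x : Vec d, ⟪ν, x⟫_ℝ ≠ 0 := by
    have := Measure.addHaar_submodule (volume : Measure (Vec d)) (LinearMap.ker (innerSL ℝ ν).toLinearMap)
      (by
        intro h
        have h1 : ν ∈ LinearMap.ker (innerSL ℝ ν).toLinearMap := by rw [h]; trivial
        simp at h1
        rw [h1] at hν; simp at hν)
    rw [ae_iff]
    convert this using 2
    ext x; simp
  exact (measurePreserving_sub_right volume x₀).quasiMeasurePreserving.ae h

lemma measurable_sign : Measurable Real.sign := by
  unfold Real.sign
  exact Measurable.ite measurableSet_Iio measurable_const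
    (Measurable.ite measurableSet_Ioi measurable_const measurable_const)

lemma abs_sign_le_one (t : ℝ) : |Real.sign t| ≤ 1 := by
  rcases lt_trichotomy t 0 with h | h | h
  · simp [Real.sign_of_neg h]
  · simp [h]
  · simp [Real.sign_of_pos h]

/-- The weak residual for a bump centred on the side between two elements. -/
lemma weakResidual_side {Ω S₁ S₂ : Set (Vec d)} {z P₁ P₂ : Vec d → Vec d}
    {A₁ A₂ : Vec d →L[ℝ] Vec d} {B₁ B₂ : Vec d →L[ℝ] Vec d →L[ℝ] Vec d}
    (hz₁ : IsQuadOn S₁ z P₁ A₁ B₁) (hz₂ : IsQuadOn S₂ z P₂ A₂ B₂)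
    {r : Vec d → ℝ} {c₁ c₂ : ℝ} {b₁ b₂ : Vec d} (hr₁ : ∀ x ∈ S₁, r x = c₁ + ⟪b₁, x⟫_ℝ)
    (hr₂ : ∀ x ∈ S₂, r x = c₂ + ⟪b₂, x⟫_ℝ) {x₀ : Vec d} {s : ℝ} (hs : 0 < s) (a : Vec d)
    {ν J : Vec d} (hν : ‖ν‖ = 1)
    (hS₁ : ∀ x ∈ Metric.ball x₀ s, ⟪ν, x - x₀⟫_ℝ < 0 → x ∈ S₁)
    (hS₂ : ∀ x ∈ Metric.ball x₀ s, 0 < ⟪ν, x - x₀⟫_ℝ → x ∈ S₂)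
    (hr₀ : c₁ + ⟪b₁, x₀⟫_ℝ = c₂ + ⟪b₂, x₀⟫_ℝ)
    (hJ : ∀ u, (A₂ + B₂ x₀) u - (A₁ + B₁ x₀) u = ⟪ν, u⟫_ℝ • J) (hΩ : Metric.ball x₀ s ⊆ Ω) :
    weakResidual Ω z r (bumpField x₀ s a) = -(s ^ d * s⁻¹) *
      (⟪a, J⟫_ℝ / 2 * (∫ y, bumpKer y * |⟪ν, y⟫_ℝ|) +
        s / 2 * bumpInt d * (⟪a, strongResidual B₁ b₁⟫_ℝ + ⟪a, strongResidual B₂ b₂⟫_ℝ)) := by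
  set L : Vec d →L[ℝ] ℝ := (innerSL ℝ a).comp (A₁ + B₁ x₀) + (c₁ + ⟪b₁, x₀⟫_ℝ) • innerSL ℝ a with hL
  set L₂ : Vec d →L[ℝ] ℝ := (innerSL ℝ a).comp (A₂ + B₂ x₀) + (c₁ + ⟪b₁, x₀⟫_ℝ) • innerSL ℝ a
    with hL₂
  set Q₁ := residualForm a B₁ b₁ with hQ₁
  set Q₂ := residualForm a B₂ b₂ with hQ₂
  have hopen : IsOpen {x : Vec d | ⟪ν, x - x₀⟫_ℝ < 0} :=
    isOpen_lt (by fun_prop) continuous_const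
  have hopen' : IsOpen {x : Vec d | 0 < ⟪ν, x - x₀⟫_ℝ} :=
    isOpen_lt continuous_const (by fun_prop)
  have hLd : ∀ y, L₂ y - L y = ⟪ν, y⟫_ℝ * ⟪a, J⟫_ℝ := by
    intro y
    have := congrArg (fun v => ⟪a, v⟫_ℝ) (hJ y)
    simp only [inner_sub_right, inner_smul_right] at this
    rw [← this]
    simp [hL, hL₂, inner_add_right]
  -- The two one-sided integrands are merged into half their sum plus `sign ⟪ν, y⟫` times half their
  -- difference. The sum of the linear parts and the sign times the quadratic difference are odd and
  -- disappear; the difference of the linear parts becomes |⟪ν, y⟫| times the jump and survives.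
  rw [integral_residual_eq hs a hΩ z r (fun y => (L y + L₂ y) / 2 + s / 2 * (Q₁ y y + Q₂ y y) +
    ⟪a, J⟫_ℝ / 2 * |⟪ν, y⟫_ℝ| + Real.sign ⟪ν, y⟫_ℝ * (s / 2 * (Q₂ y y - Q₁ y y)))]
  swap
  · filter_upwards [volume_hyperplane hν x₀] with x hx hxb
    have hin : ⟪ν, s⁻¹ • (x - x₀)⟫_ℝ = s⁻¹ * ⟪ν, x - x₀⟫_ℝ := inner_smul_right _ _ _
    have hsi : 0 < s⁻¹ := inv_pos.2 hs
    rcases lt_or_gt_of_ne hx with h | h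
    · have hxS : x ∈ interior S₁ := interior_maximal (fun x hx => hS₁ x hx.1 hx.2)
        (Metric.isOpen_ball.inter hopen) ⟨hxb, h⟩
      have hneg : ⟪ν, s⁻¹ • (x - x₀)⟫_ℝ < 0 := by rw [hin]; exact mul_neg_of_pos_of_neg hsi h
      rw [residual_integrand hz₁ hr₁ hs a hxS, Real.sign_of_neg hneg, abs_of_neg hneg, ← hQ₁]
      have h1 := hLd (s⁻¹ • (x - x₀))
      have h2 : L (s⁻¹ • (x - x₀)) = ⟪a, (A₁ + B₁ x₀) (s⁻¹ • (x - x₀))⟫_ℝ +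
        (c₁ + ⟪b₁, x₀⟫_ℝ) * ⟪a, s⁻¹ • (x - x₀)⟫_ℝ := rfl
      rw [← h2]
      linear_combination (s⁻¹ * bumpKer (s⁻¹ • (x - x₀)) / 2) * h1
    · have hxS : x ∈ interior S₂ := interior_maximal (fun x hx => hS₂ x hx.1 hx.2)
        (Metric.isOpen_ball.inter hopen') ⟨hxb, h⟩
      have hpos : 0 < ⟪ν, s⁻¹ • (x - x₀)⟫_ℝ := by rw [hin]; exact mul_pos hsi h
      rw [residual_integrand hz₂ hr₂ hs a hxS, Real.sign_of_pos hpos, abs_of_pos hpos, ← hQ₂]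
      have h1 := hLd (s⁻¹ • (x - x₀))
      have h2 : L₂ (s⁻¹ • (x - x₀)) = ⟪a, (A₂ + B₂ x₀) (s⁻¹ • (x - x₀))⟫_ℝ +
        (c₂ + ⟪b₂, x₀⟫_ℝ) * ⟪a, s⁻¹ • (x - x₀)⟫_ℝ := by
        rw [← hr₀]; rfl
      rw [← h2]
      linear_combination (-s⁻¹ * bumpKer (s⁻¹ • (x - x₀)) / 2) * h1
  have h1 : ∀ y, bumpKer y * ((L y + L₂ y) / 2 + s / 2 * (Q₁ y y + Q₂ y y) +
      ⟪a, J⟫_ℝ / 2 * |⟪ν, y⟫_ℝ| + Real.sign ⟪ν, y⟫_ℝ * (s / 2 * (Q₂ y y - Q₁ y y))) =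
      bumpKer y * ((1 / 2 : ℝ) • (L + L₂)) y + (s / 2 * (bumpKer y * Q₁ y y) +
        s / 2 * (bumpKer y * Q₂ y y)) + ⟪a, J⟫_ℝ / 2 * (bumpKer y * |⟪ν, y⟫_ℝ|) +
        Real.sign ⟪ν, y⟫_ℝ * (bumpKer y * (s / 2 * (Q₂ y y - Q₁ y y))) := by
    intro y; simp; ring
  simp_rw [h1]
  have i1 : Integrable fun y => bumpKer y * ((1 / 2 : ℝ) • (L + L₂)) y :=
    integrable_bumpKer_mul (by fun_prop)
  have i2 : Integrable fun y => s / 2 * (bumpKer y * Q₁ y y) :=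
    (integrable_bumpKer_mul (by fun_prop)).const_mul _
  have i3 : Integrable fun y => s / 2 * (bumpKer y * Q₂ y y) :=
    (integrable_bumpKer_mul (by fun_prop)).const_mul _
  have i4 : Integrable fun y : Vec d => ⟪a, J⟫_ℝ / 2 * (bumpKer y * |⟪ν, y⟫_ℝ|) :=
    (integrable_bumpKer_mul (by fun_prop)).const_mul _
  have i5 : Integrable fun y =>
      Real.sign ⟪ν, y⟫_ℝ * (bumpKer y * (s / 2 * (Q₂ y y - Q₁ y y))) := by
    refine (integrable_bumpKer_mul (by fun_prop)).bdd_mul (c := 1)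
      (measurable_sign.comp (by fun_prop)).aestronglyMeasurable
      (Eventually.of_forall fun y => abs_sign_le_one _)
  rw [integral_add ?_ i5, integral_add ?_ i4, integral_add i1 ?_, integral_add i2 i3,
    integral_bumpKer_odd,
    integral_eq_zero_of_odd (f := fun y => Real.sign ⟪ν, y⟫_ℝ *
      (bumpKer y * (s / 2 * (Q₂ y y - Q₁ y y)))), integral_const_mul, integral_const_mul,
    integral_const_mul, integral_bumpKer_residualForm, integral_bumpKer_residualForm]
  · ring
  · intro y
    rw [inner_neg_right, Real.sign_neg, bumpKer_neg]
    simp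
  · exact i2.add i3
  · exact i1.add (i2.add i3)
  · exact (i1.add (i2.add i3)).add i4

end

section

/-! ### Barycentric coordinates -/

/-- A nondegenerate `d`-simplex, given by its vertices. -/
structure IsSimplex (T : Finset (Vec d)) : Prop where
  card_eq : T.card = d + 1
  affineIndependent : AffineIndependent ℝ ((↑) : T → Vec d)

/-- The vertices as an affine basis. -/
def IsSimplex.basis {T : Finset (Vec d)} (h : IsSimplex T) : AffineBasis T ℝ (Vec d) :=
  ⟨(↑), h.affineIndependent, by
    rw [h.affineIndependent.affineSpan_eq_top_iff_card_eq_finrank_add_one]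
    simp [h.card_eq]⟩

open Classical in
/-- The barycentric coordinate of `T` at the vertex `v`. -/
def bary (T : Finset (Vec d)) (v : Vec d) : Vec d →ᵃ[ℝ] ℝ :=
  if h : IsSimplex T ∧ v ∈ T then h.1.basis.coord ⟨v, h.2⟩ else 0

lemma affineMap_sum {ι : Type*} (f : Vec d →ᵃ[ℝ] ℝ) (s : Finset ι) (w : ι → ℝ) (p : ι → Vec d)
    (hw : ∑ i ∈ s, w i = 1) : f (∑ i ∈ s, w i • p i) = ∑ i ∈ s, w i * f (p i) := by
  have h : ∀ x, f x = f.linear x + f 0 := fun x => congrFun f.decomp x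
  rw [h, map_sum]
  simp_rw [fun i => h (p i), mul_add, Finset.sum_add_distrib, ← Finset.sum_mul, hw]
  simp

lemma affineMap_add (f : Vec d →ᵃ[ℝ] ℝ) (x u : Vec d) : f (x + u) = f x + f.linear u := by
  rw [add_comm x u]
  have := f.map_vadd x u
  simpa [add_comm] using this

/-- A function with values in [0, 1] changes by at most one along a diameter. The steps from the
centre have length r/2, so that both endpoints lie in the open ball. -/
lemma affineMap_lipschitz {f : Vec d →ᵃ[ℝ] ℝ} {c : Vec d} {r : ℝ} (hr : 0 < r)
    (hf : ∀ x ∈ Metric.ball c r, f x ∈ Set.Icc (0 : ℝ) 1) (x y : Vec d) :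
    |f x - f y| ≤ ‖x - y‖ / r := by
  have h0 : ∀ u : Vec d, |f.linear u| ≤ ‖u‖ / r := by
    intro u
    by_cases hu : u = 0
    · simp [hu]
    have hun : 0 < ‖u‖ := norm_pos_iff.2 hu
    set t := r / (2 * ‖u‖) with ht
    have htpos : 0 < t := by positivity
    have hnorm : ‖t • u‖ < r := by
      rw [norm_smul, Real.norm_of_nonneg htpos.le, ht]
      field_simp; norm_num
    have h1 := hf (c + t • u) (by simpa using hnorm)
    have h2 := hf (c + -(t • u)) (by simpa using hnorm)
    rw [affineMap_add] at h1 h2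
    rw [map_neg] at h2
    rw [map_smul, smul_eq_mul] at h1 h2
    have h3 : |t * f.linear u| ≤ 1 / 2 := by
      rw [abs_le]; constructor <;> linarith [h1.1, h1.2, h2.1, h2.2]
    rw [abs_mul, abs_of_pos htpos, ht] at h3
    rw [le_div_iff₀ hr]
    have h4 : r / (2 * ‖u‖) * |f.linear u| * (2 * ‖u‖) ≤ 1 / 2 * (2 * ‖u‖) := by gcongr
    have h5 : r / (2 * ‖u‖) * |f.linear u| * (2 * ‖u‖) = |f.linear u| * r := by field_simp
    linarith
  have := affineMap_add f y (x - y)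
  rw [add_sub_cancel] at this
  rw [this, add_sub_cancel_left]
  exact h0 _

namespace IsSimplex

variable {T : Finset (Vec d)} {v w x y : Vec d}

lemma bary_self (h : IsSimplex T) (hv : v ∈ T) : bary T v v = 1 := by
  rw [bary, dif_pos ⟨h, hv⟩]
  exact h.basis.coord_apply_eq ⟨v, hv⟩

lemma bary_ne (h : IsSimplex T) (hv : v ∈ T) (hw : w ∈ T) (hvw : v ≠ w) : bary T v w = 0 := by
  rw [bary, dif_pos ⟨h, hv⟩]
  exact h.basis.coord_apply_ne (i := ⟨v, hv⟩) (j := ⟨w, hw⟩) (by simpa using hvw)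

lemma sum_bary (h : IsSimplex T) (x : Vec d) : ∑ v ∈ T, bary T v x = 1 := by
  have := h.basis.sum_coord_apply_eq_one x
  rw [← Finset.sum_coe_sort]
  simpa [bary, h] using this

lemma sum_bary_smul (h : IsSimplex T) (x : Vec d) : ∑ v ∈ T, bary T v x • v = x := by
  have := h.basis.linear_combination_coord_eq_self x
  rw [← Finset.sum_coe_sort T fun v => bary T v x • v]
  refine Eq.trans ?_ this
  refine Finset.sum_congr rfl fun v _ => ?_
  simp [bary, h]
  rfl

lemma mem_hull_iff (h : IsSimplex T) : x ∈ hull T ↔ ∀ v ∈ T, 0 ≤ bary T v x := by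
  have := h.basis.convexHull_eq_nonneg_coord
  have hr : Set.range h.basis = (T : Set (Vec d)) := by
    show Set.range ((↑) : T → Vec d) = _
    simp
  rw [hr] at this
  rw [hull, this]
  simp only [Set.mem_ofPred_eq, Subtype.forall]
  refine forall₂_congr fun v hv => ?_
  rw [bary, dif_pos ⟨h, hv⟩]

lemma bary_le_one (h : IsSimplex T) (hx : x ∈ hull T) (hv : v ∈ T) : bary T v x ≤ 1 := by
  rw [← h.sum_bary x]
  exact Finset.single_le_sum (f := fun v => bary T v x) (h.mem_hull_iff.1 hx) hv

lemma bary_lipschitz (h : IsSimplex T) {c : Vec d} {r : ℝ} (hr : 0 < r)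
    (hb : Metric.ball c r ⊆ hull T) (hv : v ∈ T) (x y : Vec d) :
    |bary T v x - bary T v y| ≤ ‖x - y‖ / r :=
  affineMap_lipschitz hr (fun _ hx => ⟨h.mem_hull_iff.1 (hb hx) v hv, h.bary_le_one (hb hx) hv⟩) x y

/-- A barycentric coordinate falls from 1 to 0 along an edge and has Lipschitz constant 1/r. -/
lemma le_dist_vertices (h : IsSimplex T) {c : Vec d} {r : ℝ} (hr : 0 < r)
    (hb : Metric.ball c r ⊆ hull T) (hv : v ∈ T) (hw : w ∈ T) (hvw : v ≠ w) :
    r ≤ ‖v - w‖ := by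
  have := h.bary_lipschitz hr hb hv v w
  rw [h.bary_self hv, h.bary_ne hv hw hvw] at this
  norm_num at this
  rwa [le_div_iff₀ hr, one_mul] at this

end IsSimplex

lemma affineMap_eqOn_convexHull {f g : Vec d →ᵃ[ℝ] ℝ} {V : Set (Vec d)} (h : Set.EqOn f g V) :
    Set.EqOn f g (convexHull ℝ V) := by
  have hc : Convex ℝ {x | f x = g x} := by
    have : {x | f x = g x} = (f - g) ⁻¹' {0} := by
      ext x; simp [sub_eq_zero]
    rw [this]
    exact (convex_singleton 0).affine_preimage _
  exact convexHull_min h hc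

lemma isCompact_hull (T : Finset (Vec d)) : IsCompact (hull T) :=
  T.finite_toSet.isCompact_convexHull ℝ

lemma convex_hull' (T : Finset (Vec d)) : Convex ℝ (hull T) := convex_convexHull ℝ _

lemma subset_hull {T : Finset (Vec d)} {v : Vec d} (hv : v ∈ T) : v ∈ hull T :=
  subset_convexHull ℝ _ hv

lemma dist_le_hSize {T : Finset (Vec d)} {x y : Vec d} (hx : x ∈ hull T) (hy : y ∈ hull T) :
    dist x y ≤ hSize T :=
  Metric.dist_le_diam_of_mem (isCompact_hull T).isBounded hx hy

lemma hSize_nonneg (T : Finset (Vec d)) : 0 ≤ hSize T := Metric.diam_nonneg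

lemma IsSimplex.interior_nonempty {T : Finset (Vec d)} (h : IsSimplex T) :
    (interior (hull T)).Nonempty := by
  have := h.basis.centroid_mem_interior_convexHull
  have hr : Set.range h.basis = (T : Set (Vec d)) := by
    show Set.range ((↑) : T → Vec d) = _
    simp
  rw [hr] at this
  exact ⟨_, this⟩

lemma IsSimplex.uniqueDiffOn {T : Finset (Vec d)} (h : IsSimplex T) : UniqueDiffOn ℝ (hull T) :=
  uniqueDiffOn_convex (convex_hull' T) h.interior_nonempty

lemma centroid_eq (S : Finset (Vec d)) (hS : S.Nonempty) :
    S.centroid ℝ id = ∑ v ∈ S, (S.card : ℝ)⁻¹ • v := by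
  rw [Finset.centroid_def, Finset.affineCombination_eq_linear_combination _ _ _
    (Finset.sum_centroidWeights_eq_one_of_nonempty ℝ S hS)]
  simp

lemma affineMap_centroid (f : Vec d →ᵃ[ℝ] ℝ) (S : Finset (Vec d)) (hS : S.Nonempty) :
    f (S.centroid ℝ id) = (S.card : ℝ)⁻¹ * ∑ v ∈ S, f v := by
  rw [centroid_eq S hS, affineMap_sum, Finset.mul_sum]
  have : (S.card : ℝ) ≠ 0 := by simpa using hS.ne_empty
  simp [this]

/-! ### Two elements that share a side -/

lemma linear_eq_smul_of_ker {g₁ g₂ : Vec d} (h : ∀ u, ⟪g₁, u⟫_ℝ = 0 → ⟪g₂, u⟫_ℝ = 0) :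
    ∃ κ : ℝ, g₂ = κ • g₁ := by
  have : g₂ ∈ ((ℝ ∙ g₁)ᗮ)ᗮ := by
    rw [Submodule.mem_orthogonal]
    intro u hu
    rw [real_inner_comm]
    exact h u (Submodule.mem_orthogonal_singleton_iff_inner_right.1 hu)
  rw [Submodule.orthogonal_orthogonal, Submodule.mem_span_singleton] at this
  obtain ⟨κ, hκ⟩ := this
  exact ⟨κ, hκ.symm⟩

/-- `F` is the side of `T` opposite to the vertex `v`. -/
structure IsSide (F T : Finset (Vec d)) (v : Vec d) : Prop where
  subset : F ⊆ T
  mem : v ∈ T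
  notMem : v ∉ F
  eq_of_notMem : ∀ w ∈ T, w ∉ F → w = v

open Classical in
lemma exists_isSide {T F : Finset (Vec d)} (hT : T.card = d + 1) (hF : F ⊆ T)
    (hc : F.card = d) : ∃ v, IsSide F T v := by
  obtain ⟨v, hv⟩ := Finset.card_eq_one.1 (show (T \ F).card = 1 by
    rw [Finset.card_sdiff_of_subset hF]; omega)
  have h1 : ∀ w, w ∈ T \ F ↔ w = v := by intro w; rw [hv]; simp
  have h2 := Finset.mem_sdiff.1 ((h1 v).2 rfl)
  exact ⟨v, hF, h2.1, h2.2, fun w hw hw' => (h1 w).1 (Finset.mem_sdiff.2 ⟨hw, hw'⟩)⟩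

/-- The gradient of an affine function that vanishes at `x₀`. -/
lemma exists_gradient (f : Vec d →ᵃ[ℝ] ℝ) {x₀ : Vec d} (h : f x₀ = 0) :
    ∃ g : Vec d, ∀ x, f x = ⟪g, x - x₀⟫_ℝ := by
  refine ⟨(InnerProductSpace.toDual ℝ (Vec d)).symm (LinearMap.toContinuousLinearMap f.linear),
    fun x => ?_⟩
  rw [InnerProductSpace.toDual_symm_apply]
  have := affineMap_add f x₀ (x - x₀)
  rw [add_sub_cancel, h, zero_add] at this
  simpa using this

lemma IsSimplex.eq_sum_side {T F : Finset (Vec d)} {v : Vec d} (h : IsSimplex T)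
    (hF : IsSide F T v) {x : Vec d} (hx : bary T v x = 0) :
    ∑ w ∈ F, bary T w x • w = x ∧ ∑ w ∈ F, bary T w x = 1 := by
  have h0 : ∀ w ∈ T, w ∉ F → bary T w x = 0 := fun w hw hw' => by
    rw [hF.eq_of_notMem w hw hw', hx]
  refine ⟨?_, ?_⟩
  · refine (Finset.sum_subset hF.subset fun w hw hw' => ?_).trans (h.sum_bary_smul x)
    rw [h0 w hw hw', zero_smul]
  · rw [← h.sum_bary x]
    exact Finset.sum_subset hF.subset h0

lemma IsSimplex.bary_side {T F : Finset (Vec d)} {v w : Vec d} (h : IsSimplex T)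
    (hF : IsSide F T v) (hw : w ∈ F) : bary T v w = 0 :=
  h.bary_ne hF.mem (hF.subset hw) (by rintro rfl; exact hF.notMem hw)

lemma IsSimplex.vectorSpan_side {T F : Finset (Vec d)} {v : Vec d}
    (h : IsSimplex T) (hF : IsSide F T v) {x₀ g : Vec d}
    (hx₀ : x₀ ∈ affineSpan ℝ (F : Set (Vec d))) (hg : ∀ x, bary T v x = ⟪g, x - x₀⟫_ℝ) :
    vectorSpan ℝ (F : Set (Vec d)) = (ℝ ∙ g)ᗮ := by
  apply le_antisymm
  · rw [vectorSpan_def, Submodule.span_le]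
    rintro _ ⟨p, hp, q, hq, rfl⟩
    rw [SetLike.mem_coe, Submodule.mem_orthogonal_singleton_iff_inner_right]
    have h1 := hg p
    have h2 := hg q
    rw [h.bary_side hF hp] at h1
    rw [h.bary_side hF hq] at h2
    show ⟪g, p - q⟫_ℝ = 0
    rw [show p - q = (p - x₀) - (q - x₀) by abel, inner_sub_right, ← h1, ← h2, sub_zero]
  · intro u hu
    rw [Submodule.mem_orthogonal_singleton_iff_inner_right] at hu
    have h1 : bary T v (x₀ + u) = 0 := by rw [hg]; simpa using hu
    obtain ⟨h2, h3⟩ := h.eq_sum_side hF h1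
    have h4 : x₀ + u ∈ affineSpan ℝ (F : Set (Vec d)) := by
      have := affineCombination_mem_affineSpan_image (p := (id : Vec d → Vec d)) h3
        (s' := (F : Set (Vec d))) (fun i hi hi' => absurd hi hi')
      rw [Finset.affineCombination_eq_linear_combination _ _ _ h3] at this
      simp only [id, h2, Set.image_id'] at this
      exact this
    have h5 := AffineSubspace.vsub_mem_direction h4 hx₀
    rw [direction_affineSpan] at h5
    simpa using h5

open Classical in
/-- Two elements sharing the side `F` lie on different sides of the hyperplane of `F`. -/
lemma exists_side_normal (hd : 0 < d) {T₁ T₂ : Finset (Vec d)} (h₁ : IsSimplex T₁)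
    (h₂ : IsSimplex T₂)
    (hconf : hull T₁ ∩ hull T₂ = convexHull ℝ ((T₁ : Set (Vec d)) ∩ (T₂ : Set (Vec d))))
    (hcard : (T₁ ∩ T₂).card = d) {c₁ c₂ : Vec d} {r : ℝ} (hr : 0 < r)
    (hb₁ : Metric.ball c₁ r ⊆ hull T₁) (hb₂ : Metric.ball c₂ r ⊆ hull T₂) :
    ∃ ν x₀ : Vec d, ‖ν‖ = 1 ∧ sideNormal (T₁ ∩ T₂) T₂ = ν ∧ sideNormal (T₁ ∩ T₂) T₁ = -ν ∧
      x₀ ∈ hull (T₁ ∩ T₂) ∧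
      (∀ x, ‖x - x₀‖ ≤ r / d → ⟪ν, x - x₀⟫_ℝ ≤ 0 → x ∈ hull T₁) ∧
      (∀ x, ‖x - x₀‖ ≤ r / d → 0 ≤ ⟪ν, x - x₀⟫_ℝ → x ∈ hull T₂) ∧
      (∀ x ∈ hull (T₁ ∩ T₂), ⟪ν, x - x₀⟫_ℝ = 0) := by
  set F := T₁ ∩ T₂ with hFdef
  obtain ⟨v₁, hF₁⟩ := exists_isSide h₁.card_eq (F := F) Finset.inter_subset_left hcard
  obtain ⟨v₂, hF₂⟩ := exists_isSide h₂.card_eq (F := F) Finset.inter_subset_right hcard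
  have hFne : F.Nonempty := Finset.card_pos.1 (by omega)
  set x₀ := F.centroid ℝ id with hx₀
  have hd' : (0 : ℝ) < d := by exact_mod_cast hd
  have hzero : ∀ {T v}, IsSimplex T → IsSide F T v → bary T v x₀ = 0 := by
    intro T v hT hF
    rw [hx₀, affineMap_centroid _ _ hFne, Finset.sum_eq_zero fun w hw => hT.bary_side hF hw,
      mul_zero]
  have hinv : ∀ {T v w}, IsSimplex T → IsSide F T v → w ∈ F → bary T w x₀ = (d : ℝ)⁻¹ := by
    intro T v w hT hF hw
    rw [hx₀, affineMap_centroid _ _ hFne, hcard, Finset.sum_eq_single w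
      (fun b hb hbw => hT.bary_ne (hF.subset hw) (hF.subset hb) hbw.symm) (fun h => absurd hw h),
      hT.bary_self (hF.subset hw), mul_one]
  -- At the centroid of the side its d barycentric coordinates equal 1/d, so by the Lipschitz bound
  -- they remain nonnegative within distance r/d. There the coordinate of the opposite vertex alone
  -- decides membership.
  have hmem : ∀ {T v c}, IsSimplex T → IsSide F T v → Metric.ball c r ⊆ hull T →
      ∀ x, ‖x - x₀‖ ≤ r / d → 0 ≤ bary T v x → x ∈ hull T := by
    intro T v c hT hF hb x hx hvx
    rw [hT.mem_hull_iff]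
    intro w hw
    by_cases hwF : w ∈ F
    · have h1 := hT.bary_lipschitz hr hb hw x x₀
      rw [hinv hT hF hwF, abs_le] at h1
      have h2 : ‖x - x₀‖ / r ≤ (d : ℝ)⁻¹ := by
        rw [div_le_iff₀ hr]; rw [div_eq_inv_mul] at hx; exact hx
      linarith [h1.1]
    · rw [hF.eq_of_notMem w hw hwF]; exact hvx
  obtain ⟨g₁, hg₁⟩ := exists_gradient (bary T₁ v₁) (hzero h₁ hF₁)
  obtain ⟨g₂, hg₂⟩ := exists_gradient (bary T₂ v₂) (hzero h₂ hF₂)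
  have hx₀F : x₀ ∈ hull F := Finset.centroid_mem_convexHull F hFne
  have hx₀s : x₀ ∈ affineSpan ℝ (F : Set (Vec d)) := convexHull_subset_affineSpan _ hx₀F
  -- Both opposite coordinates vanish on the hyperplane of the side, so their gradients are
  -- parallel.
  obtain ⟨κ, hκ⟩ : ∃ κ : ℝ, g₁ = κ • g₂ := by
    refine linear_eq_smul_of_ker fun u hu => ?_
    have h1 : bary T₂ v₂ (x₀ + u) = 0 := by rw [hg₂]; simpa using hu
    obtain ⟨h2, h3⟩ := h₂.eq_sum_side hF₂ h1
    have h4 : bary T₁ v₁ (x₀ + u) = 0 := by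
      rw [← h2, affineMap_sum _ _ _ _ h3, Finset.sum_eq_zero]
      intro w hw
      rw [h₁.bary_side hF₁ hw, mul_zero]
    rw [hg₁] at h4; simpa using h4
  have hg₁0 : g₁ ≠ 0 := by
    rintro h0
    have := hg₁ v₁
    rw [h₁.bary_self hF₁.mem, h0, inner_zero_left] at this
    exact one_ne_zero this
  have hg₂0 : g₂ ≠ 0 := by
    rintro h0
    have := hg₂ v₂
    rw [h₂.bary_self hF₂.mem, h0, inner_zero_left] at this
    exact one_ne_zero this
  have hn₂ : 0 < ‖g₂‖ := norm_pos_iff.2 hg₂0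
  -- With κ > 0, a small step along g₂ would stay in both simplices, hence by conformity in the
  -- common side, where the coordinate of v₁ is zero.
  have hκneg : κ < 0 := by
    by_contra hk
    have hkpos : 0 < κ := lt_of_le_of_ne (not_lt.1 hk) (by
      rintro h0; rw [← h0, zero_smul] at hκ; exact hg₁0 hκ)
    set τ := r / d / ‖g₂‖ with hτ
    have hτpos : 0 < τ := by positivity
    have hn : ‖x₀ + τ • g₂ - x₀‖ ≤ r / d := by
      rw [add_sub_cancel_left, norm_smul, Real.norm_of_nonneg hτpos.le, hτ,
        div_mul_cancel₀ _ hn₂.ne']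
    have hb2 : bary T₂ v₂ (x₀ + τ • g₂) = τ * ‖g₂‖ ^ 2 := by
      rw [hg₂, add_sub_cancel_left, inner_smul_right, real_inner_self_eq_norm_sq]
    have hb1 : bary T₁ v₁ (x₀ + τ • g₂) = κ * (τ * ‖g₂‖ ^ 2) := by
      rw [hg₁, hκ, add_sub_cancel_left, inner_smul_right, inner_smul_left,
        real_inner_self_eq_norm_sq]; simp; ring
    have hm1 := hmem h₁ hF₁ hb₁ _ hn (by rw [hb1]; positivity)
    have hm2 := hmem h₂ hF₂ hb₂ _ hn (by rw [hb2]; positivity)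
    have hm : x₀ + τ • g₂ ∈ convexHull ℝ (F : Set (Vec d)) := by
      rw [hFdef, Finset.coe_inter, ← hconf]; exact ⟨hm1, hm2⟩
    have := affineMap_eqOn_convexHull (f := bary T₁ v₁) (g := 0) (V := (F : Set (Vec d)))
      (fun w hw => by simpa using h₁.bary_side hF₁ hw) hm
    rw [hb1] at this
    have hp : 0 < κ * (τ * ‖g₂‖ ^ 2) := by positivity
    simp only [AffineMap.coe_zero, Pi.zero_apply] at this
    linarith
  set ν := ‖g₂‖⁻¹ • g₂ with hν
  have hνn : ‖ν‖ = 1 := by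
    rw [hν, norm_smul, norm_inv, norm_norm, inv_mul_cancel₀ hn₂.ne']
  have hb2 : ∀ x, bary T₂ v₂ x = ‖g₂‖ * ⟪ν, x - x₀⟫_ℝ := by
    intro x
    rw [hg₂, hν, inner_smul_left]
    simp only [map_inv₀, RCLike.conj_to_real]
    field_simp
  have hb1 : ∀ x, bary T₁ v₁ x = κ * ‖g₂‖ * ⟪ν, x - x₀⟫_ℝ := by
    intro x
    rw [hg₁, hκ, inner_smul_left, ← hg₂, hb2]
    simp; ring
  have hspan : (vectorSpan ℝ (F : Set (Vec d)))ᗮ = ℝ ∙ ν := by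
    rw [h₂.vectorSpan_side hF₂ hx₀s hg₂, Submodule.orthogonal_orthogonal, hν,
      Submodule.span_singleton_smul_eq (IsUnit.mk0 _ (inv_ne_zero hn₂.ne'))]
  have hsn : ∀ T : Finset (Vec d), sideNormal F T =
      ‖⟪ν, T.centroid ℝ id - x₀⟫_ℝ • ν‖⁻¹ • (⟪ν, T.centroid ℝ id - x₀⟫_ℝ • ν) := by
    intro T
    have : (vectorSpan ℝ (F : Set (Vec d)))ᗮ.starProjection (T.centroid ℝ id - x₀) =
        ⟪ν, T.centroid ℝ id - x₀⟫_ℝ • ν := by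
      rw [← Submodule.starProjection_unit_singleton ℝ hνn]
      congr 2
    rw [sideNormal, ← hx₀, this]
  have hcen : ∀ {T v}, IsSimplex T → IsSide F T v → 0 < bary T v (T.centroid ℝ id) := by
    intro T v hT hF
    have hTne : T.Nonempty := ⟨v, hF.mem⟩
    rw [affineMap_centroid _ _ hTne, Finset.sum_eq_single v
      (fun b hb hbw => hT.bary_ne hF.mem hb hbw.symm) (fun h => absurd hF.mem h),
      hT.bary_self hF.mem, mul_one]
    have := Finset.card_pos.2 hTne
    positivity
  refine ⟨ν, x₀, hνn, ?_, ?_, hx₀F, ?_, ?_, ?_⟩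
  · have h1 := hcen h₂ hF₂
    rw [hb2] at h1
    have h2 : 0 < ⟪ν, T₂.centroid ℝ id - x₀⟫_ℝ := (mul_pos_iff_of_pos_left hn₂).1 h1
    rw [hsn, norm_smul, hνn, mul_one, Real.norm_of_nonneg h2.le, smul_smul,
      inv_mul_cancel₀ h2.ne', one_smul]
  · have h1 := hcen h₁ hF₁
    rw [hb1] at h1
    have h2 : ⟪ν, T₁.centroid ℝ id - x₀⟫_ℝ < 0 := by
      by_contra h
      have : κ * ‖g₂‖ * ⟪ν, T₁.centroid ℝ id - x₀⟫_ℝ ≤ 0 :=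
        mul_nonpos_of_nonpos_of_nonneg (mul_nonpos_of_nonpos_of_nonneg hκneg.le hn₂.le) (not_lt.1 h)
      linarith
    rw [hsn, norm_smul, hνn, mul_one, Real.norm_of_nonpos h2.le, smul_smul, inv_neg, neg_mul,
      inv_mul_cancel₀ h2.ne, neg_smul, one_smul]
  · intro x hx hx'
    refine hmem h₁ hF₁ hb₁ x hx ?_
    rw [hb1]
    exact mul_nonneg_of_nonpos_of_nonpos (mul_nonpos_of_nonpos_of_nonneg hκneg.le hn₂.le) hx'
  · intro x hx hx'
    refine hmem h₂ hF₂ hb₂ x hx ?_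
    rw [hb2]
    positivity
  · intro x hx
    have := affineMap_eqOn_convexHull (f := bary T₂ v₂) (g := 0) (V := (F : Set (Vec d)))
      (fun w hw => by simpa using h₂.bary_side hF₂ hw) hx
    rw [hb2] at this
    simpa [hn₂.ne'] using this

end

section

/-! ### Combinatorics of shape regular meshes -/

variable {Ω : Set (Vec d)}

lemma Mesh.isSimplex (M : Mesh Ω) {T : Finset (Vec d)} (hT : T ∈ M.elements) : IsSimplex T :=
  ⟨M.card_eq T hT, M.affineIndependent T hT⟩

lemma hSize_pos_of_ball (hd : 0 < d) {T : Finset (Vec d)} (h : IsSimplex T) {c : Vec d} {r : ℝ}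
    (hr : 0 < r) (hb : Metric.ball c r ⊆ hull T) : r ≤ hSize T := by
  obtain ⟨v, hv, w, hw, hvw⟩ := Finset.one_lt_card.1 (show 1 < T.card by rw [h.card_eq]; omega)
  refine (h.le_dist_vertices hr hb hv hw hvw).trans ?_
  rw [← dist_eq_norm]
  exact dist_le_hSize (subset_hull hv) (subset_hull hw)

lemma Mesh.IsShapeRegular.mono {M : Mesh Ω} {σ σ' : ℝ} (h : M.IsShapeRegular σ) (hσ : σ ≤ σ') :
    M.IsShapeRegular σ' := by
  intro T hT
  obtain ⟨c, r, hr, hb, hh⟩ := h T hT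
  exact ⟨c, r, hr, hb, hh.trans (mul_le_mul_of_nonneg_right hσ hr.le)⟩

open Classical in
/-- The elements that touch `T`. -/
def Mesh.touching (M : Mesh Ω) (T : Finset (Vec d)) : Finset (Finset (Vec d)) :=
  M.elements.filter fun T' => (hull T ∩ hull T').Nonempty

lemma Mesh.mem_touching {M : Mesh Ω} {T T' : Finset (Vec d)} :
    T' ∈ M.touching T ↔ T' ∈ M.elements ∧ (hull T ∩ hull T').Nonempty := by
  simp [touching]

lemma Mesh.hull_subset_star {M : Mesh Ω} {T T' : Finset (Vec d)} (h : T' ∈ M.touching T) :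
    hull T' ⊆ M.star T :=
  Set.subset_biUnion_of_mem (u := fun T' => hull T') (Mesh.mem_touching.1 h)

lemma Mesh.self_mem_touching {M : Mesh Ω} {T : Finset (Vec d)} (h : T ∈ M.elements) :
    T ∈ M.touching T := by
  obtain ⟨x, hx⟩ := (M.isSimplex h).interior_nonempty
  exact Mesh.mem_touching.2 ⟨h, x, interior_subset hx, interior_subset hx⟩

open Classical in
lemma Mesh.mem_neighbors {M : Mesh Ω} {T T' : Finset (Vec d)} :
    T' ∈ M.neighbors T ↔ T' ∈ M.elements ∧ T' ≠ T ∧ (T ∩ T').card = d := by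
  simp only [neighbors, Finset.mem_filter]

lemma Mesh.neighbors_symm {M : Mesh Ω} {T T' : Finset (Vec d)} (hT : T ∈ M.elements)
    (h : T' ∈ M.neighbors T) : T ∈ M.neighbors T' := by
  classical
  rw [Mesh.mem_neighbors] at h ⊢
  refine ⟨hT, h.2.1.symm, ?_⟩
  rw [Finset.inter_comm]; exact h.2.2

lemma Mesh.neighbors_subset_touching {M : Mesh Ω} (hd : 0 < d) {T T' : Finset (Vec d)}
    (h : T' ∈ M.neighbors T) : T' ∈ M.touching T := by
  classical
  obtain ⟨h1, -, h3⟩ := Mesh.mem_neighbors.1 h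
  obtain ⟨v, hv⟩ := Finset.card_pos.1 (show 0 < (T ∩ T').card by omega)
  obtain ⟨hv1, hv2⟩ := Finset.mem_inter.1 hv
  exact Mesh.mem_touching.2 ⟨h1, v, subset_hull hv1, subset_hull hv2⟩

/-- If some vertex v of T were not a vertex of T', its barycentric coordinate would vanish on the
intersection by conformity. An affine function that is zero on a ball is zero everywhere, but this
one is 1 at v. -/
lemma Mesh.eq_of_ball (M : Mesh Ω) {T T' : Finset (Vec d)} (hT : T ∈ M.elements)
    (hT' : T' ∈ M.elements) {x : Vec d} {ε : ℝ} (hε : 0 < ε) (h : Metric.ball x ε ⊆ hull T)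
    (h' : Metric.ball x ε ⊆ hull T') : T = T' := by
  by_contra hne
  obtain ⟨v, hv, hv'⟩ : ∃ v ∈ T, v ∉ T' := by
    by_contra hcon
    push Not at hcon
    exact hne (Finset.eq_of_subset_of_card_le hcon (by rw [M.card_eq T hT, M.card_eq T' hT']))
  have h0 : ∀ y ∈ Metric.ball x ε, bary T v y = 0 := by
    intro y hy
    have hy' : y ∈ convexHull ℝ ((T : Set (Vec d)) ∩ (T' : Set (Vec d))) := by
      rw [← M.conforming T hT T' hT']; exact ⟨h hy, h' hy⟩
    have := affineMap_eqOn_convexHull (f := bary T v) (g := 0) (fun w hw => ?_) hy'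
    · simpa using this
    · simp only [AffineMap.coe_zero, Pi.zero_apply]
      exact (M.isSimplex hT).bary_ne hv hw.1 (by rintro rfl; exact hv' hw.2)
  have h1 := (M.isSimplex hT).bary_self hv
  by_cases hvx : v = x
  · subst hvx
    rw [h0 v (Metric.mem_ball_self hε)] at h1
    exact zero_ne_one h1
  · have hn : 0 < ‖v - x‖ := norm_pos_iff.2 (sub_ne_zero.2 hvx)
    set τ := ε / (2 * ‖v - x‖) with hτ
    have hτ0 : 0 < τ := by positivity
    have h2 := h0 (x + τ • (v - x)) (by
      rw [Metric.mem_ball, dist_eq_norm, add_sub_cancel_left, norm_smul,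
        Real.norm_of_nonneg hτ0.le, hτ]
      field_simp; norm_num)
    have h3 := h0 x (Metric.mem_ball_self hε)
    have h4 := affineMap_add (bary T v) x (v - x)
    rw [add_sub_cancel, h1, h3, zero_add] at h4
    rw [affineMap_add, map_smul, h3, ← h4] at h2
    simp at h2
    exact hτ0.ne' h2

/-- A volume count that needs no comparison of sizes. Contracted towards v to the size δ of the
smallest one, each element stays inside itself by convexity and contains a ball of radius δ/σ. These
balls are disjoint and lie within distance δ of v. -/
lemma Mesh.card_vertex_le (M : Mesh Ω) (hd : 0 < d) {σ : ℝ} (hσ : 1 ≤ σ)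
    (hM : M.IsShapeRegular σ) (v : Vec d) [DecidablePred fun T : Finset (Vec d) => v ∈ T] :
    ((M.elements.filter fun T => v ∈ T).card : ℝ) ≤ σ ^ d := by
  set A := M.elements.filter fun T => v ∈ T with hA
  by_cases hAe : A = ∅
  · rw [hAe]; simp; positivity
  have hAel : ∀ T ∈ A, T ∈ M.elements ∧ v ∈ T := fun T hT => Finset.mem_filter.1 hT
  choose! c r hr hb hh using hM
  obtain ⟨T₀, hT₀, hmin⟩ := Finset.exists_min_image A hSize (Finset.nonempty_iff_ne_empty.2 hAe)
  have hpos : ∀ T ∈ M.elements, 0 < hSize T := fun T hT =>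
    (hr T hT).trans_le (hSize_pos_of_ball hd (M.isSimplex hT) (hr T hT) (hb T hT))
  set δ := hSize T₀ with hδ
  have hδ0 : 0 < δ := hpos T₀ (hAel T₀ hT₀).1
  have hσ0 : 0 < σ := by linarith
  set p : Finset (Vec d) → Vec d := fun T => v + (δ / hSize T) • (c T - v) with hp
  have hsub : ∀ T ∈ A, Metric.ball (p T) (δ / σ) ⊆ hull T := by
    intro T hT x hx
    obtain ⟨hTe, hvT⟩ := hAel T hT
    have hhT := hpos T hTe
    set τ := δ / hSize T with hτ
    have hτ0 : 0 < τ := by positivity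
    have hτ1 : τ ≤ 1 := by rw [hτ, div_le_one hhT]; exact hmin T hT
    have hy : c T + τ⁻¹ • (x - p T) ∈ hull T := by
      apply hb T hTe
      rw [Metric.mem_ball, dist_eq_norm, add_sub_cancel_left, norm_smul, norm_inv,
        Real.norm_of_nonneg hτ0.le, inv_mul_lt_iff₀ hτ0]
      rw [Metric.mem_ball, dist_eq_norm] at hx
      refine hx.trans_le ?_
      rw [hτ, div_mul_eq_mul_div, div_le_div_iff₀ hσ0 hhT]
      nlinarith [hh T hTe]
    have hx' : x = (1 - τ) • v + τ • (c T + τ⁻¹ • (x - p T)) := by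
      rw [smul_add, smul_smul, mul_inv_cancel₀ hτ0.ne', one_smul]
      simp only [hp, ← hτ]
      module
    rw [hx']
    exact convex_hull' T (subset_hull hvT) hy (by linarith) hτ0.le (by ring)
  have hdisj : (A : Set (Finset (Vec d))).PairwiseDisjoint fun T => Metric.ball (p T) (δ / σ) := by
    intro T hT T' hT' hne
    rw [Function.onFun, Set.disjoint_left]
    intro x hx hx'
    obtain ⟨ε, hε, hsub'⟩ := Metric.isOpen_iff.1 (Metric.isOpen_ball.inter Metric.isOpen_ball) x
      ⟨hx, hx'⟩
    exact hne (M.eq_of_ball (hAel T hT).1 (hAel T' hT').1 hε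
      (fun y hy => hsub T hT (hsub' hy).1) (fun y hy => hsub T' hT' (hsub' hy).2))
  have hvol : ∑ T ∈ A, volume (Metric.ball (p T) (δ / σ)) ≤ volume (Metric.closedBall v δ) := by
    rw [← measure_biUnion_finset hdisj fun T _ => measurableSet_ball]
    refine measure_mono (Set.iUnion₂_subset fun T hT => ?_)
    intro x hx
    rw [Metric.mem_closedBall]
    obtain ⟨hTe, hvT⟩ := hAel T hT
    have hhT := hpos T hTe
    have hτ0 : 0 < δ / hSize T := by positivity
    have hy : c T + (δ / hSize T)⁻¹ • (x - p T) ∈ hull T := by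
      apply hb T hTe
      rw [Metric.mem_ball, dist_eq_norm, add_sub_cancel_left, norm_smul, norm_inv,
        Real.norm_of_nonneg hτ0.le, inv_mul_lt_iff₀ hτ0]
      rw [Metric.mem_ball, dist_eq_norm] at hx
      refine hx.trans_le ?_
      rw [div_mul_eq_mul_div, div_le_div_iff₀ hσ0 hhT]
      nlinarith [hh T hTe]
    have h1 := dist_le_hSize hy (subset_hull hvT)
    have h2 : x - v = (δ / hSize T) • (c T + (δ / hSize T)⁻¹ • (x - p T) - v) := by
      rw [smul_sub, smul_add, smul_smul, mul_inv_cancel₀ hτ0.ne', one_smul]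
      simp only [hp]
      module
    rw [dist_eq_norm] at h1 ⊢
    rw [h2, norm_smul, Real.norm_of_nonneg hτ0.le, div_mul_eq_mul_div, div_le_iff₀ hhT]
    gcongr
  have : Nonempty (Fin d) := ⟨⟨0, hd⟩⟩
  simp_rw [Measure.addHaar_ball volume _ (by positivity : (0:ℝ) ≤ δ / σ),
    Measure.addHaar_closedBall volume _ hδ0.le] at hvol
  rw [Finset.sum_const, nsmul_eq_mul, ← mul_assoc] at hvol
  have hB0 : volume (Metric.ball (0 : Vec d) 1) ≠ 0 :=
    (Metric.measure_ball_pos volume _ one_pos).ne'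
  have hBt : volume (Metric.ball (0 : Vec d) 1) ≠ ∞ := measure_ball_lt_top.ne
  rw [ENNReal.mul_le_mul_iff_left hB0 hBt, ← ENNReal.ofReal_natCast,
    ← ENNReal.ofReal_mul (by positivity), ENNReal.ofReal_le_ofReal_iff (by positivity)] at hvol
  simp only [finrank_euclideanSpace, Fintype.card_fin] at hvol
  rw [div_pow, mul_div_assoc', div_le_iff₀ (by positivity), mul_comm] at hvol
  exact le_of_mul_le_mul_left hvol (by positivity)

/-- A bound for the number of elements that touch an element. -/
def touchBound (d : ℕ) (σ : ℝ) : ℕ := ⌈(d + 1) * σ ^ d⌉₊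

/-- By conformity elements that touch share a vertex, and T has d + 1 of them. -/
lemma Mesh.card_touching_le (M : Mesh Ω) (hd : 0 < d) {σ : ℝ} (hσ : 1 ≤ σ)
    (hM : M.IsShapeRegular σ) {T : Finset (Vec d)} (hT : T ∈ M.elements) :
    (M.touching T).card ≤ touchBound d σ := by
  classical
  have hsub : M.touching T ⊆ T.biUnion fun v => M.elements.filter fun T' => v ∈ T' := by
    intro T' hT'
    obtain ⟨h1, h2⟩ := Mesh.mem_touching.1 hT'
    rw [M.conforming T hT T' h1, convexHull_nonempty_iff] at h2
    obtain ⟨v, hv, hv'⟩ := h2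
    exact Finset.mem_biUnion.2 ⟨v, hv, Finset.mem_filter.2 ⟨h1, hv'⟩⟩
  have h1 : ((M.touching T).card : ℝ) ≤ (d + 1) * σ ^ d := by
    calc ((M.touching T).card : ℝ)
        ≤ ((T.biUnion fun v => M.elements.filter fun T' => v ∈ T').card : ℝ) := by
          exact_mod_cast Finset.card_le_card hsub
      _ ≤ ∑ v ∈ T, ((M.elements.filter fun T' => v ∈ T').card : ℝ) := by
          exact_mod_cast Finset.card_biUnion_le
      _ ≤ ∑ v ∈ T, σ ^ d := Finset.sum_le_sum fun v _ => M.card_vertex_le hd hσ hM v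
      _ = (d + 1) * σ ^ d := by rw [Finset.sum_const, M.card_eq T hT]; simp
  exact Nat.cast_le.1 (h1.trans (Nat.le_ceil _))

/-! ### Paths through common sides and element sizes along them. -/

/-- `T'` is reached from `T` in `n` steps through sides and elements that touch `T`. -/
inductive Mesh.Chain (M : Mesh Ω) (T : Finset (Vec d)) : Finset (Vec d) → ℕ → Prop
  | refl : Mesh.Chain M T T 0
  | step {T₁ T₂ : Finset (Vec d)} {n : ℕ} : Mesh.Chain M T T₁ n → T₂ ∈ M.touching T →
      T₂ ∈ M.neighbors T₁ → Mesh.Chain M T T₂ (n + 1)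

lemma Mesh.Chain.mem_touching {M : Mesh Ω} {T T' : Finset (Vec d)} (hT : T ∈ M.elements) {n : ℕ}
    (h : M.Chain T T' n) : T' ∈ M.touching T := by
  cases h with
  | refl => exact Mesh.self_mem_touching hT
  | step _ h2 _ => exact h2

/-- A shortest path has no repetitions and stays among the elements touching T. Here `f j` is an
element whose minimal path length is `k - j`; distinct minimal lengths force distinct elements. -/
lemma Mesh.Chain.exists_short {M : Mesh Ω} {T T' : Finset (Vec d)} (hT : T ∈ M.elements) {n : ℕ}
    (h : M.Chain T T' n) : ∃ m ≤ (M.touching T).card, M.Chain T T' m := by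
  classical
  have hex : ∃ n, M.Chain T T' n := ⟨n, h⟩
  set k := Nat.find hex with hk
  refine ⟨k, ?_, Nat.find_spec hex⟩
  have key : ∀ j ≤ k, ∃ T'', M.Chain T T'' (k - j) ∧ ∀ m < k - j, ¬ M.Chain T T'' m := by
    intro j
    induction j with
    | zero => exact fun _ => ⟨T', Nat.find_spec hex, fun m hm => Nat.find_min hex hm⟩
    | succ j ih =>
      intro hj
      obtain ⟨T'', h1, h2⟩ := ih (by omega)
      obtain ⟨i, hi⟩ : ∃ i, k - j = i + 1 := ⟨k - j - 1, by omega⟩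
      rw [hi] at h1 h2
      cases h1 with
      | step h3 h4 h5 =>
        refine ⟨_, by rw [show k - (j + 1) = i by omega]; exact h3, fun m hm hc => ?_⟩
        exact h2 (m + 1) (by omega) (hc.step h4 h5)
  choose! f hf1 hf2 using key
  have hinj : Set.InjOn f (Finset.range (k + 1)) := by
    intro i hi j hj hij
    simp only [Finset.coe_range, Set.mem_Iio] at hi hj
    have a1 := hf1 i (by omega)
    have a2 := hf1 j (by omega)
    by_contra hne
    rcases Nat.lt_or_ge (k - i) (k - j) with hlt | hge
    · exact hf2 j (by omega) _ hlt (hij ▸ a1)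
    · exact hf2 i (by omega) _ (by omega) (hij ▸ a2)
  have := Finset.card_le_card_of_injOn (s := Finset.range (k + 1)) (t := M.touching T) f
    (fun i hi => (hf1 i (by simp at hi; omega)).mem_touching hT) hinj
  rw [Finset.card_range] at this
  omega

/-- For d ≥ 2 a common side contains an edge, whose length is at least the inscribed radius of T and
at most the diameter of T'. -/
lemma Mesh.hSize_neighbor (M : Mesh Ω) (hd : 2 ≤ d) {σ : ℝ} (hσ : 1 ≤ σ)
    (hM : M.IsShapeRegular σ) {T T' : Finset (Vec d)} (hT : T ∈ M.elements)
    (h : T' ∈ M.neighbors T) : hSize T ≤ σ * hSize T' := by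
  classical
  obtain ⟨-, -, hc⟩ := Mesh.mem_neighbors.1 h
  obtain ⟨c, r, hr, hb, hh⟩ := hM T hT
  obtain ⟨v, hv, w, hw, hvw⟩ := Finset.one_lt_card.1 (show 1 < (T ∩ T').card by omega)
  rw [Finset.mem_inter] at hv hw
  have h1 := (M.isSimplex hT).le_dist_vertices hr hb hv.1 hw.1 hvw
  have h2 := dist_le_hSize (subset_hull hv.2) (subset_hull hw.2)
  rw [dist_eq_norm] at h2
  refine hh.trans (mul_le_mul_of_nonneg_left (h1.trans h2) (by linarith))

lemma Mesh.Chain.hSize_le {M : Mesh Ω} (hd : 2 ≤ d) {σ : ℝ} (hσ : 1 ≤ σ)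
    (hM : M.IsShapeRegular σ) {T T' : Finset (Vec d)} (hT : T ∈ M.elements) {n : ℕ}
    (h : M.Chain T T' n) : hSize T ≤ σ ^ n * hSize T' ∧ hSize T' ≤ σ ^ n * hSize T := by
  induction h with
  | refl => simp
  | @step T₁ T₂ n h1 h2 h3 ih =>
    have hT₁ : T₁ ∈ M.elements := (Mesh.mem_touching.1 (h1.mem_touching hT)).1
    have hT₂ : T₂ ∈ M.elements := (Mesh.mem_touching.1 h2).1
    have e1 := M.hSize_neighbor hd hσ hM hT₁ h3
    have e2 := M.hSize_neighbor hd hσ hM hT₂ (Mesh.neighbors_symm hT₁ h3)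
    have hσn : 0 ≤ σ ^ n := by positivity
    constructor
    · calc hSize T ≤ σ ^ n * hSize T₁ := ih.1
        _ ≤ σ ^ n * (σ * hSize T₂) := by gcongr
        _ = _ := by ring
    · calc hSize T₂ ≤ σ * hSize T₁ := e2
        _ ≤ σ * (σ ^ n * hSize T) := by gcongr; exact ih.2
        _ = _ := by ring

/-- A bound for the ratio of sizes in a patch. -/
def sizeRatio (d : ℕ) (σ : ℝ) : ℝ := σ ^ touchBound d σ

lemma one_le_sizeRatio {σ : ℝ} (hσ : 1 ≤ σ) : 1 ≤ sizeRatio d σ := one_le_pow₀ hσ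

/-- Passing to a shortest path makes the ratio independent of the length of the given one. -/
lemma Mesh.Chain.hSize_le' {M : Mesh Ω} (hd : 2 ≤ d) {σ : ℝ} (hσ : 1 ≤ σ)
    (hM : M.IsShapeRegular σ) {T T' : Finset (Vec d)} (hT : T ∈ M.elements) {n : ℕ}
    (h : M.Chain T T' n) :
    hSize T ≤ sizeRatio d σ * hSize T' ∧ hSize T' ≤ sizeRatio d σ * hSize T := by
  obtain ⟨m, hm, h'⟩ := h.exists_short hT
  have h1 := h'.hSize_le hd hσ hM hT
  have h2 : σ ^ m ≤ sizeRatio d σ :=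
    pow_le_pow_right₀ hσ (hm.trans (M.card_touching_le (by omega) hσ hM hT))
  exact ⟨h1.1.trans (mul_le_mul_of_nonneg_right h2 (hSize_nonneg _)),
    h1.2.trans (mul_le_mul_of_nonneg_right h2 (hSize_nonneg _))⟩

end

section

/-! ### The patch of an element contains a ball of comparable size -/

variable {Ω : Set (Vec d)}

lemma affineSpan_ne_top {V : Finset (Vec d)} (hV : V.card ≤ d) :
    affineSpan ℝ (V : Set (Vec d)) ≠ ⊤ := by
  classical
  intro h
  obtain hV0 | ⟨n, hn⟩ : V.card = 0 ∨ ∃ n, V.card = n + 1 := by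
    cases hc : V.card with
    | zero => exact Or.inl rfl
    | succ n => exact Or.inr ⟨n, rfl⟩
  · rw [Finset.card_eq_zero] at hV0
    rw [hV0, Finset.coe_empty, AffineSubspace.span_empty] at h
    exact AffineSubspace.bot_ne_top ℝ (Vec d) (Vec d) h
  · have h1 := finrank_vectorSpan_image_finset_le ℝ (id : Vec d → Vec d) V hn
    rw [Finset.image_id] at h1
    have h2 : vectorSpan ℝ (V : Set (Vec d)) = ⊤ := by
      rw [← direction_affineSpan, h, AffineSubspace.direction_top]
    rw [h2, finrank_top, finrank_euclideanSpace, Fintype.card_fin] at h1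
    omega

lemma volume_affineSpan {V : Finset (Vec d)} (hV : V.card ≤ d) :
    volume (affineSpan ℝ (V : Set (Vec d)) : Set (Vec d)) = 0 :=
  Measure.addHaar_affineSubspace _ _ (affineSpan_ne_top hV)

/-! ### The nodal function that equals one on an element. -/

open Classical in
/-- The sum of the barycentric coordinates of `T'` at the vertices of `T`. -/
def hat (T T' : Finset (Vec d)) : Vec d →ᵃ[ℝ] ℝ := ∑ v ∈ T' with v ∈ T, bary T' v

open Classical in
lemma hat_apply (T T' : Finset (Vec d)) (x : Vec d) :
    hat T T' x = ∑ v ∈ T' with v ∈ T, bary T' v x := by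
  have : ∀ s : Finset (Vec d), (∑ v ∈ s, bary T' v) x = ∑ v ∈ s, bary T' v x := by
    intro s
    induction s using Finset.induction_on with
    | empty => simp
    | insert a s ha ih => rw [Finset.sum_insert ha, Finset.sum_insert ha, AffineMap.coe_add,
        Pi.add_apply, ih]
  exact this _

open Classical in
lemma hat_vertex {T T' : Finset (Vec d)} (h : IsSimplex T') {w : Vec d} (hw : w ∈ T') :
    hat T T' w = if w ∈ T then 1 else 0 := by
  rw [hat_apply]
  split_ifs with h1
  · rw [Finset.sum_eq_single w (fun b hb hbw => h.bary_ne (Finset.mem_filter.1 hb).1 hw hbw)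
      (fun hn => absurd (Finset.mem_filter.2 ⟨hw, h1⟩) hn), h.bary_self hw]
  · refine Finset.sum_eq_zero fun b hb => h.bary_ne (Finset.mem_filter.1 hb).1 hw ?_
    rintro rfl
    exact h1 (Finset.mem_filter.1 hb).2

lemma hat_mem_Icc {T T' : Finset (Vec d)} (h : IsSimplex T') {x : Vec d} (hx : x ∈ hull T') :
    hat T T' x ∈ Set.Icc (0 : ℝ) 1 := by
  classical
  rw [hat_apply]
  refine ⟨Finset.sum_nonneg fun v hv => h.mem_hull_iff.1 hx v (Finset.mem_filter.1 hv).1, ?_⟩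
  rw [← h.sum_bary x]
  exact Finset.sum_le_sum_of_subset_of_nonneg (Finset.filter_subset _ _)
    fun v hv _ => h.mem_hull_iff.1 hx v hv

lemma hat_self {T : Finset (Vec d)} (h : IsSimplex T) (x : Vec d) : hat T T x = 1 := by
  classical
  rw [hat_apply, Finset.filter_true_of_mem fun _ h => h, h.sum_bary]

/-- The maps `hat T T'` are the pieces of one continuous piecewise affine function, with value 1 at
the vertices of T and 0 at all other vertices: on an intersection both pieces are determined by the
common vertices. -/
lemma Mesh.hat_eq (M : Mesh Ω) {T T₁ T₂ : Finset (Vec d)} (h₁ : T₁ ∈ M.elements)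
    (h₂ : T₂ ∈ M.elements) {x : Vec d} (hx₁ : x ∈ hull T₁) (hx₂ : x ∈ hull T₂) :
    hat T T₁ x = hat T T₂ x := by
  have hx : x ∈ convexHull ℝ ((T₁ : Set (Vec d)) ∩ (T₂ : Set (Vec d))) := by
    rw [← M.conforming T₁ h₁ T₂ h₂]; exact ⟨hx₁, hx₂⟩
  refine affineMap_eqOn_convexHull (fun w hw => ?_) hx
  rw [hat_vertex (M.isSimplex h₁) hw.1, hat_vertex (M.isSimplex h₂) hw.2]

lemma Mesh.mem_touching_of_hat_pos {M : Mesh Ω} {T T' : Finset (Vec d)} (h' : T' ∈ M.elements)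
    {x : Vec d} (hx : hat T T' x ≠ 0) : T' ∈ M.touching T := by
  classical
  rw [hat_apply] at hx
  obtain ⟨v, hv, -⟩ := Finset.exists_ne_zero_of_sum_ne_zero hx
  obtain ⟨h1, h2⟩ := Finset.mem_filter.1 hv
  exact Mesh.mem_touching.2 ⟨h', v, subset_hull h2, subset_hull h1⟩

/-- The segment from `a` to `x` meets two elements only in common sides. -/
def Mesh.Generic (M : Mesh Ω) (a x : Vec d) : Prop :=
  ∀ T₁ ∈ M.elements, ∀ T₂ ∈ M.elements, T₁ ≠ T₂ → ∀ s ∈ Set.Icc (0 : ℝ) 1,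
    a + s • (x - a) ∈ hull T₁ → a + s • (x - a) ∈ hull T₂ → T₂ ∈ M.neighbors T₁

/-- Distinct elements that share no side meet in the span of fewer than d points. Once a avoids
these finitely many spans, the span of such a set together with a still has at most d generators and
is null; a segment from a to any x off these null sets misses the bad intersections. -/
lemma Mesh.ae_generic (M : Mesh Ω) {U : Set (Vec d)} (hU : IsOpen U) (hUne : U.Nonempty) :
    ∃ a ∈ U, ∀ᵐ x, M.Generic a x := by
  classical
  set I := (M.elements ×ˢ M.elements).filter fun p => (p.1 ∩ p.2).card < d with hI
  have hnull : ∀ᵐ a : Vec d, ∀ p ∈ I, a ∉ affineSpan ℝ ((p.1 ∩ p.2 : Finset (Vec d)) : Set (Vec d)) := by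
    rw [Filter.eventually_all_finset]
    intro p hp
    have := volume_affineSpan (V := p.1 ∩ p.2) (Finset.mem_filter.1 hp).2.le
    exact measure_eq_zero_iff_ae_notMem.1 this
  obtain ⟨a, haU, ha⟩ : ∃ a ∈ U, ∀ p ∈ I,
      a ∉ affineSpan ℝ ((p.1 ∩ p.2 : Finset (Vec d)) : Set (Vec d)) := by
    by_contra hcon
    push Not at hcon
    have h1 : volume U = 0 := by
      refine measure_mono_null (fun a ha => ?_) (ae_iff.1 hnull)
      obtain ⟨p, hp, hpa⟩ := hcon a ha
      exact fun h => h p hp hpa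
    exact (hU.measure_pos volume hUne).ne' h1
  refine ⟨a, haU, ?_⟩
  have hnull2 : ∀ᵐ x : Vec d, ∀ p ∈ I,
      x ∉ affineSpan ℝ ((insert a (p.1 ∩ p.2) : Finset (Vec d)) : Set (Vec d)) := by
    rw [Filter.eventually_all_finset]
    intro p hp
    have := volume_affineSpan (V := insert a (p.1 ∩ p.2))
      ((Finset.card_insert_le _ _).trans (Finset.mem_filter.1 hp).2)
    exact measure_eq_zero_iff_ae_notMem.1 this
  filter_upwards [hnull2] with x hx T₁ h₁ T₂ h₂ hne s hs hs₁ hs₂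
  rw [Mesh.mem_neighbors]
  refine ⟨h₂, hne.symm, ?_⟩
  have hle : (T₁ ∩ T₂).card ≤ d := by
    by_contra hlt
    have hc1 := M.card_eq T₁ h₁
    have hc2 := M.card_eq T₂ h₂
    have e1 := Finset.eq_of_subset_of_card_le (Finset.inter_subset_left (s₁ := T₁) (s₂ := T₂))
      (by omega)
    have e2 := Finset.eq_of_subset_of_card_le (Finset.inter_subset_right (s₁ := T₁) (s₂ := T₂))
      (by omega)
    exact hne (e1.symm.trans e2)
  by_contra hlt
  have hp : (T₁, T₂) ∈ I := Finset.mem_filter.2 ⟨Finset.mem_product.2 ⟨h₁, h₂⟩, by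
    show (T₁ ∩ T₂).card < d
    have : (T₁ ∩ T₂).card ≠ d := by convert hlt
    omega⟩
  have hγ : a + s • (x - a) ∈ affineSpan ℝ ((T₁ ∩ T₂ : Finset (Vec d)) : Set (Vec d)) := by
    refine convexHull_subset_affineSpan _ ?_
    rw [Finset.coe_inter, ← M.conforming T₁ h₁ T₂ h₂]; exact ⟨hs₁, hs₂⟩
  by_cases hs0 : s = 0
  · rw [hs0, zero_smul, add_zero] at hγ
    exact ha _ hp hγ
  · refine hx _ hp ?_
    have h1 : a + s • (x - a) ∈
        affineSpan ℝ ((insert a (T₁ ∩ T₂) : Finset (Vec d)) : Set (Vec d)) :=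
      affineSpan_mono ℝ (by exact_mod_cast Finset.subset_insert _ _) hγ
    have h2 : a ∈ affineSpan ℝ ((insert a (T₁ ∩ T₂) : Finset (Vec d)) : Set (Vec d)) :=
      mem_affineSpan ℝ (by exact_mod_cast Finset.mem_insert_self _ _)
    have h3 := AffineMap.lineMap_mem s⁻¹ h2 h1
    rw [AffineMap.lineMap_apply] at h3
    simpa [smul_smul, hs0] using h3

/-- Continuous induction along the segment. The nodal function of T starts at 1 and falls with slope
at most Λ < 1, so it stays positive and every element entered shares a vertex with T; genericity
makes each transition pass through a side. The Lipschitz bound is asked only along chains, where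
sizes are comparable. -/
lemma Mesh.chain_of_generic (M : Mesh Ω) {T : Finset (Vec d)}
    (hT : T ∈ M.elements) {a x : Vec d} (ha : a ∈ hull T) (hgen : M.Generic a x) {L : ℝ}
    (hL : ∀ T' n, M.Chain T T' n → ∀ u v, |hat T T' u - hat T T' v| ≤ L * ‖u - v‖)
    (hsmall : L * ‖x - a‖ < 1) (hseg : ∀ s ∈ Set.Icc (0 : ℝ) 1, a + s • (x - a) ∈ closure Ω) :
    ∃ T' n, M.Chain T T' n ∧ x ∈ hull T' := by
  classical
  set γ : ℝ → Vec d := fun s => a + s • (x - a) with hγ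
  have hγc : Continuous γ := by fun_prop
  set Λ := L * ‖x - a‖ with hΛ
  have hL0 : 0 ≤ Λ := by
    have := (abs_nonneg _).trans (hL T 0 .refl x a)
    exact this
  set Pt : Set (Finset (Vec d)) := {T' | T' ∈ M.elements ∧ ∃ n, M.Chain T T' n} with hPt
  have hPfin : Pt.Finite := M.elements.finite_toSet.subset fun T' h => h.1
  set S : Set ℝ := ⋃ T' ∈ Pt, {s | γ s ∈ hull T' ∧ 1 - Λ * s ≤ hat T T' (γ s)} with hS
  have hScl : IsClosed S := by
    refine hPfin.isClosed_biUnion fun T' _ => ?_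
    have c1 : Continuous fun s : ℝ => 1 - Λ * s := by fun_prop
    have c2 : Continuous fun s => hat T T' (γ s) :=
      (AffineMap.continuous_of_finiteDimensional _).comp hγc
    exact ((isCompact_hull T').isClosed.preimage hγc).inter (isClosed_le c1 c2)
  have hmem : ∀ {s}, s ∈ S ↔ ∃ T' ∈ Pt, γ s ∈ hull T' ∧ 1 - Λ * s ≤ hat T T' (γ s) := by
    intro s; simp only [hS, Set.mem_iUnion, Set.mem_ofPred_eq, exists_prop]
  have hsub : Set.Icc (0 : ℝ) 1 ⊆ S := by
    refine IsClosed.Icc_subset_of_forall_exists_gt (hScl.inter isClosed_Icc) ?_ ?_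
    · refine hmem.2 ⟨T, ⟨hT, 0, .refl⟩, by simpa [hγ] using ha, ?_⟩
      rw [hat_self (M.isSimplex hT)]; simp
    · rintro s ⟨hsS, hs0, hs1⟩ y hy
      obtain ⟨T₁, ⟨hT₁, n, hch⟩, hs₁, hh₁⟩ := hmem.1 hsS
      -- Finitely many closed elements cover the segment, so one of them meets it arbitrarily soon
      -- after s, and by closedness also contains the point at s.
      obtain ⟨T₂, hT₂, hfreq⟩ : ∃ T₂ ∈ M.elements, ∃ᶠ s' in 𝓝[>] s, γ s' ∈ hull T₂ := by
        by_contra hcon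
        push Not at hcon
        have h1 : ∀ᶠ s' in 𝓝[>] s, ∀ T₂ ∈ M.elements, γ s' ∉ hull T₂ :=
          (Filter.eventually_all_finset _).2 hcon
        have h2 : ∀ᶠ s' in 𝓝[>] s, s' ∈ Set.Ioo s 1 := Ioo_mem_nhdsGT hs1
        obtain ⟨s', h3, h4⟩ := (h1.and h2).exists
        have h5 := hseg s' ⟨hs0.trans h4.1.le, h4.2.le⟩
        rw [← M.cover] at h5
        simp only [Set.mem_iUnion] at h5
        obtain ⟨T₂, hT₂, h6⟩ := h5
        exact h3 T₂ hT₂ h6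
      have hs₂ : γ s ∈ hull T₂ :=
        (isCompact_hull T₂).isClosed.mem_of_frequently_of_tendsto hfreq
          (hγc.continuousAt.tendsto.mono_left nhdsWithin_le_nhds)
      have hlt : s < min y 1 := lt_min hy hs1
      obtain ⟨s', h3, h4⟩ := (hfreq.and_eventually (Ioo_mem_nhdsGT hlt)).exists
      have hheq : hat T T₁ (γ s) = hat T T₂ (γ s) := M.hat_eq hT₁ hT₂ hs₁ hs₂
      obtain ⟨m, hch₂⟩ : ∃ m, M.Chain T T₂ m := by
        by_cases h12 : T₁ = T₂
        · exact ⟨n, h12 ▸ hch⟩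
        · refine ⟨n + 1, hch.step (Mesh.mem_touching_of_hat_pos hT₂ (x := γ s) ?_)
            (hgen T₁ hT₁ T₂ hT₂ h12 s ⟨hs0, hs1.le⟩ hs₁ hs₂)⟩
          rw [← hheq]
          nlinarith
      refine ⟨s', hmem.2 ⟨T₂, ⟨hT₂, m, hch₂⟩, h3, ?_⟩, h4.1, h4.2.le.trans (min_le_left _ _)⟩
      have h5 := hL T₂ m hch₂ (γ s') (γ s)
      have h6 : γ s' - γ s = (s' - s) • (x - a) := by simp only [hγ]; module
      rw [h6, norm_smul, Real.norm_of_nonneg (by linarith [h4.1]), abs_le] at h5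
      rw [hheq] at hh₁
      have h7 : L * ((s' - s) * ‖x - a‖) = Λ * (s' - s) := by rw [hΛ]; ring
      rw [h7] at h5
      linarith [h5.1]
  obtain ⟨T', ⟨-, n, hch⟩, hx, -⟩ := hmem.1 (hsub ⟨zero_le_one, le_rfl⟩)
  exact ⟨T', n, hch, by simpa [hγ] using hx⟩

/-- Almost every point of a small ball around a point of `T` lies in an element that is linked to
`T`. -/
lemma Mesh.ae_mem_chain (M : Mesh Ω) (hd : 2 ≤ d) {σ : ℝ} (hσ : 1 ≤ σ)
    (hM : M.IsShapeRegular σ) {T : Finset (Vec d)} (hT : T ∈ M.elements) {t : Vec d}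
    (ht : t ∈ hull T) {ℓ : ℝ} (hℓ : 0 < ℓ) (hℓ' : 2 * σ * sizeRatio d σ * ℓ ≤ hSize T)
    (hΩ : Metric.ball t ℓ ⊆ closure Ω) :
    ∀ᵐ x, x ∈ Metric.ball t ℓ → ∃ T' n, M.Chain T T' n ∧ x ∈ hull T' := by
  have hd0 : 0 < d := by omega
  have hUne : (interior (hull T) ∩ Metric.ball t ℓ).Nonempty := by
    have h1 : t ∈ closure (interior (hull T)) := by
      rw [(convex_hull' T).closure_interior_eq_closure_of_nonempty_interior
        (M.isSimplex hT).interior_nonempty]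
      exact subset_closure ht
    obtain ⟨x, hx, hx'⟩ := Metric.mem_closure_iff.1 h1 ℓ hℓ
    exact ⟨x, hx, by rw [Metric.mem_ball, dist_comm]; exact hx'⟩
  obtain ⟨a, ⟨haT, hab⟩, hgen⟩ := M.ae_generic (isOpen_interior.inter Metric.isOpen_ball) hUne
  filter_upwards [hgen] with x hx hxb
  have hR := one_le_sizeRatio (d := d) hσ
  have hh : 0 < hSize T := lt_of_lt_of_le (by positivity) hℓ'
  have hxa : ‖x - a‖ < 2 * ℓ := by
    rw [← dist_eq_norm]
    have h1 := dist_triangle x t a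
    have h2 : dist x t < ℓ := hxb
    have h3 : dist t a < ℓ := by rw [dist_comm]; exact hab
    linarith
  -- On a chained element the nodal function has Lipschitz constant 1/r ≤ σ K / h_T with K the size
  -- ratio, while x and a are less than 2ℓ apart.
  refine M.chain_of_generic hT (interior_subset haT) hx (L := σ * sizeRatio d σ / hSize T) ?_ ?_ ?_
  · intro T' n hch u v
    have hT' := (Mesh.mem_touching.1 (hch.mem_touching hT)).1
    obtain ⟨c, r, hr, hb, hhr⟩ := hM T' hT'
    refine (affineMap_lipschitz hr (fun x hx => hat_mem_Icc (M.isSimplex hT') (hb hx)) u v).trans ?_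
    have h1 := (hch.hSize_le' hd hσ hM hT).1
    have h2 : 1 / r ≤ σ * sizeRatio d σ / hSize T := by
      rw [div_le_div_iff₀ hr hh, one_mul]
      calc hSize T ≤ sizeRatio d σ * hSize T' := h1
        _ ≤ sizeRatio d σ * (σ * r) := by gcongr
        _ = _ := by ring
    calc ‖u - v‖ / r = 1 / r * ‖u - v‖ := by ring
      _ ≤ _ := by gcongr
  · rw [div_mul_eq_mul_div, div_lt_one hh]
    calc σ * sizeRatio d σ * ‖x - a‖ < σ * sizeRatio d σ * (2 * ℓ) := by
          gcongr
      _ = 2 * σ * sizeRatio d σ * ℓ := by ring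
      _ ≤ hSize T := hℓ'
  · intro s hs
    refine hΩ ?_
    have := (convex_ball t ℓ) hab hxb (a := 1 - s) (b := s) (by linarith [hs.2]) hs.1 (by ring)
    convert this using 1
    module

end

section

/-! ### The weight -/

variable {Ω : Set (Vec d)} {D : Finset (Vec d)} {α : ℝ}

lemma measurable_rho : Measurable (rho Ω D α) := by
  unfold rho
  refine Measurable.ite ?_ (measurable_infDist.pow_const α) measurable_const
  by_cases h : D.card = 1
  · simp [h]
  · simp only [h, false_or]
    exact measurable_infDist measurableSet_Iio

lemma rho_nonneg (x : Vec d) : 0 ≤ rho Ω D α x := by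
  unfold rho
  split_ifs
  · exact Real.rpow_nonneg Metric.infDist_nonneg _
  · exact zero_le_one

lemma infDist_pos (hD : D.Nonempty) {x : Vec d} (hx : x ∉ D) :
    0 < Metric.infDist x (D : Set (Vec d)) :=
  (D.finite_toSet.isClosed.notMem_iff_infDist_pos (by simpa using hD)).1 (by simpa using hx)

lemma rho_pos (hD : D.Nonempty) {x : Vec d} (hx : x ∉ D) : 0 < rho Ω D α x := by
  unfold rho
  split_ifs
  · exact Real.rpow_pos_of_pos (infDist_pos hD hx) _
  · exact zero_lt_one

lemma ae_notMem_finset (hd : 0 < d) (D : Finset (Vec d)) : ∀ᵐ x : Vec d, x ∉ D := by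
  have : Nonempty (Fin d) := ⟨⟨0, hd⟩⟩
  have := measure_eq_zero_iff_ae_notMem.1 (D.finite_toSet.measure_zero (volume : Measure (Vec d)))
  simpa using this

/-- Two-sided control of the weight on a bounded domain. -/
lemma exists_rho_bounds (hΩ : Bornology.IsBounded Ω) (hD : D.Nonempty)
    (hDΩ : (D : Set (Vec d)) ⊆ Ω) (hα : 0 < α) :
    ∃ c R : ℝ, 0 < c ∧ 0 < R ∧ (∀ x ∈ closure Ω, ∀ y ∈ closure Ω, dist x y ≤ R) ∧
      (∀ x ∈ closure Ω, c * Metric.infDist x (D : Set (Vec d)) ^ α ≤ rho Ω D α x) ∧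
      ∀ x ∈ closure Ω, rho Ω D α x ≤ R ^ α := by
  -- R is also kept at least 1, so that R^α bounds the constant value of the weight away from 𝒟.
  set R := max (Metric.diam (closure Ω)) 1 with hR
  have hR1 : 1 ≤ R := le_max_right _ _
  have hR0 : 0 < R := by linarith
  have hdist : ∀ x ∈ closure Ω, ∀ y ∈ closure Ω, dist x y ≤ R := fun x hx y hy =>
    (Metric.dist_le_diam_of_mem hΩ.closure hx hy).trans (le_max_left _ _)
  obtain ⟨t, ht⟩ := hD
  have hinf : ∀ x ∈ closure Ω, Metric.infDist x (D : Set (Vec d)) ≤ R := fun x hx =>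
    (Metric.infDist_le_dist_of_mem (by simpa using ht)).trans
      (hdist x hx t (subset_closure (hDΩ ht)))
  have hRα : 1 ≤ R ^ α := Real.one_le_rpow hR1 hα.le
  refine ⟨(R ^ α)⁻¹, R, by positivity, hR0, hdist, fun x hx => ?_, fun x hx => ?_⟩
  · have h1 : Metric.infDist x (D : Set (Vec d)) ^ α ≤ R ^ α :=
      Real.rpow_le_rpow Metric.infDist_nonneg (hinf x hx) hα.le
    have h0 : 0 ≤ Metric.infDist x (D : Set (Vec d)) ^ α :=
      Real.rpow_nonneg Metric.infDist_nonneg _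
    unfold rho
    split_ifs
    · exact mul_le_of_le_one_left h0 (inv_le_one_of_one_le₀ hRα)
    · rw [inv_mul_le_iff₀ (by positivity)]; linarith
  · unfold rho
    split_ifs
    · exact Real.rpow_le_rpow Metric.infDist_nonneg (hinf x hx) hα.le
    · exact hRα

/-- Homogeneity reduces every ball to the unit ball, where |x|^(-α) is integrable because α < d. -/
lemma exists_lintegral_rpow (hd : 0 < d) (hα : α < d) : ∃ K : ℝ, 0 < K ∧ ∀ (t : Vec d) (s : ℝ),
    0 < s → ∫⁻ x in Metric.ball t s, ENNReal.ofReal (‖x - t‖ ^ (-α)) ≤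
      ENNReal.ofReal (K * (s ^ (-α) * s ^ d)) := by
  have hmeas : Measurable fun x : Vec d => ‖x‖ ^ (-α) := measurable_norm.pow_const _
  have hint : IntegrableOn (fun x : Vec d => ‖x‖ ^ (-α)) (Metric.ball 0 1) :=
    integrableOn_ball_of_norm_le_rpow (C := 1) (α := α)
      (by rw [finrank_euclideanSpace, Fintype.card_fin]; exact hd) (by simpa using hα)
      (Eventually.of_forall fun x => by
        rw [one_mul, Real.norm_of_nonneg (Real.rpow_nonneg (norm_nonneg _) _)])
      hmeas.aestronglyMeasurable
  set K := ∫ x : Vec d in Metric.ball 0 1, ‖x‖ ^ (-α) with hK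
  have hK0 : 0 ≤ K := integral_nonneg fun x => Real.rpow_nonneg (norm_nonneg _) _
  refine ⟨K + 1, by linarith, fun t s hs => ?_⟩
  set f : Vec d → ℝ := (Metric.ball (0 : Vec d) 1).indicator fun x => ‖x‖ ^ (-α) with hf
  have hfint : Integrable f := (integrable_indicator_iff measurableSet_ball).2 hint
  have hfi : ∫ y, f y = K := integral_indicator measurableSet_ball
  have hscale := integral_comp_scale f t hs
  have hpt : ∀ x, f (s⁻¹ • (x - t)) =
      (Metric.ball t s).indicator (fun x => s ^ α * ‖x - t‖ ^ (-α)) x := by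
    intro x
    have hn : ‖s⁻¹ • (x - t)‖ = s⁻¹ * ‖x - t‖ := by
      rw [norm_smul, Real.norm_of_nonneg (by positivity)]
    have hiff : s⁻¹ • (x - t) ∈ Metric.ball (0 : Vec d) 1 ↔ x ∈ Metric.ball t s := by
      rw [mem_ball_zero_iff, hn, inv_mul_lt_iff₀ hs, mul_one, Metric.mem_ball, dist_eq_norm]
    by_cases hx : x ∈ Metric.ball t s
    · rw [hf, Set.indicator_of_mem (hiff.2 hx), Set.indicator_of_mem hx, hn,
        Real.mul_rpow (by positivity) (norm_nonneg _), Real.inv_rpow hs.le, Real.rpow_neg hs.le,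
        inv_inv]
    · rw [hf, Set.indicator_of_notMem (fun h => hx (hiff.1 h)), Set.indicator_of_notMem hx]
  simp_rw [hpt] at hscale
  rw [integral_indicator measurableSet_ball, integral_const_mul, hfi] at hscale
  have hint2 : IntegrableOn (fun x : Vec d => ‖x - t‖ ^ (-α)) (Metric.ball t s) := by
    have h1 : Integrable fun x => f (s⁻¹ • (x - t)) :=
      ((integrable_comp_smul_iff volume f (inv_ne_zero hs.ne')).2 hfint).comp_sub_right t
    simp_rw [hpt] at h1
    rw [integrable_indicator_iff measurableSet_ball] at h1
    have h2 := h1.const_mul (s ^ α)⁻¹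
    refine h2.congr (Eventually.of_forall fun x => ?_)
    simp only
    rw [← mul_assoc, inv_mul_cancel₀ (Real.rpow_pos_of_pos hs α).ne', one_mul]
  rw [← ofReal_integral_eq_lintegral_ofReal hint2
    (Eventually.of_forall fun x => Real.rpow_nonneg (norm_nonneg _) _)]
  refine ENNReal.ofReal_le_ofReal ?_
  have hsα := Real.rpow_pos_of_pos hs α
  have h3 : ∫ x in Metric.ball t s, ‖x - t‖ ^ (-α) = K * (s ^ (-α) * s ^ d) := by
    rw [Real.rpow_neg hs.le]
    field_simp
    linarith
  rw [h3]
  gcongr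
  linarith

lemma rhoInv_le (hD : D.Nonempty) {c : ℝ} (hc : 0 < c) {x : Vec d} (hx : x ∉ D)
    (h : c * Metric.infDist x (D : Set (Vec d)) ^ α ≤ rho Ω D α x) :
    rhoInv Ω D α x ≤ c⁻¹ * Metric.infDist x (D : Set (Vec d)) ^ (-α) := by
  have h1 := Real.rpow_pos_of_pos (infDist_pos hD hx) α
  rw [rhoInv, Real.rpow_neg Metric.infDist_nonneg, ← mul_inv]
  exact inv_anti₀ (by positivity) h

lemma exists_infDist_eq (hD : D.Nonempty) (x : Vec d) :
    ∃ t ∈ D, Metric.infDist x (D : Set (Vec d)) = dist x t := by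
  obtain ⟨t, ht, h⟩ := D.finite_toSet.isCompact.exists_infDist_eq_dist (by simpa using hD) x
  exact ⟨t, ht, h⟩

/-- `ρ⁻¹` is integrable over the domain. -/
lemma lintegral_rhoInv_lt_top (hd : 0 < d) (hΩo : IsOpen Ω) (hΩ : Bornology.IsBounded Ω) (hD : D.Nonempty)
    (hDΩ : (D : Set (Vec d)) ⊆ Ω) (hα : 0 < α) (hα' : α < d) :
    ∫⁻ x in Ω, ENNReal.ofReal (rhoInv Ω D α x) < ∞ := by
  obtain ⟨c, R, hc, hR, hdist, hlow, -⟩ := exists_rho_bounds (α := α) hΩ hD hDΩ hα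
  obtain ⟨K, hK, hKb⟩ := exists_lintegral_rpow hd hα'
  have hm : ∀ t : Vec d, Measurable fun x : Vec d => ENNReal.ofReal (‖x - t‖ ^ (-α)) := fun t =>
    ((measurable_id.sub_const t).norm.pow_const _).ennreal_ofReal
  calc ∫⁻ x in Ω, ENNReal.ofReal (rhoInv Ω D α x)
      ≤ ∫⁻ x in ⋂ t ∈ D, Metric.ball t (R + 1),
          ENNReal.ofReal c⁻¹ * ∑ t ∈ D, ENNReal.ofReal (‖x - t‖ ^ (-α)) := by
        have hsub : Ω ⊆ ⋂ t ∈ D, Metric.ball t (R + 1) := by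
          intro x hx
          simp only [Set.mem_iInter]
          intro t ht
          have := hdist x (subset_closure hx) t (subset_closure (hDΩ ht))
          rw [Metric.mem_ball]; linarith
        refine (lintegral_mono_ae ?_).trans (lintegral_mono' (Measure.restrict_mono hsub le_rfl)
          le_rfl)
        filter_upwards [ae_restrict_of_ae (s := Ω) (ae_notMem_finset hd D),
          ae_restrict_mem hΩo.measurableSet] with x hx hxΩ
        refine (ENNReal.ofReal_le_ofReal
          (rhoInv_le hD hc hx (hlow x (subset_closure hxΩ)))).trans ?_
        rw [ENNReal.ofReal_mul (by positivity)]
        gcongr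
        -- The distance to 𝒟 is attained at one t, so its power is one summand of the sum over 𝒟.
        obtain ⟨t, ht, h⟩ := exists_infDist_eq hD x
        rw [h, dist_eq_norm]
        exact Finset.single_le_sum (f := fun t => ENNReal.ofReal (‖x - t‖ ^ (-α)))
          (fun _ _ => zero_le) ht
    _ ≤ ENNReal.ofReal c⁻¹ * ∑ t ∈ D, ENNReal.ofReal (K * ((R + 1) ^ (-α) * (R + 1) ^ d)) := by
        rw [lintegral_const_mul _ (Finset.measurable_fun_sum _ fun t _ => hm t)]
        gcongr
        rw [lintegral_finsetSum _ fun t _ => hm t]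
        refine Finset.sum_le_sum fun t ht => ?_
        refine le_trans ?_ (hKb t (R + 1) (by linarith))
        exact lintegral_mono' (Measure.restrict_mono (Set.biInter_subset_of_mem ht) le_rfl) le_rfl
    _ < ∞ := by
        rw [Finset.sum_const, nsmul_eq_mul]
        exact ENNReal.mul_lt_top ENNReal.ofReal_lt_top
          (ENNReal.mul_lt_top (ENNReal.natCast_lt_top _) ENNReal.ofReal_lt_top)

/-- The Cauchy-Schwarz inequality with a weight. -/
lemma integral_norm_le_of_weight {F : Type*} [NormedAddCommGroup F] {B : Set (Vec d)}
    {f : Vec d → F} {ω : Vec d → ℝ} (hω : Measurable ω) (hpos : ∀ᵐ x ∂(volume.restrict B), 0 < ω x)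
    (hf : AEStronglyMeasurable f (volume.restrict B)) {W E : ℝ} (hE0 : 0 ≤ E) (hW0 : 0 ≤ W)
    (hW : ∫⁻ x in B, ENNReal.ofReal (ω x)⁻¹ ≤ ENNReal.ofReal W)
    (hE : wL2Sq ω B f ≤ ENNReal.ofReal (E ^ 2)) :
    ∫ x in B, ‖f x‖ ≤ √W * E := by
  rw [integral_norm_eq_lintegral_enorm hf]
  refine ENNReal.toReal_le_of_le_ofReal (by positivity) ?_
  have h1 : ∫⁻ x in B, ‖f x‖ₑ = ∫⁻ x in B, ((fun x => ENNReal.ofReal (ω x)⁻¹ ^ (1 / 2 : ℝ)) *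
      (fun x => ‖f x‖ₑ * ENNReal.ofReal (ω x) ^ (1 / 2 : ℝ))) x := by
    refine lintegral_congr_ae ?_
    filter_upwards [hpos] with x hx
    show ‖f x‖ₑ = ENNReal.ofReal (ω x)⁻¹ ^ (1 / 2 : ℝ) *
      (‖f x‖ₑ * ENNReal.ofReal (ω x) ^ (1 / 2 : ℝ))
    rw [mul_left_comm, ← ENNReal.mul_rpow_of_nonneg _ _ (by norm_num),
      ← ENNReal.ofReal_mul (by positivity), inv_mul_cancel₀ hx.ne']
    simp
  rw [h1]
  refine (ENNReal.lintegral_mul_le_Lp_mul_Lq (volume.restrict B) Real.HolderConjugate.two_two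
    (f := fun x => ENNReal.ofReal (ω x)⁻¹ ^ (1 / 2 : ℝ))
    (g := fun x => ‖f x‖ₑ * ENNReal.ofReal (ω x) ^ (1 / 2 : ℝ))
    (hω.inv.ennreal_ofReal.pow_const _).aemeasurable
    (hf.enorm.mul (hω.ennreal_ofReal.pow_const _).aemeasurable)).trans ?_
  have e1 : ∀ x, (ENNReal.ofReal (ω x)⁻¹ ^ (1 / 2 : ℝ)) ^ (2 : ℝ) = ENNReal.ofReal (ω x)⁻¹ := by
    intro x; rw [← ENNReal.rpow_mul]; norm_num
  have e2 : ∀ x, (‖f x‖ₑ * ENNReal.ofReal (ω x) ^ (1 / 2 : ℝ)) ^ (2 : ℝ) =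
      ‖f x‖ₑ ^ 2 * ENNReal.ofReal (ω x) := by
    intro x
    rw [ENNReal.mul_rpow_of_nonneg _ _ (by norm_num), ← ENNReal.rpow_mul]; norm_num
  rw [lintegral_congr e1, lintegral_congr e2]
  rw [ENNReal.ofReal_mul (by positivity), Real.sqrt_eq_rpow,
    ← ENNReal.ofReal_rpow_of_nonneg hW0 (by norm_num)]
  gcongr
  calc (∫⁻ x in B, ‖f x‖ₑ ^ 2 * ENNReal.ofReal (ω x)) ^ (1 / 2 : ℝ)
      ≤ ENNReal.ofReal (E ^ 2) ^ (1 / 2 : ℝ) := by gcongr; exact hE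
    _ = ENNReal.ofReal E := by
        rw [ENNReal.ofReal_rpow_of_nonneg (by positivity) (by norm_num), ← Real.sqrt_eq_rpow,
          Real.sqrt_sq hE0]

end

section

/-! ### Testing the adjoint equation with smooth fields -/

variable {Ω : Set (Vec d)} {D : Finset (Vec d)} {α : ℝ}

lemma isTest_grad {w : Vec d → Vec d} (hw : IsTest Ω w) :
    Continuous (grad w) ∧ HasCompactSupport (grad w) ∧ ∀ x, x ∉ tsupport w → grad w x = 0 := by
  have h0 : ∀ x, x ∉ tsupport w → fderiv ℝ w x = 0 := fun x hx =>
    image_eq_zero_of_notMem_tsupport fun h => hx (tsupport_fderiv_subset ℝ h)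
  have h1 : ∀ x, x ∉ tsupport w → grad w x = 0 := fun x hx => by
    rw [grad, h0 x hx]; ext; simp
  refine ⟨?_, HasCompactSupport.intro hw.2.1 h1, h1⟩
  have hc : Continuous (fderiv ℝ w) := hw.1.continuous_fderiv (by simp)
  refine (PiLp.continuous_toLp 2 _).comp (continuous_pi fun j => ?_)
  exact hc.clm_apply continuous_const

lemma memL2_of_continuous {F : Type*} [NormedAddCommGroup F] {wt : Vec d → ℝ}
    (hwt : ∫⁻ x in Ω, ENNReal.ofReal (wt x) < ∞) {f : Vec d → F} (hf : Continuous f)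
    (hfc : HasCompactSupport f) : MemL2 wt Ω f := by
  refine ⟨hf.locallyIntegrable.locallyIntegrableOn Ω, ?_⟩
  obtain ⟨C, hC⟩ := hf.bounded_above_of_compact_support hfc
  calc wL2Sq wt Ω f ≤ ∫⁻ x in Ω, ENNReal.ofReal C ^ 2 * ENNReal.ofReal (wt x) := by
        refine lintegral_mono fun x => ?_
        gcongr
        rw [← ofReal_norm]
        exact ENNReal.ofReal_le_ofReal (hC x)
    _ = ENNReal.ofReal C ^ 2 * ∫⁻ x in Ω, ENNReal.ofReal (wt x) :=
        lintegral_const_mul' _ _ (by simp)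
    _ < ∞ := ENNReal.mul_lt_top (by simp) hwt

lemma isWeakGrad_of_isTest {w : Vec d → Vec d} (hw : IsTest Ω w) : IsWeakGrad Ω w (grad w) := by
  intro φ hφ j
  have hφ0 : ∀ x, x ∉ Ω → φ x = 0 := fun x hx =>
    image_eq_zero_of_notMem_tsupport fun h => hx (hφ.2.2 h)
  have hφ1 : ∀ x, x ∉ Ω → fderiv ℝ φ x = 0 := fun x hx =>
    image_eq_zero_of_notMem_tsupport fun h => hx (hφ.2.2 (tsupport_fderiv_subset ℝ h))
  rw [setIntegral_eq_integral_of_forall_compl_eq_zero fun x hx => by rw [hφ1 x hx]; simp,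
    setIntegral_eq_integral_of_forall_compl_eq_zero fun x hx => by rw [hφ0 x hx]; simp]
  have hφd : Differentiable ℝ φ := hφ.1.differentiable (by simp)
  have hwd : Differentiable ℝ w := hw.1.differentiable (by simp)
  have c1 : Continuous fun x => fderiv ℝ φ x (basisVec j) :=
    (hφ.1.continuous_fderiv (by simp)).clm_apply continuous_const
  have c2 : Continuous fun x => fderiv ℝ w x (basisVec j) :=
    (hw.1.continuous_fderiv (by simp)).clm_apply continuous_const
  have h := integral_smul_fderiv_eq_neg_fderiv_smul_of_integrable (μ := volume) (f := φ) (g := w)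
    (v := basisVec j) ?_ ?_ ?_ (fun x _ => hφd x) (fun x _ => hwd x)
  · have e : ∀ x, φ x • grad w x j = φ x • fderiv ℝ w x (basisVec j) := fun x => rfl
    simp_rw [e, h, neg_neg]
  · exact (c1.smul hw.1.continuous).integrable_of_hasCompactSupport hw.2.1.smul_left
  · exact (hφ.1.continuous.smul c2).integrable_of_hasCompactSupport hφ.2.1.smul_right
  · exact (hφ.1.continuous.smul hw.1.continuous).integrable_of_hasCompactSupport hw.2.1.smul_left

lemma testSeqTendsto_const {wt : Vec d → ℝ} {w : Vec d → Vec d} (hw : IsTest Ω w) :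
    TestSeqTendsto wt Ω (fun _ => w) w (grad w) := by
  refine ⟨fun _ => hw, ?_, ?_⟩ <;> simp [wL2Sq]

/-- A constant sequence is an admissible approximation, and bounded compactly supported fields have
finite norm under an integrable weight. With ρ⁻¹ as weight, smooth fields become test functions for
the adjoint equation. -/
lemma memH10_of_isTest {wt : Vec d → ℝ} (hwt : ∫⁻ x in Ω, ENNReal.ofReal (wt x) < ∞)
    {w : Vec d → Vec d} (hw : IsTest Ω w) : MemH10 wt Ω w (grad w) :=
  ⟨⟨memL2_of_continuous hwt hw.1.continuous hw.2.1,
    memL2_of_continuous hwt (isTest_grad hw).1 (isTest_grad hw).2.1, isWeakGrad_of_isTest hw⟩,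
    fun _ => w, testSeqTendsto_const hw⟩

lemma isDiracValue_of_isTest {wt : Vec d → ℝ} {w : Vec d → Vec d} (hw : IsTest Ω w) (t : Vec d) :
    IsDiracValue wt Ω t w (grad w) (w t) :=
  ⟨fun _ => w, testSeqTendsto_const hw, tendsto_const_nhds⟩

/-- Local integrability of f is enough, since the compact support of the test gradient confines the
product to K. -/
lemma integrableOn_of_bilinear {F : Type*} [NormedAddCommGroup F] [NormedSpace ℝ F] {f : Vec d → F}
    (hf : LocallyIntegrableOn f Ω) (hΩ : IsOpen Ω) {K : Set (Vec d)} (hK : IsCompact K)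
    (hKΩ : K ⊆ Ω) {g : Vec d → ℝ} {C : ℝ} (hg : AEStronglyMeasurable g (volume.restrict Ω))
    (hgf : ∀ x ∈ K, ‖g x‖ ≤ C * ‖f x‖) (hg0 : ∀ x, x ∉ K → g x = 0) : IntegrableOn g Ω := by
  have h1 : IntegrableOn f K := hf.integrableOn_compact_subset hKΩ hK
  have h2 : IntegrableOn g K := by
    refine Integrable.mono' (h1.norm.const_mul C) (hg.mono_measure (Measure.restrict_mono hKΩ le_rfl))
      ?_
    filter_upwards [ae_restrict_mem hK.measurableSet] with x hx using hgf x hx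
  exact h2.of_forall_sdiff_eq_zero hΩ.measurableSet fun x hx => hg0 x hx.2

lemma integrableOn_inner_grad {w : Vec d → Vec d} (hw : IsTest Ω w) (hΩ : IsOpen Ω)
    {G : Vec d → Tens d} (hG : LocallyIntegrableOn G Ω) :
    IntegrableOn (fun x => ⟪grad w x, G x⟫_ℝ) Ω := by
  obtain ⟨hc, hcs, h0⟩ := isTest_grad hw
  obtain ⟨C, hC⟩ := hc.bounded_above_of_compact_support hcs
  refine integrableOn_of_bilinear hG hΩ hw.2.1 hw.2.2 (C := C)
    (hc.aestronglyMeasurable.inner (hG.aestronglyMeasurable)) (fun x _ => ?_) fun x hx => ?_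
  · exact (norm_inner_le_norm _ _).trans (mul_le_mul_of_nonneg_right (hC x) (norm_nonneg _))
  · rw [h0 x hx, inner_zero_left]

lemma integrableOn_mul_tr_grad {w : Vec d → Vec d} (hw : IsTest Ω w) (hΩ : IsOpen Ω)
    {q : Vec d → ℝ} (hq : LocallyIntegrableOn q Ω) :
    IntegrableOn (fun x => q x * tr (grad w x)) Ω := by
  obtain ⟨hc, hcs, h0⟩ := isTest_grad hw
  obtain ⟨C, hC⟩ := hc.bounded_above_of_compact_support hcs
  refine integrableOn_of_bilinear hq hΩ hw.2.1 hw.2.2 (C := d * C)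
    (hq.aestronglyMeasurable.mul (continuous_tr.comp hc).aestronglyMeasurable)
    (fun x _ => ?_) fun x hx => ?_
  · rw [norm_mul, mul_comm]
    refine mul_le_mul_of_nonneg_right ((abs_tr_le _).trans ?_) (norm_nonneg _)
    gcongr
    exact hC x
  · rw [h0 x hx]; simp [tr]

lemma locallyIntegrableOn_of_inV {M : Mesh Ω} {z : Vec d → Vec d} (hz : M.InV z) :
    LocallyIntegrableOn (grad z) Ω := hz.2.1.2.1.1

lemma locallyIntegrableOn_of_inQ (hΩ : IsOpen Ω) {M : Mesh Ω} {q : Vec d → ℝ} (hq : M.InQ q) :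
    LocallyIntegrableOn q Ω :=
  (hq.1.mono subset_closure).locallyIntegrableOn hΩ.measurableSet

/-- The error equation, tested with smooth fields. -/
lemma residual_identity (hd : 0 < d) (hΩ : IsOpen Ω) (hΩb : Bornology.IsBounded Ω)
    (hD : D.Nonempty) (hDΩ : (D : Set (Vec d)) ⊆ Ω) (hα : 0 < α) (hα' : α < d)
    {lam : ℝ} {lo up : Vec d} {yd y : Vec d → Vec d} {Gy : Vec d → Tens d} {p : Vec d → ℝ}
    {z : Vec d → Vec d} {Gz : Vec d → Tens d} {r : Vec d → ℝ} {u : Vec d → Vec d}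
    (hopt : IsOptimal Ω D α lam lo up yd y Gy p z Gz r u) {zT : Vec d → Vec d} {rT : Vec d → ℝ}
    (hzT : LocallyIntegrableOn (grad zT) Ω) (hrT : LocallyIntegrableOn rT Ω) {w : Vec d → Vec d}
    (hw : IsTest Ω w) :
    ∑ t ∈ D, ⟪y t - yd t, w t⟫_ℝ - weakResidual Ω zT rT w =
      ∫ x in Ω, (⟪grad w x, Gz x - grad zT x⟫_ℝ + (r x - rT x) * tr (grad w x)) := by
  have h := hopt.adjoint_momentum w (grad w)
    (memH10_of_isTest (lintegral_rhoInv_lt_top hd hΩ hΩb hD hDΩ hα hα') hw) w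
    (fun t _ => isDiracValue_of_isTest hw t)
  have hGz : LocallyIntegrableOn Gz Ω := hopt.z_mem.1.2.1.1
  have hr : LocallyIntegrableOn r Ω := hopt.r_mem.1
  have i1 := integrableOn_inner_grad hw hΩ hGz
  have i2 := integrableOn_mul_tr_grad hw hΩ hr
  have i3 := integrableOn_inner_grad hw hΩ hzT
  have i4 := integrableOn_mul_tr_grad hw hΩ hrT
  have i12 : IntegrableOn (fun x => ⟪grad w x, Gz x⟫_ℝ + r x * tr (grad w x)) Ω := i1.add i2
  have i34 : IntegrableOn (fun x => ⟪grad w x, grad zT x⟫_ℝ + rT x * tr (grad w x)) Ω := i3.add i4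
  rw [← h, aForm, bForm, sub_neg_eq_add, weakResidual, ← integral_add i1 i2,
    ← integral_sub i12 i34]
  refine integral_congr_ae (Eventually.of_forall fun x => ?_)
  simp only [inner_sub_right]
  ring

/-- Everything lives on the ball, where the gradient of the bump is at most C‖a‖/s; the factor d is
the price of bounding a trace by the norm. -/
lemma abs_residual_le (hd : 0 < d) (hΩ : IsOpen Ω) (hΩb : Bornology.IsBounded Ω)
    (hD : D.Nonempty) (hDΩ : (D : Set (Vec d)) ⊆ Ω) (hα : 0 < α) (hα' : α < d)
    {lam : ℝ} {lo up : Vec d} {yd y : Vec d → Vec d} {Gy : Vec d → Tens d} {p : Vec d → ℝ}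
    {z : Vec d → Vec d} {Gz : Vec d → Tens d} {r : Vec d → ℝ} {u : Vec d → Vec d}
    (hopt : IsOptimal Ω D α lam lo up yd y Gy p z Gz r u) {zT : Vec d → Vec d} {rT : Vec d → ℝ}
    (hzT : LocallyIntegrableOn (grad zT) Ω) (hrT : LocallyIntegrableOn rT Ω)
    {C : ℝ} (hC : ∀ y : Vec d, bumpKer y * ‖y‖ ≤ C) {x₀ a : Vec d} {s : ℝ} (hs : 0 < s)
    (hball : Metric.closedBall x₀ s ⊆ Ω) :
    |∑ t ∈ D, ⟪y t - yd t, bumpField x₀ s a t⟫_ℝ - weakResidual Ω zT rT (bumpField x₀ s a)| ≤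
      d * (C * ‖a‖ / s) * ((∫ x in Metric.ball x₀ s, ‖Gz x - grad zT x‖) +
        ∫ x in Metric.ball x₀ s, ‖r x - rT x‖) := by
  have hw := isTest_bumpField (a := a) hs hball
  have hGz : LocallyIntegrableOn (fun x => Gz x - grad zT x) Ω := hopt.z_mem.1.2.1.1.sub hzT
  have hr : LocallyIntegrableOn (fun x => r x - rT x) Ω := hopt.r_mem.1.sub hrT
  have hcb := isCompact_closedBall x₀ s
  have i1 : IntegrableOn (fun x => ‖Gz x - grad zT x‖) (Metric.ball x₀ s) :=
    ((hGz.integrableOn_compact_subset hball hcb).mono_set Metric.ball_subset_closedBall).norm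
  have i2 : IntegrableOn (fun x => ‖r x - rT x‖) (Metric.ball x₀ s) :=
    ((hr.integrableOn_compact_subset hball hcb).mono_set Metric.ball_subset_closedBall).norm
  rw [residual_identity hd hΩ hΩb hD hDΩ hα hα' hopt hzT hrT hw,
    setIntegral_eq_of_subset_of_forall_sdiff_eq_zero hΩ.measurableSet
      (Metric.ball_subset_closedBall.trans hball)
      (fun x hx => by rw [grad_bumpField_eq_zero hs hx.2]; simp [tr]),
    ← integral_add i1 i2, ← integral_const_mul]
  refine (abs_integral_le_integral_abs).trans (integral_mono_of_nonneg
    (Eventually.of_forall fun x => abs_nonneg _) ((i1.add i2).const_mul _)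
    (Eventually.of_forall fun x => ?_))
  have h1 := norm_grad_bumpField_le (x₀ := x₀) (a := a) hs hC x
  have hd1 : (1 : ℝ) ≤ d := by exact_mod_cast hd
  have h0 : 0 ≤ C * ‖a‖ / s := (norm_nonneg _).trans h1
  have e1 : |⟪grad (bumpField x₀ s a) x, Gz x - grad zT x⟫_ℝ| ≤
      d * (C * ‖a‖ / s) * ‖Gz x - grad zT x‖ := by
    refine (abs_real_inner_le_norm _ _).trans (mul_le_mul_of_nonneg_right ?_ (norm_nonneg _))
    nlinarith
  have e2 : |(r x - rT x) * tr (grad (bumpField x₀ s a) x)| ≤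
      d * (C * ‖a‖ / s) * ‖r x - rT x‖ := by
    rw [abs_mul, mul_comm, ← Real.norm_eq_abs (r x - rT x)]
    refine mul_le_mul_of_nonneg_right ((abs_tr_le _).trans ?_) (norm_nonneg _)
    gcongr
  refine (abs_add_le _ _).trans ((add_le_add e1 e2).trans (le_of_eq ?_))
  ring

/-- The adjoint velocity is divergence free. -/
lemma tr_eq_zero_ae (hd : 0 < d) (hΩ : IsOpen Ω) (hΩb : Bornology.IsBounded Ω)
    (hD : D.Nonempty) (hDΩ : (D : Set (Vec d)) ⊆ Ω) (hα : 0 < α)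
    {G : Vec d → Tens d} (hG : MemL2 (rho Ω D α) Ω G)
    (h : ∀ s, MemL2 (rhoInv Ω D α) Ω s → bForm Ω G s = 0) :
    ∀ᵐ x ∂(volume.restrict Ω), tr (G x) = 0 := by
  obtain ⟨c, R, hc, hR, -, -, hup⟩ := exists_rho_bounds (α := α) hΩb hD hDΩ hα
  have hmeas : AEStronglyMeasurable (fun x => tr (G x)) (volume.restrict Ω) :=
    continuous_tr.comp_aestronglyMeasurable hG.1.aestronglyMeasurable
  have hmeas2 : AEStronglyMeasurable (fun x => rho Ω D α x * tr (G x)) (volume.restrict Ω) :=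
    measurable_rho.aestronglyMeasurable.mul hmeas
  have hpos : ∀ᵐ x ∂(volume.restrict Ω), 0 < rho Ω D α x := by
    filter_upwards [ae_restrict_of_ae (ae_notMem_finset hd D)] with x hx using rho_pos hD hx
  -- The test function is ρ tr G: it lies in L²(ρ⁻¹) because (ρ tr G)² ρ⁻¹ = ρ (tr G)², and testing
  -- with it makes the integral of ρ (tr G)² vanish.
  have hs : MemL2 (rhoInv Ω D α) Ω (fun x => rho Ω D α x * tr (G x)) := by
    constructor
    · intro x hx
      obtain ⟨U, hU, hUi⟩ := hG.1 x hx
      refine ⟨U ∩ Ω, inter_mem hU self_mem_nhdsWithin, ?_⟩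
      refine Integrable.mono' ((hUi.mono_set Set.inter_subset_left).norm.const_mul (R ^ α * d))
        (hmeas2.mono_measure (Measure.restrict_mono Set.inter_subset_right le_rfl)) ?_
      have : ∀ᵐ x ∂(volume.restrict (U ∩ Ω)), x ∈ Ω :=
        ae_mono (Measure.restrict_mono Set.inter_subset_right le_rfl)
          (ae_restrict_mem hΩ.measurableSet)
      filter_upwards [this] with x hx
      rw [norm_mul, Real.norm_of_nonneg (rho_nonneg x), mul_assoc]
      exact mul_le_mul (hup x (subset_closure hx)) (abs_tr_le _) (norm_nonneg _) (by positivity)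
    · refine lt_of_le_of_lt ?_ (ENNReal.mul_lt_top
        (ENNReal.pow_lt_top (n := 2) (ENNReal.natCast_lt_top d)) hG.2)
      rw [wL2Sq, wL2Sq, ← lintegral_const_mul' _ _ (by simp)]
      refine lintegral_mono_ae ?_
      filter_upwards [hpos] with x hx
      rw [enorm_mul, mul_pow, Real.enorm_of_nonneg hx.le, rhoInv]
      calc ENNReal.ofReal (rho Ω D α x) ^ 2 * ‖tr (G x)‖ₑ ^ 2 * ENNReal.ofReal (rho Ω D α x)⁻¹
          = ‖tr (G x)‖ₑ ^ 2 * (ENNReal.ofReal (rho Ω D α x) *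
              (ENNReal.ofReal (rho Ω D α x) * ENNReal.ofReal (rho Ω D α x)⁻¹)) := by ring
        _ = ‖tr (G x)‖ₑ ^ 2 * ENNReal.ofReal (rho Ω D α x) := by
            rw [← ENNReal.ofReal_mul hx.le, mul_inv_cancel₀ hx.ne', ENNReal.ofReal_one, mul_one]
        _ ≤ (d * ‖G x‖ₑ) ^ 2 * ENNReal.ofReal (rho Ω D α x) := by
            gcongr
            rw [← ofReal_norm, ← ofReal_norm, ← ENNReal.ofReal_natCast,
              ← ENNReal.ofReal_mul (by positivity)]
            exact ENNReal.ofReal_le_ofReal (abs_tr_le _)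
        _ = _ := by ring
  have h0 := h _ hs
  rw [bForm, neg_eq_zero] at h0
  have hint : IntegrableOn (fun x => rho Ω D α x * tr (G x) * tr (G x)) Ω := by
    refine ⟨hmeas2.mul hmeas, ?_⟩
    refine lt_of_le_of_lt ?_ (ENNReal.mul_lt_top
        (ENNReal.pow_lt_top (n := 2) (ENNReal.natCast_lt_top d)) hG.2)
    rw [wL2Sq, ← lintegral_const_mul' _ _ (by simp)]
    refine lintegral_mono fun x => ?_
    rw [enorm_mul, enorm_mul, Real.enorm_of_nonneg (rho_nonneg x)]
    calc ENNReal.ofReal (rho Ω D α x) * ‖tr (G x)‖ₑ * ‖tr (G x)‖ₑ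
        = ‖tr (G x)‖ₑ ^ 2 * ENNReal.ofReal (rho Ω D α x) := by ring
      _ ≤ (d * ‖G x‖ₑ) ^ 2 * ENNReal.ofReal (rho Ω D α x) := by
          gcongr
          rw [← ofReal_norm, ← ofReal_norm, ← ENNReal.ofReal_natCast,
            ← ENNReal.ofReal_mul (by positivity)]
          exact ENNReal.ofReal_le_ofReal (abs_tr_le _)
      _ = _ := by ring
  have h1 := (integral_eq_zero_iff_of_nonneg_ae (Eventually.of_forall fun x => by
    have := mul_nonneg (rho_nonneg (Ω := Ω) (D := D) (α := α) x) (mul_self_nonneg (tr (G x)))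
    simpa [mul_assoc] using this) hint).1 h0
  filter_upwards [h1, hpos] with x hx hx'
  simpa [hx'.ne'] using hx

end

section

/-! ### Estimates for the discrete residuals on balls where the error is controlled -/

variable {Ω : Set (Vec d)} {z : Vec d → Vec d} {r : Vec d → ℝ} {s n : ℝ}

/-- The weak momentum residual and the divergence of `(z, r)`, tested with bumps supported in
the ball of radius `s` about `x₀`, are bounded in terms of `n`. -/
structure IsControlled (Ω : Set (Vec d)) (z : Vec d → Vec d) (r : Vec d → ℝ) (s n : ℝ)
    (x₀ : Vec d) : Prop where
  ball_subset : Metric.ball x₀ s ⊆ Ω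
  residual_le : ∀ a, |weakResidual Ω z r (bumpField x₀ s a)| ≤
    s ^ d * s⁻¹ * (‖a‖ * (n * bumpInt d))
  div_le : |∫ x, bump (s⁻¹ • (x - x₀)) * tr (grad z x)| ≤ s ^ d * (n * bumpInt d)

/-- Of two distant balls inside `X`, at least one is controlled. -/
def IsPatchControlled (Ω : Set (Vec d)) (z : Vec d → Vec d) (r : Vec d → ℝ) (s n : ℝ)
    (X : Set (Vec d)) : Prop :=
  ∀ x x', Metric.closedBall x (2 * s) ⊆ X → Metric.closedBall x' (2 * s) ⊆ X →
    4 * s ≤ dist x x' → IsControlled Ω z r s n x ∨ IsControlled Ω z r s n x'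

/-- Among x and x ± 4s u, pairwise at distance at least 4s, at most one point fails to be
controlled. Two controlled points are what it takes to bound an affine function on the line. -/
lemma IsPatchControlled.exists_two {X : Set (Vec d)} (h : IsPatchControlled Ω z r s n X)
    (hs : 0 < s) {x : Vec d} (hx : Metric.closedBall x (6 * s) ⊆ X) {u : Vec d} (hu : ‖u‖ = 1) :
    ∃ p q : ℝ, |p| ≤ 4 * s ∧ |q| ≤ 4 * s ∧ 4 * s ≤ |p - q| ∧
      IsControlled Ω z r s n (x + p • u) ∧ IsControlled Ω z r s n (x + q • u) := by
  have hsub : ∀ p : ℝ, |p| ≤ 4 * s → Metric.closedBall (x + p • u) (2 * s) ⊆ X := by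
    intro p hp
    refine (Metric.closedBall_subset_closedBall' ?_).trans hx
    rw [dist_eq_norm, add_sub_cancel_left, norm_smul, hu, mul_one, Real.norm_eq_abs]
    linarith
  have hdist : ∀ p q : ℝ, dist (x + p • u) (x + q • u) = |p - q| := by
    intro p q
    rw [dist_eq_norm, add_sub_add_left_eq_sub, ← sub_smul, norm_smul, hu, mul_one,
      Real.norm_eq_abs]
  have key : ∀ p q : ℝ, |p| ≤ 4 * s → |q| ≤ 4 * s → 4 * s ≤ |p - q| →
      IsControlled Ω z r s n (x + p • u) ∨ IsControlled Ω z r s n (x + q • u) := by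
    intro p q hp hq hpq
    exact h _ _ (hsub p hp) (hsub q hq) (by rw [hdist]; exact hpq)
  have e0 : |(0 : ℝ)| ≤ 4 * s := by rw [abs_zero]; linarith
  have e1 : |4 * s| ≤ 4 * s := (abs_of_pos (by linarith)).le
  have e2 : |-(4 * s)| ≤ 4 * s := by rw [abs_neg]; exact e1
  have d1 : 4 * s ≤ |0 - 4 * s| := by rw [zero_sub, abs_neg]; exact le_abs_self _
  have d2 : 4 * s ≤ |0 - -(4 * s)| := by rw [sub_neg_eq_add, zero_add]; exact le_abs_self _
  have d3 : 4 * s ≤ |4 * s - -(4 * s)| := by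
    refine le_trans ?_ (le_abs_self _); linarith
  rcases key 0 (4 * s) e0 e1 d1 with h0 | h1
  · rcases key (4 * s) (-(4 * s)) e1 e2 d3 with h1 | h2
    · exact ⟨0, 4 * s, e0, e1, d1, h0, h1⟩
    · exact ⟨0, -(4 * s), e0, e2, d2, h0, h2⟩
  · rcases key 0 (-(4 * s)) e0 e2 d2 with h0 | h2
    · exact ⟨0, 4 * s, e0, e1, d1, h0, h1⟩
    · exact ⟨4 * s, -(4 * s), e1, e2, d3, h1, h2⟩

/-! ### Strong residual and divergence inside an element. -/

section element

variable {S : Set (Vec d)} {P : Vec d → Vec d} {A : Vec d →L[ℝ] Vec d}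
  {B : Vec d →L[ℝ] Vec d →L[ℝ] Vec d} {c : ℝ} {b : Vec d}

/-- The test vector is the residual itself. The powers of s in `IsControlled` are such that n bounds
gradients and pressures, and therefore s times second derivatives. -/
lemma IsControlled.norm_strongResidual_le {x₀ : Vec d} (h : IsControlled Ω z r s n x₀)
    (hs : 0 < s) (hz : IsQuadOn S z P A B) (hr : ∀ x ∈ S, r x = c + ⟪b, x⟫_ℝ)
    (hS : Metric.ball x₀ s ⊆ S) : s * ‖strongResidual B b‖ ≤ n := by
  have h1 := h.residual_le (strongResidual B b)
  have hI : 0 < bumpInt d := bumpInt_pos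
  rw [weakResidual_interior hz hr hs _ hS h.ball_subset, real_inner_self_eq_norm_sq, abs_mul,
    abs_neg, abs_of_pos (by positivity), abs_of_nonneg (by positivity)] at h1
  set ρ := ‖strongResidual B b‖ with hρ
  have hρ0 : 0 ≤ ρ := norm_nonneg _
  have h2 : s * ρ * ρ ≤ n * ρ := by
    have h3 : (s ^ d * s⁻¹ * bumpInt d) * (s * ρ * ρ) ≤ (s ^ d * s⁻¹ * bumpInt d) * (n * ρ) := by
      calc _ = s ^ d * bumpInt d * ρ ^ 2 := by field_simp
        _ ≤ _ := h1
        _ = _ := by ring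
    exact le_of_mul_le_mul_left h3 (by positivity)
  -- If the residual is zero there is nothing to divide by, and n ≥ 0 is read off the divergence
  -- bound.
  rcases hρ0.eq_or_lt with h0 | h0
  · rw [← h0, mul_zero]
    have h4 := (abs_nonneg _).trans h.div_le
    have h5 : 0 < s ^ d * bumpInt d := by positivity
    by_contra hn
    nlinarith
  · exact le_of_mul_le_mul_right h2 h0

/-- The divergence is affine on the ball, so its integral against the even function `bump` sees only
its value at the centre. -/
lemma IsControlled.abs_tr_le {x₀ : Vec d} (h : IsControlled Ω z r s n x₀)
    (hs : 0 < s) (hz : IsQuadOn S z P A B) (hS : Metric.ball x₀ s ⊆ S) :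
    |tr (tensOf (A + B x₀))| ≤ n := by
  have h1 := h.div_le
  have hI : 0 < bumpInt d := bumpInt_pos
  have hcont : Continuous fun y => tr (tensOf (B y)) := by
    simp only [tr, tensOf]
    fun_prop
  have h2 : ∀ x, bump (s⁻¹ • (x - x₀)) * tr (grad z x) = (fun y => bump y *
      (tr (tensOf (A + B x₀)) + s * tr (tensOf (B y)))) (s⁻¹ • (x - x₀)) := by
    intro x
    by_cases hx : x ∈ Metric.ball x₀ s
    · have hx' : x = x₀ + s • (s⁻¹ • (x - x₀)) := by
        rw [smul_smul, mul_inv_cancel₀ hs.ne']; simp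
      rw [grad_eq_tensOf, hz.fderiv_eq_of_mem_interior
        (interior_maximal hS Metric.isOpen_ball hx)]
      simp only
      congr 1
      conv_lhs => rw [hx']
      simp only [tr, tensOf, map_add, map_smul, add_apply,
        smul_apply, PiLp.add_apply, PiLp.smul_apply, smul_eq_mul,
        Finset.mul_sum, Finset.sum_add_distrib]
      ring
    · have := bump_eq_zero (one_le_norm_of_notMem_ball hs hx)
      simp [this]
  rw [integral_congr_ae (Eventually.of_forall h2), integral_comp_scale (fun y => bump y *
      (tr (tensOf (A + B x₀)) + s * tr (tensOf (B y)))) x₀ hs] at h1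
  have h3 : ∫ y, bump y * (tr (tensOf (A + B x₀)) + s * tr (tensOf (B y))) =
      tr (tensOf (A + B x₀)) * bumpInt d := by
    simp_rw [mul_add]
    rw [integral_add (integrable_bump.mul_const _), integral_mul_const, ← bumpInt,
      integral_eq_zero_of_odd (f := fun y => bump y * (s * tr (tensOf (B y)))), add_zero, mul_comm]
    · intro y
      have : tr (tensOf (B (-y))) = - tr (tensOf (B y)) := by simp [tr, tensOf]
      rw [this, bump, norm_neg, ← bump]; ring
    · refine Continuous.integrable_of_hasCompactSupport
        (contDiff_bump.continuous.mul (continuous_const.mul hcont)) hasCompactSupport_bump.mul_right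
  rw [h3, abs_mul, abs_mul, abs_of_pos hI, abs_of_pos (by positivity)] at h1
  have h5 : 0 < s ^ d * bumpInt d := by positivity
  refine le_of_mul_le_mul_left ?_ h5
  linarith

variable {X : Set (Vec d)} (h : IsPatchControlled Ω z r s n X) (hs : 0 < s)
  (hz : IsQuadOn S z P A B) (hr : ∀ x ∈ S, r x = c + ⟪b, x⟫_ℝ) {x₀ : Vec d}
  (hS : Metric.closedBall x₀ (6 * s) ⊆ S) (hSX : S ⊆ X)

lemma ball_subset_of_abs_le (hs : 0 < s) (hS : Metric.closedBall x₀ (6 * s) ⊆ S) {u : Vec d}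
    (hu : ‖u‖ = 1) {p : ℝ} (hp : |p| ≤ 4 * s) : Metric.ball (x₀ + p • u) s ⊆ S := by
  refine (Metric.ball_subset_closedBall.trans (Metric.closedBall_subset_closedBall' ?_)).trans hS
  rw [dist_eq_norm, add_sub_cancel_left, norm_smul, hu, mul_one, Real.norm_eq_abs]
  linarith

include h hs hz hr hS hSX in
lemma norm_strongResidual_le_of_patch {u : Vec d} (hu : ‖u‖ = 1) :
    s * ‖strongResidual B b‖ ≤ n := by
  obtain ⟨p, q, hp, -, -, h1, -⟩ := h.exists_two hs (hS.trans hSX) hu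
  exact h1.norm_strongResidual_le hs hz hr (ball_subset_of_abs_le hs hS hu hp)

-- The divergence is affine along u and at most n at two points that are at least 4s apart, which
-- bounds its slope.
include h hs hz hS hSX in
lemma abs_tr_le_of_patch {u : Vec d} (hu : ‖u‖ = 1) : s * |tr (tensOf (B u))| ≤ n := by
  obtain ⟨p, q, hp, hq, hpq, h1, h2⟩ := h.exists_two hs (hS.trans hSX) hu
  have e1 := h1.abs_tr_le hs hz (ball_subset_of_abs_le hs hS hu hp)
  have e2 := h2.abs_tr_le hs hz (ball_subset_of_abs_le hs hS hu hq)
  have e3 : ∀ t : ℝ, tr (tensOf (A + B (x₀ + t • u))) =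
      tr (tensOf (A + B x₀)) + t * tr (tensOf (B u)) := by
    intro t
    simp only [tr, tensOf, map_add, map_smul, add_apply,
        smul_apply, PiLp.add_apply, PiLp.smul_apply, smul_eq_mul,
        Finset.mul_sum, Finset.sum_add_distrib]
    ring
  rw [e3] at e1 e2
  have e4 : |p - q| * |tr (tensOf (B u))| ≤ 2 * n := by
    rw [← abs_mul]
    calc |(p - q) * tr (tensOf (B u))| = |(tr (tensOf (A + B x₀)) + p * tr (tensOf (B u))) -
        (tr (tensOf (A + B x₀)) + q * tr (tensOf (B u)))| := by congr 1; ring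
      _ ≤ _ := (abs_sub _ _).trans (by linarith)
  have e5 := mul_le_mul_of_nonneg_right hpq (abs_nonneg (tr (tensOf (B u))))
  nlinarith [abs_nonneg (tr (tensOf (B u))), mul_nonneg hs.le (abs_nonneg (tr (tensOf (B u))))]

end element

/-! ### Consequences of continuity across a side. -/

section side

variable {S₁ S₂ : Set (Vec d)} {P₁ P₂ : Vec d → Vec d}
    {A₁ A₂ : Vec d →L[ℝ] Vec d} {B₁ B₂ : Vec d →L[ℝ] Vec d →L[ℝ] Vec d}
    {c₁ c₂ : ℝ} {b₁ b₂ : Vec d} {x₀ ν : Vec d} {ρ : ℝ}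

/-- Two sets that contain the two halves of a ball of radius `ρ`, with a field that is quadratic
and a function that is affine on each of them. -/
structure IsSidePair (z : Vec d → Vec d) (r : Vec d → ℝ) (S₁ S₂ : Set (Vec d))
    (P₁ P₂ : Vec d → Vec d) (A₁ A₂ : Vec d →L[ℝ] Vec d) (B₁ B₂ : Vec d →L[ℝ] Vec d →L[ℝ] Vec d)
    (c₁ c₂ : ℝ) (b₁ b₂ x₀ ν : Vec d) (ρ : ℝ) : Prop where
  quad₁ : IsQuadOn S₁ z P₁ A₁ B₁
  quad₂ : IsQuadOn S₂ z P₂ A₂ B₂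
  affine₁ : ∀ x ∈ S₁, r x = c₁ + ⟪b₁, x⟫_ℝ
  affine₂ : ∀ x ∈ S₂, r x = c₂ + ⟪b₂, x⟫_ℝ
  norm_eq : ‖ν‖ = 1
  mem₁ : ∀ x, ‖x - x₀‖ ≤ ρ → ⟪ν, x - x₀⟫_ℝ ≤ 0 → x ∈ S₁
  mem₂ : ∀ x, ‖x - x₀‖ ≤ ρ → 0 ≤ ⟪ν, x - x₀⟫_ℝ → x ∈ S₂

namespace IsSidePair

variable (H : IsSidePair z r S₁ S₂ P₁ P₂ A₁ A₂ B₁ B₂ c₁ c₂ b₁ b₂ x₀ ν ρ) (hρ : 0 < ρ)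

include H in
lemma mem_both {u : Vec d} (hu : ⟪ν, u⟫_ℝ = 0) (hu' : ‖u‖ ≤ ρ) : x₀ + u ∈ S₁ ∧ x₀ + u ∈ S₂ :=
  ⟨H.mem₁ _ (by simpa using hu') (by simp [hu]), H.mem₂ _ (by simpa using hu') (by simp [hu])⟩

-- P₂ - P₁ vanishes on a disc in the hyperplane. Along a tangential line its derivative is affine in
-- t and zero near t = 0, so both coefficients vanish.
include H hρ in
lemma tangential {u : Vec d} (hu : ⟪ν, u⟫_ℝ = 0) :
    (A₂ + B₂ x₀) u = (A₁ + B₁ x₀) u ∧ B₂ u u = B₁ u u := by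
  have hev : ∀ᶠ t : ℝ in 𝓝 0, ‖t • u‖ < ρ := by
    have : Tendsto (fun t : ℝ => ‖t • u‖) (𝓝 0) (𝓝 0) := by
      have : Continuous fun t : ℝ => ‖t • u‖ := by fun_prop
      simpa using this.tendsto 0
    exact this.eventually_lt_const hρ
  have hq : ∀ᶠ t : ℝ in 𝓝 0, P₂ (x₀ + t • u) - P₁ (x₀ + t • u) = 0 := by
    filter_upwards [hev] with t ht
    obtain ⟨h1, h2⟩ := H.mem_both (u := t • u) (by rw [inner_smul_right, hu, mul_zero]) ht.le
    rw [← H.quad₁.eqOn h1, ← H.quad₂.eqOn h2, sub_self]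
  have hder : ∀ t : ℝ, HasDerivAt (fun t : ℝ => P₂ (x₀ + t • u) - P₁ (x₀ + t • u))
      ((A₂ + B₂ (x₀ + t • u)) u - (A₁ + B₁ (x₀ + t • u)) u) t := by
    intro t
    have hl : HasDerivAt (fun t : ℝ => x₀ + t • u) u t := by
      simpa using ((hasDerivAt_id t).smul_const u).const_add x₀
    exact ((H.quad₂.hasFDerivAt _).comp_hasDerivAt t hl).sub
      ((H.quad₁.hasFDerivAt _).comp_hasDerivAt t hl)
  have hz : ∀ᶠ t : ℝ in 𝓝 0, ((A₂ + B₂ x₀) u - (A₁ + B₁ x₀) u) + t • (B₂ u u - B₁ u u) = 0 := by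
    filter_upwards [hq.eventually_nhds] with t ht
    have h1 := (hder t).unique ((hasDerivAt_const t (0 : Vec d)).congr_of_eventuallyEq ht)
    rw [← h1]
    simp [smul_sub]
    abel
  have h0 := hz.self_of_nhds
  rw [zero_smul, add_zero] at h0
  refine ⟨sub_eq_zero.1 h0, ?_⟩
  obtain ⟨ε, hε, hball⟩ := Metric.eventually_nhds_iff.1 hz
  have h1 := hball (y := ε / 2) (by rw [Real.dist_eq, sub_zero, abs_of_pos (by positivity)]; linarith)
  rw [h0, zero_add, smul_eq_zero] at h1
  exact sub_eq_zero.1 (h1.resolve_left (by positivity))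

-- Polarization of the diagonal identity, by the symmetry of second derivatives.
include H hρ in
lemma tangential₂ {u v : Vec d} (hu : ⟪ν, u⟫_ℝ = 0) (hv : ⟪ν, v⟫_ℝ = 0) : B₂ u v = B₁ u v := by
  have h1 := (H.tangential hρ hu).2
  have h2 := (H.tangential hρ hv).2
  have h3 := (H.tangential hρ (u := u + v) (by rw [inner_add_right, hu, hv, add_zero])).2
  simp only [map_add, add_apply] at h3
  rw [H.quad₂.symm v u, H.quad₁.symm v u, h1, h2] at h3
  have h4 : (2 : ℝ) • B₂ u v = (2 : ℝ) • B₁ u v := by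
    rw [two_smul, two_smul]
    have := congrArg (fun w => w - B₁ u u - B₁ v v) h3
    convert this using 1 <;> abel
  exact smul_right_injective _ (two_ne_zero' ℝ) h4

include H hρ in
lemma pressure_eq : c₁ + ⟪b₁, x₀⟫_ℝ = c₂ + ⟪b₂, x₀⟫_ℝ := by
  obtain ⟨h1, h2⟩ := H.mem_both (u := 0) (by simp) (by simpa using hρ.le)
  rw [add_zero] at h1 h2
  rw [← H.affine₁ _ h1, ← H.affine₂ _ h2]

include H hρ in
lemma pressure_tangential {u : Vec d} (hu : ⟪ν, u⟫_ℝ = 0) : ⟪b₂ - b₁, u⟫_ℝ = 0 := by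
  rcases eq_or_ne u 0 with rfl | h0
  · simp
  have hn : 0 < ‖u‖ := norm_pos_iff.2 h0
  obtain ⟨h1, h2⟩ := H.mem_both (u := (ρ / ‖u‖) • u) (by rw [inner_smul_right, hu, mul_zero])
    (by rw [norm_smul, Real.norm_of_nonneg (by positivity), div_mul_cancel₀ _ hn.ne'])
  have h3 := H.affine₁ _ h1
  rw [H.affine₂ _ h2, inner_add_right, inner_add_right, inner_smul_right, inner_smul_right] at h3
  have h4 := H.pressure_eq hρ
  have h5 : ρ / ‖u‖ * (⟪b₂, u⟫_ℝ - ⟪b₁, u⟫_ℝ) = 0 := by linarith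
  rw [inner_sub_left]
  exact (mul_eq_zero.1 h5).resolve_left (by positivity)

end IsSidePair

end side

end

section

/-! ### The jump across a side -/

variable {Ω : Set (Vec d)} {z : Vec d → Vec d} {r : Vec d → ℝ} {s n : ℝ} {S₁ S₂ X : Set (Vec d)}
  {P₁ P₂ : Vec d → Vec d} {A₁ A₂ : Vec d →L[ℝ] Vec d} {B₁ B₂ : Vec d →L[ℝ] Vec d →L[ℝ] Vec d}
  {c₁ c₂ : ℝ} {b₁ b₂ : Vec d} {x₀ ν : Vec d}

lemma exists_unit_tangent (hd : 2 ≤ d) (ν : Vec d) : ∃ τ : Vec d, ‖τ‖ = 1 ∧ ⟪ν, τ⟫_ℝ = 0 := by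
  have h1 : (ℝ ∙ ν)ᗮ ≠ ⊥ := by
    intro h
    have h2 := Submodule.finrank_add_finrank_orthogonal (ℝ ∙ ν)
    rw [h, finrank_bot, finrank_euclideanSpace_fin, add_zero] at h2
    have h3 : Module.finrank ℝ (ℝ ∙ ν) ≤ 1 := (finrank_span_le_card {ν}).trans (by simp)
    omega
  obtain ⟨v, hv, hv0⟩ := Submodule.exists_mem_ne_zero_of_ne_bot h1
  have hn : ‖v‖ ≠ 0 := norm_ne_zero_iff.2 hv0
  refine ⟨‖v‖⁻¹ • v, by rw [norm_smul, norm_inv, norm_norm, inv_mul_cancel₀ hn], ?_⟩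
  rw [inner_smul_right, Submodule.mem_orthogonal_singleton_iff_inner_right.1 hv, mul_zero]

lemma inner_tangential (hν : ‖ν‖ = 1) (u : Vec d) : ⟪ν, u - ⟪ν, u⟫_ℝ • ν⟫_ℝ = 0 := by
  rw [inner_sub_right, inner_smul_right, real_inner_self_eq_norm_sq, hν]; ring

lemma norm_tangential_le (hν : ‖ν‖ = 1) (u : Vec d) : ‖u - ⟪ν, u⟫_ℝ • ν‖ ≤ ‖u‖ := by
  have h1 : ‖u - ⟪ν, u⟫_ℝ • ν‖ ^ 2 = ‖u‖ ^ 2 - ⟪ν, u⟫_ℝ ^ 2 := by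
    rw [norm_sub_sq_real, inner_smul_right, norm_smul, hν, real_inner_comm, Real.norm_eq_abs,
      mul_one, sq_abs]
    ring
  refine le_of_sq_le_sq ?_ (norm_nonneg _)
  rw [h1]; nlinarith [sq_nonneg ⟪ν, u⟫_ℝ]

lemma abs_inner_le_norm_of_unit (hν : ‖ν‖ = 1) (u : Vec d) : |⟪ν, u⟫_ℝ| ≤ ‖u‖ := by
  simpa [hν] using abs_real_inner_le_norm ν u

namespace IsSidePair

/-- The normal jump of the gradient at a controlled point of the side. -/
lemma norm_jump_le (H : IsSidePair z r S₁ S₂ P₁ P₂ A₁ A₂ B₁ B₂ c₁ c₂ b₁ b₂ x₀ ν (6 * s))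
    (hs : 0 < s) {τ : Vec d} (hτ : ⟪ν, τ⟫_ℝ = 0) (hτ' : ‖τ‖ ≤ 4 * s)
    (hc : IsControlled Ω z r s n (x₀ + τ)) (hR₁ : s * ‖strongResidual B₁ b₁‖ ≤ n)
    (hR₂ : s * ‖strongResidual B₂ b₂‖ ≤ n) :
    ‖((A₂ + B₂ x₀) ν - (A₁ + B₁ x₀) ν) + (B₂ τ ν - B₁ τ ν)‖ ≤ 4 * n := by
  set J := ((A₂ + B₂ x₀) ν - (A₁ + B₁ x₀) ν) + (B₂ τ ν - B₁ τ ν) with hJ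
  have hρ : 0 < 6 * s := by linarith
  have hin : ∀ x, ⟪ν, x - (x₀ + τ)⟫_ℝ = ⟪ν, x - x₀⟫_ℝ := by
    intro x
    rw [← sub_sub, inner_sub_right, hτ, sub_zero]
  have hball : ∀ x ∈ Metric.ball (x₀ + τ) s, ‖x - x₀‖ ≤ 6 * s := by
    intro x hx
    rw [mem_ball_iff_norm] at hx
    calc ‖x - x₀‖ = ‖(x - (x₀ + τ)) + τ‖ := by congr 1; abel
      _ ≤ _ := (norm_add_le _ _).trans (by linarith)
  have hp : c₁ + ⟪b₁, x₀ + τ⟫_ℝ = c₂ + ⟪b₂, x₀ + τ⟫_ℝ := by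
    have h1 := H.pressure_eq hρ
    have h2 := H.pressure_tangential hρ hτ
    rw [inner_sub_left] at h2
    rw [inner_add_right, inner_add_right]
    linarith
  -- Tangential derivatives agree on both sides, so the difference of the gradients at x₀ + τ is the
  -- rank one map u ↦ ⟪ν, u⟫ J.
  have hJ' : ∀ u, (A₂ + B₂ (x₀ + τ)) u - (A₁ + B₁ (x₀ + τ)) u = ⟪ν, u⟫_ℝ • J := by
    intro u
    have hu := inner_tangential H.norm_eq u
    have e1 := (H.tangential hρ hu).1
    have e2 := H.tangential₂ hρ hτ hu
    simp only [map_add, map_sub, map_smul, add_apply] at e1 e2 ⊢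
    rw [hJ]
    simp only [add_apply]
    have e3 : A₂ u + B₂ x₀ u - (A₁ u + B₁ x₀ u) =
        ⟪ν, u⟫_ℝ • (A₂ ν + B₂ x₀ ν - (A₁ ν + B₁ x₀ ν)) := by
      linear_combination (norm := module) e1
    have e4 : B₂ τ u - B₁ τ u = ⟪ν, u⟫_ℝ • (B₂ τ ν - B₁ τ ν) := by
      linear_combination (norm := module) e2
    linear_combination (norm := module) e3 + e4
  -- Tested with J itself and divided by `bumpInt d`, the side formula gives ‖J‖²/2 ≤ n‖J‖ + ‖J‖(n +
  -- n)/2, because the first absolute moment of the kernel is at least `bumpInt d`. Hence the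
  -- constant 4.
  have h1 := hc.residual_le J
  rw [weakResidual_side H.quad₁ H.quad₂ H.affine₁ H.affine₂ hs J H.norm_eq
    (fun x hx h => H.mem₁ x (hball x hx) (by rw [← hin]; exact h.le))
    (fun x hx h => H.mem₂ x (hball x hx) (by rw [← hin]; exact h.le)) hp hJ' hc.ball_subset,
    abs_mul, abs_neg, abs_of_pos (by positivity), real_inner_self_eq_norm_sq] at h1
  have h2 := le_of_mul_le_mul_left h1 (by positivity)
  have hI : 0 < bumpInt d := bumpInt_pos
  have h3 := bumpInt_le_integral_abs H.norm_eq
  set K := ∫ y : Vec d, bumpKer y * |⟪ν, y⟫_ℝ|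
  have h4 := (le_abs_self _).trans h2
  have e1 : -(‖J‖ * ‖strongResidual B₁ b₁‖) ≤ ⟪J, strongResidual B₁ b₁⟫_ℝ :=
    neg_le_of_abs_le (abs_real_inner_le_norm _ _)
  have e2 : -(‖J‖ * ‖strongResidual B₂ b₂‖) ≤ ⟪J, strongResidual B₂ b₂⟫_ℝ :=
    neg_le_of_abs_le (abs_real_inner_le_norm _ _)
  have hJ0 := norm_nonneg J
  have e3 : ‖J‖ ^ 2 / 2 * bumpInt d ≤ ‖J‖ ^ 2 / 2 * K :=
    mul_le_mul_of_nonneg_left h3 (by positivity)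
  have e4 : s / 2 * bumpInt d * (-(‖J‖ * ‖strongResidual B₁ b₁‖) +
      -(‖J‖ * ‖strongResidual B₂ b₂‖)) ≤ s / 2 * bumpInt d * (⟪J, strongResidual B₁ b₁⟫_ℝ +
      ⟪J, strongResidual B₂ b₂⟫_ℝ) := mul_le_mul_of_nonneg_left (add_le_add e1 e2) (by positivity)
  have e5 : bumpInt d / 2 * ‖J‖ * (s * ‖strongResidual B₁ b₁‖ + s * ‖strongResidual B₂ b₂‖) ≤
      bumpInt d / 2 * ‖J‖ * (n + n) := mul_le_mul_of_nonneg_left (add_le_add hR₁ hR₂) (by positivity)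
  have e6 : bumpInt d / 2 * (‖J‖ * ‖J‖) ≤ bumpInt d / 2 * (4 * n * ‖J‖) := by nlinarith
  have e7 := le_of_mul_le_mul_left e6 (by positivity)
  rcases hJ0.eq_or_lt with h0 | h0
  · rw [← h0]
    have := (by positivity : 0 ≤ s * ‖strongResidual B₁ b₁‖).trans hR₁
    linarith
  · exact le_of_mul_le_mul_right e7 h0

section

variable (H : IsSidePair z r S₁ S₂ P₁ P₂ A₁ A₂ B₁ B₂ c₁ c₂ b₁ b₂ x₀ ν (6 * s))
  (hs : 0 < s) (hX : IsPatchControlled Ω z r s n X) (hS₁ : S₁ ⊆ X) (hS₂ : S₂ ⊆ X)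
  (hR₁ : s * ‖strongResidual B₁ b₁‖ ≤ n) (hR₂ : s * ‖strongResidual B₂ b₂‖ ≤ n)

include H hs hX hS₁ hS₂ hR₁ hR₂

/-- The normal jump at x₀ + tτ is affine in t. Two values bounded by 4n at parameters at least 4s
apart give the slope, and then the value at t = 0. -/
lemma exists_jump_le {τ : Vec d} (hτ : ⟪ν, τ⟫_ℝ = 0) (hτ' : ‖τ‖ = 1) :
    s * ‖B₂ τ ν - B₁ τ ν‖ ≤ 2 * n ∧ ‖(A₂ + B₂ x₀) ν - (A₁ + B₁ x₀) ν‖ ≤ 12 * n := by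
  have hcb : Metric.closedBall x₀ (6 * s) ⊆ X := by
    intro x hx
    rw [mem_closedBall_iff_norm] at hx
    rcases le_total ⟪ν, x - x₀⟫_ℝ 0 with h | h
    · exact hS₁ (H.mem₁ x hx h)
    · exact hS₂ (H.mem₂ x hx h)
  obtain ⟨p, q, hp, hq, hpq, h1, h2⟩ := hX.exists_two hs hcb hτ'
  have key : ∀ t : ℝ, |t| ≤ 4 * s → IsControlled Ω z r s n (x₀ + t • τ) →
      ‖((A₂ + B₂ x₀) ν - (A₁ + B₁ x₀) ν) + t • (B₂ τ ν - B₁ τ ν)‖ ≤ 4 * n := by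
    intro t ht hc
    have := H.norm_jump_le hs (τ := t • τ) (by rw [inner_smul_right, hτ, mul_zero])
      (by rw [norm_smul, hτ', mul_one]; exact ht) hc hR₁ hR₂
    simpa only [map_smul, smul_apply, smul_sub] using this
  have k1 := key p hp h1
  have k2 := key q hq h2
  set L := (A₂ + B₂ x₀) ν - (A₁ + B₁ x₀) ν
  set w := B₂ τ ν - B₁ τ ν
  have hw : s * ‖w‖ ≤ 2 * n := by
    have e1 : |p - q| * ‖w‖ ≤ 8 * n := by
      rw [← Real.norm_eq_abs, ← norm_smul]
      calc ‖(p - q) • w‖ = ‖(L + p • w) - (L + q • w)‖ := by congr 1; module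
        _ ≤ _ := (norm_sub_le _ _).trans (by linarith)
    have e2 := mul_le_mul_of_nonneg_right hpq (norm_nonneg w)
    linarith
  refine ⟨hw, ?_⟩
  calc ‖L‖ = ‖(L + p • w) - p • w‖ := by congr 1; abel
    _ ≤ ‖L + p • w‖ + |p| * ‖w‖ := by
        refine (norm_sub_le _ _).trans (le_of_eq ?_)
        rw [norm_smul, Real.norm_eq_abs]
    _ ≤ 4 * n + 4 * s * ‖w‖ := add_le_add k1 (mul_le_mul_of_nonneg_right hp (norm_nonneg _))
    _ ≤ 12 * n := by linarith

lemma tangent_normal_le {u : Vec d} (hu : ⟪ν, u⟫_ℝ = 0) :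
    s * ‖B₂ u ν - B₁ u ν‖ ≤ 2 * n * ‖u‖ := by
  rcases eq_or_ne u 0 with rfl | h0
  · simp
  have hn : 0 < ‖u‖ := norm_pos_iff.2 h0
  have h1 := (H.exists_jump_le hs hX hS₁ hS₂ hR₁ hR₂ (τ := ‖u‖⁻¹ • u)
    (by rw [inner_smul_right, hu, mul_zero])
    (by rw [norm_smul, norm_inv, norm_norm, inv_mul_cancel₀ hn.ne'])).1
  simp only [map_smul, smul_apply, ← smul_sub] at h1
  rw [norm_smul, norm_inv, norm_norm] at h1
  calc s * ‖B₂ u ν - B₁ u ν‖ = s * (‖u‖⁻¹ * ‖B₂ u ν - B₁ u ν‖) * ‖u‖ := by field_simp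
    _ ≤ _ := mul_le_mul_of_nonneg_right h1 hn.le

-- The jump of the second derivatives is zero on pairs of tangential vectors, so only the
-- normal-normal entry is left in its trace.
omit hs hX hS₁ hS₂ hR₁ hR₂ in
lemma sum_second_derivative (hs : 0 < s) :
    ∑ i, (B₂ - B₁) (basisVec i) (basisVec i) = (B₂ - B₁) ν ν := by
  set β := B₂ - B₁ with hβ
  have hsymm : ∀ x u, β x u = β u x := fun x u => by
    simp [hβ, H.quad₁.symm x u, H.quad₂.symm x u]
  have h1 : ∀ i, β (basisVec i) (basisVec i) = ν i • β ν (basisVec i) +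
      ν i • β ν (basisVec i) - (ν i * ν i) • β ν ν := by
    intro i
    have e1 := inner_tangential H.norm_eq (basisVec i)
    rw [inner_basisVec] at e1
    have e2 := H.tangential₂ (by linarith) e1 e1
    have e3 : β (basisVec i - ν i • ν) (basisVec i - ν i • ν) = 0 := by
      rw [hβ, sub_apply, sub_apply, e2, sub_self]
    simp only [map_sub, map_smul, sub_apply, smul_apply, smul_sub] at e3
    rw [hsymm (basisVec i) ν] at e3
    linear_combination (norm := module) e3
  have h2 : ∑ i, ν i • β ν (basisVec i) = β ν ν := by
    calc _ = β ν (∑ i, ν i • basisVec i) := by simp only [map_sum, map_smul]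
      _ = _ := by rw [sum_smul_basisVec]
  have h3 : ∑ i, ν i * ν i = 1 := by
    have := EuclideanSpace.real_norm_sq_eq ν
    rw [H.norm_eq] at this
    simp only [← pow_two]
    linarith
  simp_rw [h1]
  rw [Finset.sum_sub_distrib, Finset.sum_add_distrib, h2, ← Finset.sum_smul, h3, one_smul]
  abel

/-- The jump w of the second normal derivative is not a slope of the normal jump along the side. Its
normal component is the jump in the normal derivative of the divergence, up to mixed terms already
bounded. Since b₂ - b₁ is normal, the tangential component of w is that of the difference of the
strong residuals, w + (b₂ - b₁); the pressure part is what remains of this difference. -/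
lemma second_normal_le (hD₁ : s * |tr (tensOf (B₁ ν))| ≤ n) (hD₂ : s * |tr (tensOf (B₂ ν))| ≤ n) :
    s * ‖(B₂ - B₁) ν ν‖ ≤ (2 * d + 4) * n ∧ s * |⟪ν, b₂ - b₁⟫_ℝ| ≤ (2 * d + 4) * n := by
  set β := B₂ - B₁ with hβ
  have hn : 0 ≤ n := (by positivity : 0 ≤ s * |tr (tensOf (B₁ ν))|).trans hD₁
  have hsymm : ∀ x u, β x u = β u x := fun x u => by
    simp [hβ, H.quad₁.symm x u, H.quad₂.symm x u]
  set w := β ν ν with hw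
  have h1 : s * |⟪ν, w⟫_ℝ| ≤ (2 * d + 2) * n := by
    have e1 : ⟪ν, w⟫_ℝ = (tr (tensOf (B₂ ν)) - tr (tensOf (B₁ ν))) -
        ∑ i, (β ν (basisVec i - ν i • ν)) i := by
      have : ∑ i, (β ν (basisVec i - ν i • ν)) i =
          (tr (tensOf (B₂ ν)) - tr (tensOf (B₁ ν))) - ∑ i, ν i * w i := by
        simp only [tr, tensOf, ← Finset.sum_sub_distrib]
        refine Finset.sum_congr rfl fun i _ => ?_
        simp [hβ, hw]
        ring
      rw [this, PiLp.inner_apply]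
      simp [mul_comm]
    have e2 : s * |∑ i, (β ν (basisVec i - ν i • ν)) i| ≤ d * (2 * n) := by
      calc s * |∑ i, (β ν (basisVec i - ν i • ν)) i|
          ≤ s * ∑ i, |(β ν (basisVec i - ν i • ν)) i| :=
            mul_le_mul_of_nonneg_left (Finset.abs_sum_le_sum_abs _ _) hs.le
        _ = ∑ i, s * |(β ν (basisVec i - ν i • ν)) i| := Finset.mul_sum _ _ _
        _ ≤ ∑ _i : Fin d, 2 * n := by
            refine Finset.sum_le_sum fun i _ => ?_
            have e3 := inner_tangential H.norm_eq (basisVec i)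
            have e5 := norm_tangential_le H.norm_eq (basisVec i)
            rw [inner_basisVec] at e3 e5
            rw [norm_basisVec] at e5
            have e4 := H.tangent_normal_le hs hX hS₁ hS₂ hR₁ hR₂ e3
            have e6 : |(β ν (basisVec i - ν i • ν)) i| ≤ ‖β ν (basisVec i - ν i • ν)‖ :=
              PiLp.norm_apply_le (β ν (basisVec i - ν i • ν)) i
            rw [hsymm] at e6 ⊢
            calc _ ≤ s * ‖β (basisVec i - ν i • ν) ν‖ := mul_le_mul_of_nonneg_left e6 hs.le
              _ ≤ 2 * n * ‖basisVec i - ν i • ν‖ := by simpa only [hβ, sub_apply] using e4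
              _ ≤ 2 * n * 1 := by gcongr
              _ = _ := mul_one _
        _ = d * (2 * n) := by simp
    rw [e1]
    calc s * |_ - _| ≤ s * ((|tr (tensOf (B₂ ν))| + |tr (tensOf (B₁ ν))|) +
          |∑ i, (β ν (basisVec i - ν i • ν)) i|) := by
          gcongr
          exact (abs_sub _ _).trans (add_le_add_left (abs_sub _ _) _)
      _ ≤ _ := by linarith
  have hR : strongResidual B₂ b₂ - strongResidual B₁ b₁ = w + (b₂ - b₁) := by
    have := H.sum_second_derivative hs
    rw [hw, hβ, ← this]
    simp only [strongResidual, sub_apply, Finset.sum_sub_distrib]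
    abel
  have hRn : s * ‖w + (b₂ - b₁)‖ ≤ 2 * n := by
    rw [← hR]
    calc _ ≤ s * (‖strongResidual B₂ b₂‖ + ‖strongResidual B₁ b₁‖) := by
          gcongr; exact norm_sub_le _ _
      _ ≤ _ := by linarith
  have h2 : s * ‖w - ⟪ν, w⟫_ℝ • ν‖ ≤ 2 * n := by
    set v := w - ⟪ν, w⟫_ℝ • ν with hv
    have e1 : ⟪ν, v⟫_ℝ = 0 := inner_tangential H.norm_eq w
    have e2 := H.pressure_tangential (by linarith) e1
    have e3 : ⟪v, w + (b₂ - b₁)⟫_ℝ = ‖v‖ * ‖v‖ := by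
      rw [inner_add_right, real_inner_comm (b₂ - b₁) v, e2, add_zero,
        ← real_inner_self_eq_norm_mul_norm]
      conv_rhs => rw [hv, inner_sub_right, inner_smul_right, ← hv, real_inner_comm ν v, e1]
      simp
    have e4 := real_inner_le_norm v (w + (b₂ - b₁))
    rw [e3] at e4
    rcases (norm_nonneg v).eq_or_lt with h0 | h0
    · rw [← h0, mul_zero]; linarith
    · exact (mul_le_mul_of_nonneg_left (le_of_mul_le_mul_left e4 h0) hs.le).trans hRn
  constructor
  · calc s * ‖w‖ = s * ‖(w - ⟪ν, w⟫_ℝ • ν) + ⟪ν, w⟫_ℝ • ν‖ := by congr 2; abel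
      _ ≤ s * (‖w - ⟪ν, w⟫_ℝ • ν‖ + |⟪ν, w⟫_ℝ|) := by
          gcongr
          refine (norm_add_le _ _).trans ?_
          rw [norm_smul, H.norm_eq, mul_one, Real.norm_eq_abs]
      _ ≤ _ := by linarith
  · have e1 : ⟪ν, b₂ - b₁⟫_ℝ = ⟪ν, w + (b₂ - b₁)⟫_ℝ - ⟪ν, w⟫_ℝ := by
      rw [inner_add_right]; ring
    rw [e1]
    have e2 := abs_inner_le_norm_of_unit H.norm_eq (w + (b₂ - b₁))
    calc _ ≤ s * (‖w + (b₂ - b₁)‖ + |⟪ν, w⟫_ℝ|) := by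
          gcongr
          exact (abs_sub _ _).trans (add_le_add_left e2 _)
      _ ≤ _ := by linarith

/-- The quadratic fields and the affine functions on the two sides are close to each other. -/
lemma jump_le (hd : 2 ≤ d) (hD₁ : s * |tr (tensOf (B₁ ν))| ≤ n)
    (hD₂ : s * |tr (tensOf (B₂ ν))| ≤ n) {Λ : ℝ} {x : Vec d} (hx : ‖x - x₀‖ ≤ Λ * s) :
    (∀ u, ‖(A₂ + B₂ x) u - (A₁ + B₁ x) u‖ ≤ (12 + (2 * d + 8) * Λ) * n * ‖u‖) ∧
      |(c₂ + ⟪b₂, x⟫_ℝ) - (c₁ + ⟪b₁, x⟫_ℝ)| ≤ (12 + (2 * d + 8) * Λ) * n := by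
  have hρ : 0 < 6 * s := by linarith
  have hn : 0 ≤ n := (by positivity : 0 ≤ s * |tr (tensOf (B₁ ν))|).trans hD₁
  have hΛ : 0 ≤ Λ := by
    have := (norm_nonneg _).trans hx
    by_contra h
    nlinarith
  obtain ⟨h1, h2⟩ := H.second_normal_le hs hX hS₁ hS₂ hR₁ hR₂ hD₁ hD₂
  obtain ⟨τ, hτ, hντ⟩ := exists_unit_tangent hd ν
  have h3 := (H.exists_jump_le hs hX hS₁ hS₂ hR₁ hR₂ hντ hτ).2
  set β := B₂ - B₁ with hβ
  have hsymm : ∀ x u, β x u = β u x := fun x u => by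
    simp [hβ, H.quad₁.symm x u, H.quad₂.symm x u]
  set y := x - x₀ with hy
  have hxy : x = x₀ + y := by rw [hy]; abel
  have hyt := inner_tangential H.norm_eq y
  have hyn := norm_tangential_le H.norm_eq y
  have hyν := abs_inner_le_norm_of_unit H.norm_eq y
  constructor
  · intro u
    have hut := inner_tangential H.norm_eq u
    have hun := norm_tangential_le H.norm_eq u
    have huν := abs_inner_le_norm_of_unit H.norm_eq u
    -- Both u and x - x₀ are split into normal and tangential parts. The purely tangential
    -- contribution vanishes, and the others carry the constants 12, 2, 2 and 2d + 4, whence 12 +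
    -- (2d + 8)Λ.
    have e1 : (A₂ + B₂ x) u - (A₁ + B₁ x) u =
        ⟪ν, u⟫_ℝ • ((A₂ + B₂ x₀) ν - (A₁ + B₁ x₀) ν) +
        (⟪ν, u⟫_ℝ • β (y - ⟪ν, y⟫_ℝ • ν) ν + ⟪ν, y⟫_ℝ • β (u - ⟪ν, u⟫_ℝ • ν) ν +
          (⟪ν, y⟫_ℝ * ⟪ν, u⟫_ℝ) • β ν ν) := by
      have f1 := (H.tangential hρ hut).1
      have f2 := H.tangential₂ hρ hyt hut
      have f3 := hsymm u ν
      simp only [map_sub, map_add, map_smul, add_apply, sub_apply, smul_apply, hβ, hxy] at f1 f2 f3 ⊢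
      linear_combination (norm := module) f1 + f2 - ⟪ν, y⟫_ℝ • f3
    have g1 := H.tangent_normal_le hs hX hS₁ hS₂ hR₁ hR₂ hyt
    have g2 := H.tangent_normal_le hs hX hS₁ hS₂ hR₁ hR₂ hut
    simp only [← sub_apply] at g1 g2
    rw [← hβ] at g1 g2
    have k1 : ‖⟪ν, u⟫_ℝ • ((A₂ + B₂ x₀) ν - (A₁ + B₁ x₀) ν)‖ ≤ ‖u‖ * (12 * n) := by
      rw [norm_smul, Real.norm_eq_abs]; gcongr
    have k2 : s * ‖⟪ν, u⟫_ℝ • β (y - ⟪ν, y⟫_ℝ • ν) ν‖ ≤ ‖u‖ * (2 * n * ‖y‖) := by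
      rw [norm_smul, Real.norm_eq_abs, mul_left_comm]
      exact mul_le_mul huν (g1.trans (by gcongr)) (by positivity) (norm_nonneg _)
    have k3 : s * ‖⟪ν, y⟫_ℝ • β (u - ⟪ν, u⟫_ℝ • ν) ν‖ ≤ ‖y‖ * (2 * n * ‖u‖) := by
      rw [norm_smul, Real.norm_eq_abs, mul_left_comm]
      exact mul_le_mul hyν (g2.trans (by gcongr)) (by positivity) (norm_nonneg _)
    have k4 : s * ‖(⟪ν, y⟫_ℝ * ⟪ν, u⟫_ℝ) • β ν ν‖ ≤ (‖y‖ * ‖u‖) * ((2 * d + 4) * n) := by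
      rw [norm_smul, Real.norm_eq_abs, mul_left_comm, abs_mul]
      gcongr
    have k5 : s * ‖(A₂ + B₂ x) u - (A₁ + B₁ x) u‖ ≤
        s * ((12 + (2 * d + 8) * Λ) * n * ‖u‖) := by
      rw [e1]
      calc _ ≤ s * (‖⟪ν, u⟫_ℝ • ((A₂ + B₂ x₀) ν - (A₁ + B₁ x₀) ν)‖ +
            (‖⟪ν, u⟫_ℝ • β (y - ⟪ν, y⟫_ℝ • ν) ν‖ + ‖⟪ν, y⟫_ℝ • β (u - ⟪ν, u⟫_ℝ • ν) ν‖ +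
              ‖(⟪ν, y⟫_ℝ * ⟪ν, u⟫_ℝ) • β ν ν‖)) := by
            gcongr
            exact (norm_add_le _ _).trans (add_le_add_right ((norm_add_le _ _).trans
              (add_le_add_left (norm_add_le _ _) _)) _)
        _ ≤ s * (‖u‖ * (12 * n)) + ‖y‖ * ((2 * d + 8) * n * ‖u‖) := by
            have := mul_le_mul_of_nonneg_left k1 hs.le
            linarith
        _ ≤ s * (‖u‖ * (12 * n)) + Λ * s * ((2 * d + 8) * n * ‖u‖) := by gcongr
        _ = _ := by ring
    exact le_of_mul_le_mul_left k5 hs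
  · have e1 : (c₂ + ⟪b₂, x⟫_ℝ) - (c₁ + ⟪b₁, x⟫_ℝ) = ⟪ν, y⟫_ℝ * ⟪ν, b₂ - b₁⟫_ℝ := by
      have f1 := H.pressure_eq hρ
      have f2 := H.pressure_tangential hρ hyt
      rw [inner_sub_right, inner_smul_right, inner_sub_left, inner_sub_left,
        real_inner_comm ν b₂, real_inner_comm ν b₁] at f2
      have f3 : ⟪b₂, x⟫_ℝ = ⟪b₂, x₀⟫_ℝ + ⟪b₂, y⟫_ℝ := by rw [← inner_add_right, ← hxy]
      have f4 : ⟪b₁, x⟫_ℝ = ⟪b₁, x₀⟫_ℝ + ⟪b₁, y⟫_ℝ := by rw [← inner_add_right, ← hxy]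
      have f5 := inner_sub_right (𝕜 := ℝ) ν b₂ b₁
      rw [f3, f4, f5]
      linarith
    rw [e1, abs_mul]
    have k5 : s * (|⟪ν, y⟫_ℝ| * |⟪ν, b₂ - b₁⟫_ℝ|) ≤ s * ((12 + (2 * d + 8) * Λ) * n) := by
      calc _ = |⟪ν, y⟫_ℝ| * (s * |⟪ν, b₂ - b₁⟫_ℝ|) := by ring
        _ ≤ (Λ * s) * ((2 * d + 4) * n) := by gcongr; exact hyν.trans hx
        _ ≤ (Λ * s) * ((2 * d + 8) * n) + s * (12 * n) := by
            have : 0 ≤ Λ * s * n := by positivity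
            nlinarith [mul_nonneg hs.le hn]
        _ = _ := by ring
    exact le_of_mul_le_mul_left k5 hs

end

end IsSidePair

end

section

/-! ### Controlled balls in a patch -/

variable {Ω : Set (Vec d)} {D : Finset (Vec d)} {α : ℝ}

/-- A Lipschitz domain has no slits: a point slightly below the boundary graph has a neighbourhood
free of Ω and so is not in its closure. This matters because the mesh covers the closure, whereas
bumps must be supported in Ω. -/
lemma IsLipschitzDomain.interior_closure (hΩ : IsLipschitzDomain Ω) :
    interior (closure Ω) = Ω := by
  refine Set.Subset.antisymm (fun x hx => ?_) (interior_maximal subset_closure hΩ.isOpen)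
  by_contra hxΩ
  have hxf : x ∈ frontier Ω := by
    rw [hΩ.isOpen.frontier_eq]; exact ⟨interior_subset hx, hxΩ⟩
  obtain ⟨e, K, g, r, he, hg, hr, h⟩ := hΩ.lipschitz_boundary x hxf
  obtain ⟨ε, hε, hball⟩ := Metric.mem_nhds_iff.1 (mem_interior_iff_mem_nhds.1 hx)
  set δ := min ε r / 2 with hδ
  have hδ0 : 0 < δ := by positivity
  set y := x - δ • e with hy
  have hdist : dist y x = δ := by
    rw [dist_eq_norm, hy, sub_sub_cancel_left, norm_neg, norm_smul, he, mul_one,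
      Real.norm_of_nonneg hδ0.le]
  have hmin : 0 < min ε r := lt_min hε hr
  have hyε : y ∈ Metric.ball x ε := by
    rw [Metric.mem_ball, hdist]; have := min_le_left ε r; linarith
  have hyr : y ∈ Metric.ball x r := by
    rw [Metric.mem_ball, hdist]; have := min_le_right ε r; linarith
  have hxg : ⟪e, x⟫_ℝ ≤ g (x - ⟪e, x⟫_ℝ • e) :=
    not_lt.1 fun hlt => hxΩ ((h x (Metric.mem_ball_self hr)).2 hlt)
  have hye : ⟪e, y⟫_ℝ = ⟪e, x⟫_ℝ - δ := by
    rw [hy, inner_sub_right, inner_smul_right, real_inner_self_eq_norm_sq, he]; ring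
  have hyp : y - ⟪e, y⟫_ℝ • e = x - ⟪e, x⟫_ℝ • e := by
    rw [hye, hy]; module
  have hopen : IsOpen (Metric.ball x r ∩ {y | ⟪e, y⟫_ℝ < g (y - ⟪e, y⟫_ℝ • e)}) := by
    have hgc := hg.continuous
    exact Metric.isOpen_ball.inter (isOpen_lt (by fun_prop) (by fun_prop))
  have hyW : y ∈ Metric.ball x r ∩ {y | ⟪e, y⟫_ℝ < g (y - ⟪e, y⟫_ℝ • e)} := by
    refine ⟨hyr, ?_⟩
    change ⟪e, y⟫_ℝ < g (y - ⟪e, y⟫_ℝ • e)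
    rw [hyp, hye]; linarith
  obtain ⟨w, hw, hwΩ⟩ := mem_closure_iff.1 (hball hyε) _ hopen hyW
  exact lt_asymm hw.2 ((h w hw.1).1 hwΩ)

lemma IsLipschitzDomain.closedBall_subset (hΩ : IsLipschitzDomain Ω) {x : Vec d} {s : ℝ}
    (hs : 0 < s) (h : Metric.closedBall x (2 * s) ⊆ closure Ω) : Metric.closedBall x s ⊆ Ω := by
  rw [← hΩ.interior_closure]
  refine (Metric.closedBall_subset_ball (by linarith : s < 2 * s)).trans
    (interior_maximal (Metric.ball_subset_closedBall.trans h) Metric.isOpen_ball)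

/-- The union of the elements that can be reached from `T` through sides of elements that
touch `T`. -/
def Mesh.patch (M : Mesh Ω) (T : Finset (Vec d)) : Set (Vec d) :=
  {x | ∃ T' n, M.Chain T T' n ∧ x ∈ hull T'}

lemma Mesh.Chain.mem_elements {M : Mesh Ω} {T T' : Finset (Vec d)} (hT : T ∈ M.elements) {n : ℕ}
    (h : M.Chain T T' n) : T' ∈ M.elements := (Mesh.mem_touching.1 (h.mem_touching hT)).1

lemma Mesh.hull_subset_closure (M : Mesh Ω) {T : Finset (Vec d)} (hT : T ∈ M.elements) :
    hull T ⊆ closure Ω := by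
  rw [← M.cover]
  exact Set.subset_biUnion_of_mem (u := fun T => hull T) hT

lemma Mesh.star_subset_closure (M : Mesh Ω) (T : Finset (Vec d)) : M.star T ⊆ closure Ω :=
  Set.iUnion₂_subset fun _ h => M.hull_subset_closure h.1

lemma Mesh.patch_subset_star {M : Mesh Ω} {T : Finset (Vec d)} (hT : T ∈ M.elements) :
    M.patch T ⊆ M.star T := fun _ ⟨_, _, h, hx⟩ => Mesh.hull_subset_star (h.mem_touching hT) hx

lemma Mesh.hull_subset_patch {M : Mesh Ω} {T T' : Finset (Vec d)} {n : ℕ} (h : M.Chain T T' n) :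
    hull T' ⊆ M.patch T := fun _ hx => ⟨T', n, h, hx⟩

/-! ### Distances within the patch and to the observation points. -/

section size

variable {M : Mesh Ω} (hd : 2 ≤ d) {σ : ℝ} (hσ : 1 ≤ σ) (hM : M.IsShapeRegular σ)
  {T : Finset (Vec d)} (hT : T ∈ M.elements)

include hd hσ hM hT

omit hσ in
lemma Mesh.hSize_pos : 0 < hSize T := by
  obtain ⟨c, r, hr, hb, -⟩ := hM T hT
  exact hr.trans_le (hSize_pos_of_ball (by omega) (M.isSimplex hT) hr hb)

lemma Mesh.dist_patch_le {x y : Vec d} (hx : x ∈ hull T) (hy : y ∈ M.patch T) :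
    dist x y ≤ 2 * sizeRatio d σ * hSize T := by
  obtain ⟨T', n, h, hy⟩ := hy
  obtain ⟨w, hw, hw'⟩ := (Mesh.mem_touching.1 (h.mem_touching hT)).2
  have h1 := dist_le_hSize hx hw
  have h2 := dist_le_hSize hw' hy
  have h3 := (h.hSize_le' hd hσ hM hT).2
  have h4 := mul_le_mul_of_nonneg_right (one_le_sizeRatio (d := d) hσ) (hSize_nonneg T)
  linarith [dist_triangle x w y]

lemma Mesh.dist_patch_patch_le {x y : Vec d} (hx : x ∈ M.patch T) (hy : y ∈ M.patch T) :
    dist x y ≤ 4 * sizeRatio d σ * hSize T := by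
  obtain ⟨w, hw⟩ := (M.isSimplex hT).interior_nonempty
  have hw := interior_subset hw
  have h1 := Mesh.dist_patch_le hd hσ hM hT hw hx
  have h2 := Mesh.dist_patch_le hd hσ hM hT hw hy
  rw [dist_comm] at h1
  linarith [dist_triangle x w y]

/-- Where the distance from y to 𝒟 is at least a multiple of h_T, it is therefore at least a
multiple of D_T, and the weight at y is at least a multiple of D_T^α. -/
lemma Mesh.obsDist_le (hD : D.Nonempty) {y : Vec d} (hy : y ∈ M.patch T) :
    obsDist D T ≤ Metric.infDist y (D : Set (Vec d)) + 2 * sizeRatio d σ * hSize T := by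
  obtain ⟨t, ht, h⟩ := exists_infDist_eq hD y
  obtain ⟨w, hw⟩ := (M.isSimplex hT).interior_nonempty
  rw [h]
  refine (csInf_le (D.finite_toSet.image _).bddBelow ⟨t, ht, rfl⟩).trans ?_
  refine csSup_le ⟨_, w, interior_subset hw, rfl⟩ ?_
  rintro _ ⟨x, hx, rfl⟩
  have := Mesh.dist_patch_le hd hσ hM hT hx hy
  simp only
  linarith [dist_triangle x y t]

end size

/-- Two points of T are joined through t. This makes D_T positive and lets h_T^α be replaced by 2^α
D_T^α in the load term. -/
lemma hSize_le_obsDist (hD : D.Nonempty) (T : Finset (Vec d)) : hSize T ≤ 2 * obsDist D T := by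
  rw [← div_le_iff₀' two_pos]
  refine le_csInf (by simpa using hD) ?_
  rintro _ ⟨t, ht, rfl⟩
  simp only
  have hb : BddAbove ((fun x => dist x t) '' hull T) :=
    ((isCompact_hull T).image (by fun_prop)).bddAbove
  have h0 : 0 ≤ sSup ((fun x => dist x t) '' hull T) :=
    Real.sSup_nonneg (by rintro _ ⟨x, hx, rfl⟩; exact dist_nonneg)
  rw [div_le_iff₀' two_pos]
  refine Metric.diam_le_of_forall_dist_le (by linarith) fun x hx y hy => ?_
  have h1 := le_csSup hb ⟨x, hx, rfl⟩
  have h2 := le_csSup hb ⟨y, hy, rfl⟩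
  simp only at h1 h2
  linarith [dist_triangle_right x y t]

/-! ### The error equations and the balls they control. -/

/-- The error `(eG, er)` solves the adjoint equations with right-hand side given by the discrete
solution `(z, r)` and by the loads `Y` at the observation points, tested with bumps. -/
structure IsErrorPair (Ω : Set (Vec d)) (D : Finset (Vec d)) (C : ℝ) (Y : Vec d → Vec d)
    (eG : Vec d → Tens d) (er : Vec d → ℝ) (z : Vec d → Vec d) (r : Vec d → ℝ) : Prop where
  grad_integrable : LocallyIntegrableOn eG Ω
  pressure_integrable : LocallyIntegrableOn er Ω
  tr_eq : ∀ᵐ x ∂(volume.restrict Ω), tr (grad z x) = - tr (eG x)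
  residual_le : ∀ (x₀ a : Vec d) (s : ℝ), 0 < s → Metric.closedBall x₀ s ⊆ Ω →
    |∑ t ∈ D, ⟪Y t, bumpField x₀ s a t⟫_ℝ - weakResidual Ω z r (bumpField x₀ s a)| ≤
      d * (C * ‖a‖ / s) * ((∫ x in Metric.ball x₀ s, ‖eG x‖) + ∫ x in Metric.ball x₀ s, ‖er x‖)

/-- The volume of the unit ball. -/
def unitBallVol (d : ℕ) : ℝ := volume.real (Metric.ball (0 : Vec d) 1)

lemma unitBallVol_pos : 0 < unitBallVol d :=
  ENNReal.toReal_pos (Metric.measure_ball_pos _ _ one_pos).ne' measure_ball_lt_top.ne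

lemma volume_ball (x : Vec d) {s : ℝ} (hs : 0 < s) :
    volume (Metric.ball x s) = ENNReal.ofReal (unitBallVol d * s ^ d) := by
  rw [Measure.addHaar_ball_of_pos _ _ hs, finrank_euclideanSpace_fin, unitBallVol, mul_comm,
    ENNReal.ofReal_mul measureReal_nonneg, ofReal_measureReal measure_ball_lt_top.ne]

namespace IsErrorPair

variable {C : ℝ} {Y : Vec d → Vec d} {eG : Vec d → Tens d} {er : Vec d → ℝ} {z : Vec d → Vec d}
  {r : Vec d → ℝ} (h : IsErrorPair Ω D C Y eG er z r) {S : Set (Vec d)} {E : ℝ} (hE0 : 0 ≤ E)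
  (hEG : wL2Sq (rho Ω D α) S eG ≤ ENNReal.ofReal (E ^ 2))
  (hEr : wL2Sq (rho Ω D α) S er ≤ ENNReal.ofReal (E ^ 2))

include h hE0 hEG hEr

lemma integral_le (hd : 0 < d) (hD : D.Nonempty) {x₀ : Vec d} {s W : ℝ}
    (hΩ : Metric.closedBall x₀ s ⊆ Ω) (hS : Metric.ball x₀ s ⊆ S)
    (hW0 : 0 ≤ W)
    (hW : ∫⁻ x in Metric.ball x₀ s, ENNReal.ofReal (rho Ω D α x)⁻¹ ≤ ENNReal.ofReal W) :
    ∫ x in Metric.ball x₀ s, ‖eG x‖ ≤ √W * E ∧ ∫ x in Metric.ball x₀ s, ‖er x‖ ≤ √W * E := by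
  have hpos : ∀ᵐ x ∂(volume.restrict (Metric.ball x₀ s)), 0 < rho Ω D α x := by
    filter_upwards [ae_restrict_of_ae (ae_notMem_finset hd D)] with x hx using rho_pos hD hx
  have hcb := isCompact_closedBall x₀ s
  have hmono : ∀ {F : Type} [NormedAddCommGroup F] (f : Vec d → F),
      wL2Sq (rho Ω D α) (Metric.ball x₀ s) f ≤ wL2Sq (rho Ω D α) S f := fun f =>
    lintegral_mono_set hS
  constructor
  · exact integral_norm_le_of_weight measurable_rho hpos
      ((h.grad_integrable.integrableOn_compact_subset hΩ hcb).mono_set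
        Metric.ball_subset_closedBall).aestronglyMeasurable hE0 hW0 hW ((hmono _).trans hEG)
  · exact integral_norm_le_of_weight measurable_rho hpos
      ((h.pressure_integrable.integrableOn_compact_subset hΩ hcb).mono_set
        Metric.ball_subset_closedBall).aestronglyMeasurable hE0 hW0 hW ((hmono _).trans hEr)

/-- Balls away from the observation points are controlled. -/
lemma isControlled (hd : 0 < d) (hD : D.Nonempty) (hC : 1 ≤ C) {x₀ : Vec d} {s m : ℝ}
    (hs : 0 < s) (hΩ : Metric.closedBall x₀ s ⊆ Ω) (hS : Metric.ball x₀ s ⊆ S)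
    (hDb : ∀ t ∈ D, t ∉ Metric.ball x₀ s) (hm : 0 < m)
    (hρ : ∀ y ∈ Metric.ball x₀ s, m ≤ rho Ω D α y) :
    IsControlled Ω z r s
      (2 * d * C * √(unitBallVol d * s ^ d / m) * E / (s ^ d * bumpInt d)) x₀ := by
  -- W is the volume of the ball over m and bounds the integral of ρ⁻¹. Cauchy-Schwarz then gives √W
  -- E for each error, and n is this bound brought to the form of `IsControlled`.
  set W := unitBallVol d * s ^ d / m with hWdef
  have hW0 : 0 ≤ W := by have := unitBallVol_pos (d := d); positivity
  have hI : 0 < bumpInt d := bumpInt_pos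
  have hW : ∫⁻ x in Metric.ball x₀ s, ENNReal.ofReal (rho Ω D α x)⁻¹ ≤ ENNReal.ofReal W := by
    calc ∫⁻ x in Metric.ball x₀ s, ENNReal.ofReal (rho Ω D α x)⁻¹
        ≤ ∫⁻ x in Metric.ball x₀ s, ENNReal.ofReal m⁻¹ := by
          refine setLIntegral_mono measurable_const fun x hx => ENNReal.ofReal_le_ofReal ?_
          exact inv_anti₀ hm (hρ x hx)
      _ = ENNReal.ofReal W := by
          rw [setLIntegral_const, volume_ball _ hs, ← ENNReal.ofReal_mul (by positivity), hWdef]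
          congr 1; field_simp
  obtain ⟨h1, h2⟩ := h.integral_le hE0 hEG hEr hd hD hΩ hS hW0 hW
  set n := 2 * d * C * √W * E / (s ^ d * bumpInt d) with hn
  have hnI : n * bumpInt d * s ^ d = 2 * d * C * √W * E := by rw [hn]; field_simp
  have hI' := hs.ne'
  refine ⟨Metric.ball_subset_closedBall.trans hΩ, fun a => ?_, ?_⟩
  · have h3 := h.residual_le x₀ a s hs hΩ
    rw [Finset.sum_eq_zero fun t ht => by rw [bumpField_eq_zero hs (hDb t ht), inner_zero_right],
      zero_sub, abs_neg] at h3
    refine h3.trans ?_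
    calc d * (C * ‖a‖ / s) * ((∫ x in Metric.ball x₀ s, ‖eG x‖) + ∫ x in Metric.ball x₀ s, ‖er x‖)
        ≤ d * (C * ‖a‖ / s) * (√W * E + √W * E) := by gcongr
      _ = s⁻¹ * ‖a‖ * (2 * d * C * √W * E) := by rw [div_eq_mul_inv]; ring
      _ = s ^ d * s⁻¹ * (‖a‖ * (n * bumpInt d)) := by rw [← hnI]; ring
  · have h3 : ∫ x, bump (s⁻¹ • (x - x₀)) * tr (grad z x) =
        ∫ x in Metric.ball x₀ s, bump (s⁻¹ • (x - x₀)) * tr (grad z x) := by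
      refine (setIntegral_eq_integral_of_forall_compl_eq_zero fun x hx => ?_).symm
      rw [bump_eq_zero (one_le_norm_of_notMem_ball hs hx), zero_mul]
    have hae : ∀ᵐ x ∂(volume.restrict (Metric.ball x₀ s)), tr (grad z x) = - tr (eG x) :=
      ae_mono (Measure.restrict_mono (Metric.ball_subset_closedBall.trans hΩ) le_rfl) h.tr_eq
    rw [h3]
    calc |∫ x in Metric.ball x₀ s, bump (s⁻¹ • (x - x₀)) * tr (grad z x)|
        ≤ ∫ x in Metric.ball x₀ s, d * ‖eG x‖ := by
          refine (abs_integral_le_integral_abs).trans (integral_mono_of_nonneg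
            (Eventually.of_forall fun x => abs_nonneg _)
            (((h.grad_integrable.integrableOn_compact_subset hΩ
              (isCompact_closedBall x₀ s)).mono_set Metric.ball_subset_closedBall).norm.const_mul _)
            ?_)
          filter_upwards [hae] with x hx
          rw [hx, abs_mul, abs_neg, abs_of_nonneg (bump_nonneg _)]
          exact (mul_le_of_le_one_left (abs_nonneg _) (bump_le_one _)).trans (abs_tr_le _)
      _ ≤ d * (√W * E) := by
          rw [integral_const_mul]; gcongr
      _ ≤ 2 * d * C * √W * E := by
          have : 0 ≤ d * (√W * E) := by positivity
          nlinarith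
      _ = s ^ d * (n * bumpInt d) := by rw [← hnI]; ring

end IsErrorPair

/-- The patch of an element is controlled. -/
lemma IsErrorPair.isPatchControlled {C : ℝ} {Y : Vec d → Vec d} {eG : Vec d → Tens d}
    {er : Vec d → ℝ} {z : Vec d → Vec d} {r : Vec d → ℝ} (h : IsErrorPair Ω D C Y eG er z r)
    (hd : 2 ≤ d) (hΩ : IsLipschitzDomain Ω) (hD : D.Nonempty) (hα : 0 ≤ α) (hC : 1 ≤ C)
    {M : Mesh Ω} {σ : ℝ} (hσ : 1 ≤ σ) (hM : M.IsShapeRegular σ) {T : Finset (Vec d)}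
    (hT : T ∈ M.elements) (hcard : (M.star T ∩ (D : Set (Vec d))).ncard ≤ 1) {E : ℝ} (hE0 : 0 ≤ E)
    (hEG : wL2Sq (rho Ω D α) (M.star T) eG ≤ ENNReal.ofReal (E ^ 2))
    (hEr : wL2Sq (rho Ω D α) (M.star T) er ≤ ENNReal.ofReal (E ^ 2)) {c : ℝ} (hc : 0 < c)
    (hρ : ∀ x ∈ closure Ω, c * Metric.infDist x (D : Set (Vec d)) ^ α ≤ rho Ω D α x) {s Λ m : ℝ}
    (hs : 0 < s) (hΛ : s + 2 * sizeRatio d σ * hSize T ≤ Λ * s)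
    (hm : m = c * (obsDist D T / Λ) ^ α) :
    IsPatchControlled Ω z r s
      (2 * d * C * √(unitBallVol d * s ^ d / m) * E / (s ^ d * bumpInt d)) (M.patch T) := by
  have hh := Mesh.hSize_pos hd hM hT
  have hK : 0 < sizeRatio d σ := one_pos.trans_le (one_le_sizeRatio hσ)
  have hΛ0 : 0 < Λ := by
    by_contra hneg
    have : 0 < s + 2 * sizeRatio d σ * hSize T := by positivity
    nlinarith
  have hobs : 0 < obsDist D T := by linarith [hSize_le_obsDist hD T]
  have hm0 : 0 < m := by rw [hm]; positivity
  -- A centre at distance 2s from 𝒟 keeps its ball at distance s. There D_T ≤ Λ dist(y, 𝒟), so the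
  -- weight is at least m.
  have key : ∀ x, Metric.closedBall x (2 * s) ⊆ M.patch T → (∀ t ∈ D, 2 * s ≤ dist t x) →
      IsControlled Ω z r s
        (2 * d * C * √(unitBallVol d * s ^ d / m) * E / (s ^ d * bumpInt d)) x := by
    intro x hx hxD
    have hb : Metric.ball x s ⊆ M.patch T :=
      (Metric.ball_subset_closedBall.trans
        (Metric.closedBall_subset_closedBall (by linarith))).trans hx
    refine h.isControlled hE0 hEG hEr (by omega) hD hC hs (hΩ.closedBall_subset hs
      (hx.trans ((Mesh.patch_subset_star hT).trans (M.star_subset_closure T))))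
      (hb.trans (Mesh.patch_subset_star hT)) (fun t ht htb => ?_) hm0 fun y hy => ?_
    · rw [Metric.mem_ball] at htb
      linarith [hxD t ht]
    · refine le_trans ?_ (hρ y (M.star_subset_closure T (Mesh.patch_subset_star hT (hb hy))))
      rw [hm]
      have h1 := Mesh.obsDist_le hd hσ hM hT hD (hb hy)
      have h2 : s ≤ Metric.infDist y (D : Set (Vec d)) := by
        obtain ⟨t, ht, he⟩ := exists_infDist_eq hD y
        rw [he]
        have h3 := hxD t ht
        rw [Metric.mem_ball] at hy
        linarith [dist_triangle_left t x y]
      gcongr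
      rw [div_le_iff₀ hΛ0]
      have h4 : 2 * sizeRatio d σ * hSize T ≤ (Λ - 1) * s := by linarith
      have h5 : 0 ≤ Λ - 1 := by
        by_contra hneg
        have : 0 < 2 * sizeRatio d σ * hSize T := by positivity
        nlinarith
      nlinarith
  intro x x' hx hx' hxx'
  by_contra hcon
  push Not at hcon
  -- An uncontrolled ball has an observation point of the star within 2s of its centre. Two such
  -- balls would share that point, and their centres would be closer than 4s.
  have hbad : ∀ x, Metric.closedBall x (2 * s) ⊆ M.patch T → ¬ IsControlled Ω z r s
      (2 * d * C * √(unitBallVol d * s ^ d / m) * E / (s ^ d * bumpInt d)) x →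
      ∃ t ∈ M.star T ∩ (D : Set (Vec d)), dist t x < 2 * s := by
    intro x hx hn
    by_contra hne
    push Not at hne
    refine hn (key x hx fun t ht => ?_)
    by_contra hle
    exact hle (hne t ⟨Mesh.patch_subset_star hT (hx (not_le.1 hle).le), ht⟩)
  obtain ⟨t, ht, htx⟩ := hbad x hx hcon.1
  obtain ⟨t', ht', htx'⟩ := hbad x' hx' hcon.2
  have hfin : (M.star T ∩ (D : Set (Vec d))).Finite := D.finite_toSet.inter_of_right _
  have htt : t = t' := (Set.ncard_le_one hfin).1 hcard t ht t' ht'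
  subst htt
  linarith [dist_triangle_left x x' t]

end

section

/-! ### The discrete solution on a controlled patch -/

variable {Ω : Set (Vec d)}

lemma Mesh.exists_pieces {M : Mesh Ω} {z : Vec d → Vec d} {r : Vec d → ℝ} (hz : M.InV z)
    (hr : M.InQ r) :
    ∃ (P : Finset (Vec d) → Vec d → Vec d) (A : Finset (Vec d) → Vec d →L[ℝ] Vec d)
      (B : Finset (Vec d) → Vec d →L[ℝ] Vec d →L[ℝ] Vec d) (c : Finset (Vec d) → ℝ)
      (b : Finset (Vec d) → Vec d), ∀ T ∈ M.elements,
        IsQuadOn (hull T) z (P T) (A T) (B T) ∧ ∀ x ∈ hull T, r x = c T + ⟪b T, x⟫_ℝ := by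
  choose! P A B h1 using fun T hT => exists_isQuadOn (hz.1.2 T hT)
  choose! c b h2 using fun T hT => (hr.2.1 T hT).exists_affine
  exact ⟨P, A, B, c, b, fun T hT => ⟨h1 T hT, h2 T hT⟩⟩

/-- The factor in the bound for the jumps in a patch. -/
def jumpConst (d : ℕ) (σ : ℝ) : ℝ := 12 + (2 * d + 8) * (24 * d * σ * sizeRatio d σ ^ 2)

lemma jumpConst_pos {σ : ℝ} (hσ : 1 ≤ σ) : 0 < jumpConst d σ := by
  have : 0 < sizeRatio d σ := one_pos.trans_le (one_le_sizeRatio hσ)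
  unfold jumpConst
  positivity

/-! ### Comparing the polynomials of different elements of a patch. -/

section patch

variable {M : Mesh Ω} (hd : 2 ≤ d) {σ : ℝ} (hσ : 1 ≤ σ) (hM : M.IsShapeRegular σ)
  {T : Finset (Vec d)} (hT : T ∈ M.elements) {s n : ℝ} (hs : 0 < s)
  (hsT : 6 * d * σ * sizeRatio d σ * s = hSize T)

-- This fixes s relative to h_T. The factor d is lost at a side, where the half balls have radius
-- r/d; the factor 6 leaves room for centres displaced by 4s with balls of radius 2s.
include hd hσ hM hT hs hsT in
lemma Mesh.Chain.exists_ball {T' : Finset (Vec d)} {k : ℕ} (h : M.Chain T T' k) :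
    ∃ c : Vec d, Metric.closedBall c (6 * s) ⊆ hull T' ∧ Metric.ball c (6 * d * s) ⊆ hull T' := by
  obtain ⟨c, r, hr, hb, hh⟩ := hM T' (h.mem_elements hT)
  have h1 := (h.hSize_le' hd hσ hM hT).1
  have hK : 0 < sizeRatio d σ := one_pos.trans_le (one_le_sizeRatio hσ)
  have h2 : 6 * d * s ≤ r := by
    have h3 : sizeRatio d σ * σ * (6 * d * s) ≤ sizeRatio d σ * σ * r := by
      have := mul_le_mul_of_nonneg_left hh hK.le
      linarith
    exact le_of_mul_le_mul_left h3 (by positivity)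
  have hd2 : (2 : ℝ) ≤ d := by exact_mod_cast hd
  refine ⟨c, (Metric.closedBall_subset_ball ?_).trans hb, (Metric.ball_subset_ball h2).trans hb⟩
  nlinarith

variable {z : Vec d → Vec d} {r : Vec d → ℝ} {P : Finset (Vec d) → Vec d → Vec d}
  {A : Finset (Vec d) → Vec d →L[ℝ] Vec d} {B : Finset (Vec d) → Vec d →L[ℝ] Vec d →L[ℝ] Vec d}
  {c : Finset (Vec d) → ℝ} {b : Finset (Vec d) → Vec d}
  (hP : ∀ T ∈ M.elements, IsQuadOn (hull T) z (P T) (A T) (B T) ∧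
    ∀ x ∈ hull T, r x = c T + ⟪b T, x⟫_ℝ)
  (hX : IsPatchControlled Ω z r s n (M.patch T))

include hd hσ hM hT hs hsT hP hX

lemma Mesh.Chain.norm_strongResidual_le {T' : Finset (Vec d)} {k : ℕ} (h : M.Chain T T' k) :
    s * ‖strongResidual (B T') (b T')‖ ≤ n := by
  obtain ⟨x, hx, -⟩ := h.exists_ball hd hσ hM hT hs hsT
  obtain ⟨h1, h2⟩ := hP T' (h.mem_elements hT)
  exact norm_strongResidual_le_of_patch hX hs h1 h2 hx (Mesh.hull_subset_patch h)
    (norm_basisVec ⟨0, by omega⟩)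

lemma Mesh.Chain.abs_tr_le {T' : Finset (Vec d)} {k : ℕ} (h : M.Chain T T' k) {u : Vec d}
    (hu : ‖u‖ = 1) : s * |tr (tensOf (B T' u))| ≤ n := by
  obtain ⟨x, hx, -⟩ := h.exists_ball hd hσ hM hT hs hsT
  exact abs_tr_le_of_patch hX hs (hP T' (h.mem_elements hT)).1 hx (Mesh.hull_subset_patch h) hu

open Classical in
lemma Mesh.Chain.neighbor_jump_le {T₁ T₂ : Finset (Vec d)} {k l : ℕ} (h₁ : M.Chain T T₁ k)
    (h₂ : M.Chain T T₂ l) (h₁₂ : T₂ ∈ M.neighbors T₁) :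
    ∃ ν : Vec d, ‖ν‖ = 1 ∧ sideNormal (T₁ ∩ T₂) T₂ = ν ∧ sideNormal (T₁ ∩ T₂) T₁ = -ν ∧
      ∀ x ∈ M.patch T,
        (∀ u, ‖(A T₂ + B T₂ x) u - (A T₁ + B T₁ x) u‖ ≤ jumpConst d σ * n * ‖u‖) ∧
        |(c T₂ + ⟪b T₂, x⟫_ℝ) - (c T₁ + ⟪b T₁, x⟫_ℝ)| ≤ jumpConst d σ * n := by
  have hT₁ := h₁.mem_elements hT
  have hT₂ := h₂.mem_elements hT
  obtain ⟨y₁, -, hy₁⟩ := h₁.exists_ball hd hσ hM hT hs hsT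
  obtain ⟨y₂, -, hy₂⟩ := h₂.exists_ball hd hσ hM hT hs hsT
  have hd0 : (0 : ℝ) < d := by exact_mod_cast (by omega : 0 < d)
  obtain ⟨-, -, hcard⟩ := Mesh.mem_neighbors.1 h₁₂
  obtain ⟨ν, x₀, hν, hn₂, hn₁, hx₀, hm₁, hm₂, -⟩ := exists_side_normal (by omega)
    (M.isSimplex hT₁) (M.isSimplex hT₂) (M.conforming T₁ hT₁ T₂ hT₂) hcard
    (r := 6 * d * s) (by positivity) hy₁ hy₂
  refine ⟨ν, hν, hn₂, hn₁, fun x hx => ?_⟩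
  have hr : 6 * d * s / d = 6 * s := by field_simp
  rw [hr] at hm₁ hm₂
  have H : IsSidePair z r (hull T₁) (hull T₂) (P T₁) (P T₂) (A T₁) (A T₂) (B T₁) (B T₂) (c T₁)
      (c T₂) (b T₁) (b T₂) x₀ ν (6 * s) :=
    ⟨(hP T₁ hT₁).1, (hP T₂ hT₂).1, (hP T₁ hT₁).2, (hP T₂ hT₂).2, hν, hm₁, hm₂⟩
  have hx₀T : x₀ ∈ hull T₁ := convexHull_mono (by simp) hx₀
  -- Points of the patch are within 4 K h_T of each other, K being the size ratio, and h_T = 6dσK s;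
  -- this is the length in `jumpConst`.
  have hdist : ‖x - x₀‖ ≤ 24 * d * σ * sizeRatio d σ ^ 2 * s := by
    rw [← dist_eq_norm]
    refine (Mesh.dist_patch_patch_le hd hσ hM hT hx (Mesh.hull_subset_patch h₁ hx₀T)).trans ?_
    rw [← hsT]
    exact le_of_eq (by ring)
  exact H.jump_le hs hX (Mesh.hull_subset_patch h₁) (Mesh.hull_subset_patch h₂)
    (h₁.norm_strongResidual_le hd hσ hM hT hs hsT hP hX)
    (h₂.norm_strongResidual_le hd hσ hM hT hs hsT hP hX) hd
    (h₁.abs_tr_le hd hσ hM hT hs hsT hP hX hν) (h₂.abs_tr_le hd hσ hM hT hs hsT hP hX hν) hdist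

lemma Mesh.Chain.jump_le {T' : Finset (Vec d)} {k : ℕ} (h : M.Chain T T' k) {x : Vec d}
    (hx : x ∈ M.patch T) :
    (∀ u, ‖(A T' + B T' x) u - (A T + B T x) u‖ ≤ k * (jumpConst d σ * n) * ‖u‖) ∧
      |(c T' + ⟪b T', x⟫_ℝ) - (c T + ⟪b T, x⟫_ℝ)| ≤ k * (jumpConst d σ * n) := by
  induction h with
  | refl => simp
  | @step T₁ T₂ k h₁ h₂ h₃ ih =>
    obtain ⟨ν, -, -, -, hj⟩ := h₁.neighbor_jump_le hd hσ hM hT hs hsT hP hX (h₁.step h₂ h₃) h₃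
    obtain ⟨j1, j2⟩ := hj x hx
    rw [Nat.cast_add, Nat.cast_one]
    constructor
    · intro u
      have e := norm_sub_le_norm_sub_add_norm_sub ((A T₂ + B T₂ x) u) ((A T₁ + B T₁ x) u)
        ((A T + B T x) u)
      linarith [j1 u, ih.1 u]
    · have e := abs_sub_le (c T₂ + ⟪b T₂, x⟫_ℝ) (c T₁ + ⟪b T₁, x⟫_ℝ) (c T + ⟪b T, x⟫_ℝ)
      linarith [ih.2]

/-- Jumps add up along a path, and a shortest one has at most `touchBound d σ` steps. -/
lemma Mesh.patch_jump_le {T' : Finset (Vec d)} {k : ℕ} (h : M.Chain T T' k) {x : Vec d}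
    (hx : x ∈ M.patch T) :
    (∀ u, ‖(A T' + B T' x) u - (A T + B T x) u‖ ≤
        touchBound d σ * (jumpConst d σ * n) * ‖u‖) ∧
      |(c T' + ⟪b T', x⟫_ℝ) - (c T + ⟪b T, x⟫_ℝ)| ≤ touchBound d σ * (jumpConst d σ * n) := by
  obtain ⟨m, hm, h'⟩ := h.exists_short hT
  have hn : 0 ≤ n := (by positivity : 0 ≤ s * ‖strongResidual (B T') (b T')‖).trans
    (h.norm_strongResidual_le hd hσ hM hT hs hsT hP hX)
  have hmN : (m : ℝ) ≤ touchBound d σ := by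
    exact_mod_cast hm.trans (M.card_touching_le (by omega) hσ hM hT)
  have hj := jumpConst_pos (d := d) hσ
  obtain ⟨j1, j2⟩ := h'.jump_le hd hσ hM hT hs hsT hP hX hx
  exact ⟨fun u => (j1 u).trans (by gcongr), j2.trans (by gcongr)⟩

end patch

lemma Mesh.isClosed_patch (M : Mesh Ω) {T : Finset (Vec d)} (hT : T ∈ M.elements) :
    IsClosed (M.patch T) := by
  have : M.patch T = ⋃ T' ∈ {T' | T' ∈ M.elements ∧ ∃ n, M.Chain T T' n}, hull T' := by
    ext x
    simp only [Mesh.patch, Set.mem_ofPred_eq, Set.mem_iUnion, exists_prop]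
    constructor
    · rintro ⟨T', n, h, hx⟩
      exact ⟨T', ⟨h.mem_elements hT, n, h⟩, hx⟩
    · rintro ⟨T', ⟨-, n, h⟩, hx⟩
      exact ⟨T', n, h, hx⟩
  rw [this]
  exact (M.elements.finite_toSet.subset fun T' h => h.1).isClosed_biUnion
    fun T' _ => (isCompact_hull T').isClosed

lemma subset_of_ae_mem {U S : Set (Vec d)} (hU : IsOpen U) (hS : IsClosed S)
    (h : ∀ᵐ x : Vec d, x ∈ U → x ∈ S) : U ⊆ S := by
  intro x hx
  by_contra hxS
  have hne : (U ∩ Sᶜ).Nonempty := ⟨x, hx, hxS⟩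
  refine (hU.inter hS.isOpen_compl).measure_ne_zero volume hne ?_
  rw [ae_iff] at h
  refine measure_mono_null (fun y hy => ?_) h
  simpa using hy

/-- The patch is closed, so containing almost every point of an open ball means containing the ball.
-/
lemma Mesh.ball_subset_patch (M : Mesh Ω) (hd : 2 ≤ d) {σ : ℝ} (hσ : 1 ≤ σ)
    (hM : M.IsShapeRegular σ) {T : Finset (Vec d)} (hT : T ∈ M.elements) {t : Vec d}
    (ht : t ∈ hull T) {ℓ : ℝ} (hℓ : 0 < ℓ) (hℓ' : 2 * σ * sizeRatio d σ * ℓ ≤ hSize T)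
    (hΩ : Metric.ball t ℓ ⊆ closure Ω) : Metric.ball t ℓ ⊆ M.patch T :=
  subset_of_ae_mem Metric.isOpen_ball (M.isClosed_patch hT)
    (M.ae_mem_chain hd hσ hM hT ht hℓ hℓ' hΩ)

lemma Mesh.ae_mem_interior (M : Mesh Ω) :
    ∀ᵐ x : Vec d, ∀ T ∈ M.elements, x ∈ hull T → x ∈ interior (hull T) := by
  have h : ∀ T ∈ M.elements, ∀ᵐ x : Vec d, x ∈ hull T → x ∈ interior (hull T) := by
    intro T _
    have := measure_eq_zero_iff_ae_notMem.1 ((convex_hull' T).addHaar_frontier volume)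
    filter_upwards [this] with x hx hxT
    by_contra hxi
    exact hx ⟨subset_closure hxT, hxi⟩
  exact (ae_ball_iff M.elements.countable_toSet).2 h

end

section

/-! ### The load at an observation point -/

variable {Ω : Set (Vec d)} {D : Finset (Vec d)} {α : ℝ}

/-- Replacing the discrete solution by the polynomials of one element changes the residual by a
quantity that is controlled by the jumps. -/
lemma weakResidual_sub_le (hd : 0 < d) (hΩ : IsOpen Ω) {z : Vec d → Vec d} {r : Vec d → ℝ}
    (hz : LocallyIntegrableOn (grad z) Ω) (hr : LocallyIntegrableOn r Ω) {P : Vec d → Vec d}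
    {A : Vec d →L[ℝ] Vec d} {B : Vec d →L[ℝ] Vec d →L[ℝ] Vec d}
    (hP : IsQuadOn Set.univ P P A B) {c : ℝ} {b : Vec d} {C : ℝ}
    (hC : ∀ y : Vec d, bumpKer y * ‖y‖ ≤ C) {t a : Vec d} {ℓ κ : ℝ} (hℓ : 0 < ℓ) (hκ : 0 ≤ κ)
    (hball : Metric.closedBall t ℓ ⊆ Ω)
    (hjump : ∀ᵐ x, x ∈ Metric.ball t ℓ → (∀ u, ‖fderiv ℝ z x u - (A + B x) u‖ ≤ κ * ‖u‖) ∧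
      |r x - (c + ⟪b, x⟫_ℝ)| ≤ κ) :
    |weakResidual Ω z r (bumpField t ℓ a) + ℓ ^ d * bumpInt d * ⟪a, strongResidual B b⟫_ℝ| ≤
      2 * d * (C * ‖a‖ / ℓ) * κ * (unitBallVol d * ℓ ^ d) := by
  have hw := isTest_bumpField (a := a) hℓ hball
  have hbΩ := Metric.ball_subset_closedBall.trans hball
  have hPr := weakResidual_interior (Ω := Ω) hP (r := fun x => c + ⟪b, x⟫_ℝ) (fun x _ => rfl) hℓ a
    (Set.subset_univ _) hbΩ
  have hgP : LocallyIntegrableOn (grad P) Ω := by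
    have : Continuous (grad P) := by
      refine (PiLp.continuous_toLp 2 _).comp (continuous_pi fun j => ?_)
      simp only [hP.fderiv_eq]
      fun_prop
    exact this.locallyIntegrable.locallyIntegrableOn Ω
  have hq : LocallyIntegrableOn (fun x => c + ⟪b, x⟫_ℝ) Ω :=
    (by fun_prop : Continuous fun x : Vec d => c + ⟪b, x⟫_ℝ).locallyIntegrable.locallyIntegrableOn Ω
  have i12 : IntegrableOn (fun x => ⟪grad (bumpField t ℓ a) x, grad z x⟫_ℝ +
      r x * tr (grad (bumpField t ℓ a) x)) Ω :=
    (integrableOn_inner_grad hw hΩ hz).add (integrableOn_mul_tr_grad hw hΩ hr)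
  have i34 : IntegrableOn (fun x => ⟪grad (bumpField t ℓ a) x, grad P x⟫_ℝ +
      (c + ⟪b, x⟫_ℝ) * tr (grad (bumpField t ℓ a) x)) Ω :=
    (integrableOn_inner_grad hw hΩ hgP).add (integrableOn_mul_tr_grad hw hΩ hq)
  have e1 : weakResidual Ω z r (bumpField t ℓ a) +
      ℓ ^ d * bumpInt d * ⟪a, strongResidual B b⟫_ℝ =
      ∫ x in Metric.ball t ℓ, (⟪grad (bumpField t ℓ a) x, grad z x - grad P x⟫_ℝ +
        (r x - (c + ⟪b, x⟫_ℝ)) * tr (grad (bumpField t ℓ a) x)) := by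
    rw [← setIntegral_eq_of_subset_of_forall_sdiff_eq_zero hΩ.measurableSet hbΩ
      (fun x hx => by rw [grad_bumpField_eq_zero hℓ hx.2]; simp [tr])]
    -- The polynomials of the single element, extended to the whole space, have no jumps, so their
    -- weak residual is given by the interior formula.
    have e2 : ℓ ^ d * bumpInt d * ⟪a, strongResidual B b⟫_ℝ =
        - weakResidual Ω P (fun x => c + ⟪b, x⟫_ℝ) (bumpField t ℓ a) := by rw [hPr]; ring
    rw [e2, ← sub_eq_add_neg, weakResidual, weakResidual, ← integral_sub i12 i34]
    refine integral_congr_ae (Eventually.of_forall fun x => ?_)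
    simp only [inner_sub_right]
    ring
  rw [e1, ← Real.norm_eq_abs]
  have hvol : volume.real (Metric.ball t ℓ) = unitBallVol d * ℓ ^ d := by
    rw [measureReal_def, volume_ball t hℓ, ENNReal.toReal_ofReal]
    have := unitBallVol_pos (d := d)
    positivity
  rw [← hvol]
  refine norm_setIntegral_le_of_norm_le_const_ae' measure_ball_lt_top ?_
  filter_upwards [hjump] with x hx hxb
  obtain ⟨h1, h2⟩ := hx hxb
  have h3 := norm_grad_bumpField_le (x₀ := t) (a := a) hℓ hC x
  have h0 : 0 ≤ C * ‖a‖ / ℓ := (norm_nonneg _).trans h3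
  have h4 : ‖grad z x - grad P x‖ ≤ d * κ := by
    have : grad z x - grad P x = tensOf (fderiv ℝ z x - (A + B x)) := by
      rw [grad_eq_tensOf, grad_eq_tensOf, hP.fderiv_eq]; rfl
    rw [this]
    exact norm_tensOf_le hκ h1
  rw [Real.norm_eq_abs]
  calc _ ≤ C * ‖a‖ / ℓ * (d * κ) + κ * (d * (C * ‖a‖ / ℓ)) := by
        refine (abs_add_le _ _).trans (add_le_add ?_ ?_)
        · exact (abs_real_inner_le_norm _ _).trans
            (mul_le_mul h3 h4 (norm_nonneg _) h0)
        · rw [abs_mul]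
          refine mul_le_mul h2 ((abs_tr_le _).trans ?_) (abs_nonneg _) hκ
          gcongr
    _ = _ := by ring

lemma IsQuadOn.univ {S : Set (Vec d)} {v P : Vec d → Vec d} {A : Vec d →L[ℝ] Vec d}
    {B : Vec d →L[ℝ] Vec d →L[ℝ] Vec d} (h : IsQuadOn S v P A B) : IsQuadOn Set.univ P P A B :=
  ⟨h.hasFDerivAt, h.symm, fun _ _ => rfl⟩

/-- The load at an observation point is controlled by the errors. -/
lemma IsErrorPair.norm_load_le {C : ℝ} {Y : Vec d → Vec d} {eG : Vec d → Tens d}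
    {er : Vec d → ℝ} {z : Vec d → Vec d} {r : Vec d → ℝ} (h : IsErrorPair Ω D C Y eG er z r)
    (hd : 2 ≤ d) (hΩ : IsOpen Ω) (hD : D.Nonempty)
    (hC1 : 1 ≤ C) (hC : ∀ y : Vec d, bumpKer y * ‖y‖ ≤ C)
    {M : Mesh Ω} {σ : ℝ} (hσ : 1 ≤ σ) (hM : M.IsShapeRegular σ) {T : Finset (Vec d)}
    (hT : T ∈ M.elements) (hcard : (M.star T ∩ (D : Set (Vec d))).ncard ≤ 1) {E : ℝ} (hE0 : 0 ≤ E)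
    (hEG : wL2Sq (rho Ω D α) (M.star T) eG ≤ ENNReal.ofReal (E ^ 2))
    (hEr : wL2Sq (rho Ω D α) (M.star T) er ≤ ENNReal.ofReal (E ^ 2)) {c₀ : ℝ} (hc₀ : 0 < c₀)
    (hρ : ∀ x ∈ closure Ω, c₀ * Metric.infDist x (D : Set (Vec d)) ^ α ≤ rho Ω D α x)
    {K₂ : ℝ} (hK₂ : 0 ≤ K₂) (hsing : ∀ (t : Vec d) (s : ℝ), 0 < s →
      ∫⁻ x in Metric.ball t s, ENNReal.ofReal (‖x - t‖ ^ (-α)) ≤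
        ENNReal.ofReal (K₂ * (s ^ (-α) * s ^ d)))
    {s n : ℝ} (hs : 0 < s) (hsT : 6 * d * σ * sizeRatio d σ * s = hSize T)
    (hz : M.InV z) (hr : M.InQ r) (hX : IsPatchControlled Ω z r s n (M.patch T))
    {t : Vec d} (ht : t ∈ D) (htT : t ∈ hull T) {ℓ : ℝ} (hℓ : 0 < ℓ)
    (hℓ' : 4 * σ * sizeRatio d σ * ℓ ≤ hSize T) (hℓΩ : Metric.ball t (2 * ℓ) ⊆ Ω) (e : Vec d) :
    ‖Y t - e‖ ≤ ‖e‖ + ℓ ^ d * bumpInt d * (n / s) +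
      2 * d * C * unitBallVol d * (touchBound d σ * (jumpConst d σ * n)) * (ℓ ^ d / ℓ) +
      2 * d * C / ℓ * √(c₀⁻¹ * (K₂ * (ℓ ^ (-α) * ℓ ^ d))) * E := by
  obtain ⟨P, A, B, c, b, hP⟩ := Mesh.exists_pieces hz hr
  have hpatch : Metric.ball t (2 * ℓ) ⊆ M.patch T :=
    M.ball_subset_patch hd hσ hM hT htT (by linarith) (by linarith)
      (hℓΩ.trans subset_closure)
  have hbb : Metric.ball t ℓ ⊆ Metric.ball t (2 * ℓ) := Metric.ball_subset_ball (by linarith)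
  have hcb : Metric.closedBall t ℓ ⊆ Ω :=
    (Metric.closedBall_subset_ball (by linarith)).trans hℓΩ
  have hstar := hpatch.trans (Mesh.patch_subset_star hT)
  -- The ball of radius 2ℓ lies in the star, which has no second observation point. Hence the bump
  -- vanishes at the rest of 𝒟, and within ℓ of t the distance to 𝒟 is |x - t|.
  have hfar : ∀ t' ∈ D, t' ≠ t → 2 * ℓ ≤ dist t' t := by
    intro t' ht' hne
    by_contra hlt
    have hfin : (M.star T ∩ (D : Set (Vec d))).Finite := D.finite_toSet.inter_of_right _
    exact hne ((Set.ncard_le_one hfin).1 hcard t' ⟨hstar (not_le.1 hlt), ht'⟩ t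
      ⟨hstar (Metric.mem_ball_self (by linarith)), ht⟩)
  have hinf : ∀ x ∈ Metric.ball t ℓ, Metric.infDist x (D : Set (Vec d)) = ‖x - t‖ := by
    intro x hx
    rw [Metric.mem_ball] at hx
    refine le_antisymm ((Metric.infDist_le_dist_of_mem ht).trans (dist_eq_norm x t).le) ?_
    obtain ⟨t', ht', he⟩ := exists_infDist_eq hD x
    rw [he, ← dist_eq_norm]
    by_cases hne : t' = t
    · rw [hne]
    · linarith [hfar t' ht' hne, dist_triangle_left t' t x]
  have hn : 0 ≤ n := (by positivity : 0 ≤ s * ‖strongResidual (B T) (b T)‖).trans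
    ((Mesh.Chain.refl (M := M) (T := T)).norm_strongResidual_le hd hσ hM hT hs hsT hP hX)
  have hR := (Mesh.Chain.refl (M := M) (T := T)).norm_strongResidual_le hd hσ hM hT hs hsT hP hX
  have hj := jumpConst_pos (d := d) hσ
  set κ := touchBound d σ * (jumpConst d σ * n) with hκ
  have hκ0 : 0 ≤ κ := by positivity
  have hjump : ∀ᵐ x, x ∈ Metric.ball t ℓ →
      (∀ u, ‖fderiv ℝ z x u - (A T + B T x) u‖ ≤ κ * ‖u‖) ∧
      |r x - (c T + ⟪b T, x⟫_ℝ)| ≤ κ := by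
    filter_upwards [M.ae_mem_interior] with x hx hxb
    obtain ⟨T', k, hk, hxT'⟩ := hpatch (hbb hxb)
    have hT' := hk.mem_elements hT
    rw [(hP T' hT').1.fderiv_eq_of_mem_interior (hx T' hT' hxT'), (hP T' hT').2 x hxT']
    exact Mesh.patch_jump_le hd hσ hM hT hs hsT hP hX hk ⟨T', k, hk, hxT'⟩
  -- The weight degenerates at t, so a lower bound for it is replaced by the integral of |x -
  -- t|^(-α) over the ball.
  set W := c₀⁻¹ * (K₂ * (ℓ ^ (-α) * ℓ ^ d)) with hW
  have hW0 : 0 ≤ W := by positivity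
  have hWint : ∫⁻ x in Metric.ball t ℓ, ENNReal.ofReal (rho Ω D α x)⁻¹ ≤ ENNReal.ofReal W := by
    calc ∫⁻ x in Metric.ball t ℓ, ENNReal.ofReal (rho Ω D α x)⁻¹
        ≤ ∫⁻ x in Metric.ball t ℓ, ENNReal.ofReal c₀⁻¹ * ENNReal.ofReal (‖x - t‖ ^ (-α)) := by
          refine lintegral_mono_ae ?_
          filter_upwards [ae_restrict_of_ae (ae_notMem_finset (by omega) D),
            ae_restrict_mem measurableSet_ball] with x hxD hx
          rw [← ENNReal.ofReal_mul (by positivity), ← hinf x hx]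
          exact ENNReal.ofReal_le_ofReal (rhoInv_le hD hc₀ hxD
            (hρ x (subset_closure (hℓΩ (hbb hx)))))
      _ ≤ ENNReal.ofReal c₀⁻¹ * ENNReal.ofReal (K₂ * (ℓ ^ (-α) * ℓ ^ d)) := by
          rw [lintegral_const_mul' _ _ ENNReal.ofReal_ne_top]
          gcongr
          exact hsing t ℓ hℓ
      _ = ENNReal.ofReal W := by rw [← ENNReal.ofReal_mul (by positivity)]
  obtain ⟨i1, i2⟩ := h.integral_le hE0 hEG hEr (by omega) hD hcb (hbb.trans hstar) hW0 hWint
  -- The quantity to be bounded is its own test vector, and ⟪Y t, Z⟫ = ‖Z‖² + ⟪e, Z⟫. The vector e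
  -- is free, so that the state error can be split off from the load.
  set Z := Y t - e with hZ
  have h1 := h.residual_le t Z ℓ hℓ hcb
  rw [Finset.sum_eq_single_of_mem t ht fun t' ht' hne => by
      rw [bumpField_eq_zero hℓ, inner_zero_right]
      rw [Metric.mem_ball, not_lt]
      linarith [hfar t' ht' hne], bumpField_center] at h1
  have h2 := weakResidual_sub_le (by omega) hΩ (locallyIntegrableOn_of_inV hz)
    (locallyIntegrableOn_of_inQ hΩ hr) (hP T hT).1.univ hC (a := Z) hℓ hκ0 hcb hjump
  have h3 : ⟪Y t, Z⟫_ℝ = ‖Z‖ ^ 2 + ⟪e, Z⟫_ℝ := by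
    rw [← real_inner_self_eq_norm_sq, ← inner_add_left, hZ, sub_add_cancel]
  have h4 := abs_real_inner_le_norm e Z
  have h5 := abs_real_inner_le_norm Z (strongResidual (B T) (b T))
  have h6 : ‖strongResidual (B T) (b T)‖ ≤ n / s := by rw [le_div_iff₀ hs, mul_comm]; exact hR
  have hI : 0 < bumpInt d := bumpInt_pos
  have h7 : ℓ ^ d * bumpInt d * ⟪Z, strongResidual (B T) (b T)⟫_ℝ ≥
      -(ℓ ^ d * bumpInt d * (‖Z‖ * (n / s))) := by
    rw [ge_iff_le, ← mul_neg]
    refine mul_le_mul_of_nonneg_left ?_ (by positivity)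
    refine le_trans ?_ (neg_le_of_abs_le h5)
    gcongr
  have h8 : d * (C * ‖Z‖ / ℓ) * ((∫ x in Metric.ball t ℓ, ‖eG x‖) + ∫ x in Metric.ball t ℓ, ‖er x‖) ≤
      d * (C * ‖Z‖ / ℓ) * (√W * E + √W * E) := by gcongr
  have h9 := (abs_le.1 (h1.trans h8)).2
  have h10 := (abs_le.1 h2).2
  have h11 := (abs_le.1 h4).1
  have h12 : ‖Z‖ * ‖Z‖ ≤ (‖e‖ + ℓ ^ d * bumpInt d * (n / s) +
      2 * d * C * unitBallVol d * κ * (ℓ ^ d / ℓ) + 2 * d * C / ℓ * √W * E) * ‖Z‖ := by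
    have a1 : 2 * d * C * unitBallVol d * κ * (ℓ ^ d / ℓ) * ‖Z‖ =
      2 * d * (C * ‖Z‖ / ℓ) * κ * (unitBallVol d * ℓ ^ d) := by ring
    have a2 : 2 * d * C / ℓ * √W * E * ‖Z‖ = d * (C * ‖Z‖ / ℓ) * (√W * E + √W * E) := by ring
    rw [add_mul, add_mul, add_mul, a1, a2]
    rw [h3] at h9
    linarith
  rcases (norm_nonneg Z).eq_or_lt with h0 | h0
  · rw [← h0]
    have := unitBallVol_pos (d := d)
    positivity
  · exact le_of_mul_le_mul_right h12 h0

end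

section

/-! ### The terms of the indicator -/

variable {Ω : Set (Vec d)} {D : Finset (Vec d)} {α : ℝ}

lemma volume_le_of_dist_le {S : Set (Vec d)} {x₀ : Vec d} {h : ℝ} (hh : 0 < h)
    (hS : ∀ x ∈ S, dist x x₀ ≤ h) :
    volume S ≤ ENNReal.ofReal (unitBallVol d * (2 * h) ^ d) := by
  rw [← volume_ball x₀ (by linarith : 0 < 2 * h)]
  exact measure_mono fun x hx => lt_of_le_of_lt (hS x hx) (by linarith)

/-- The surface measure of a side. -/
lemma surface_hull_le {k : ℕ} {F : Finset (Vec d)} (hF : F.card = k + 1)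
    (hind : AffineIndependent ℝ ((↑) : F → Vec d)) {h : ℝ} (hh : 0 < h)
    (hdiam : ∀ x ∈ hull F, ∀ y ∈ hull F, dist x y ≤ h) :
    μHE[k] (hull F) ≤ ENNReal.ofReal (unitBallVol k * (2 * h) ^ k) := by
  obtain ⟨v, hv⟩ : F.Nonempty := Finset.card_pos.1 (by omega)
  have hfin : Module.finrank ℝ (vectorSpan ℝ (F : Set (Vec d))) = k := by
    have := hind.finrank_vectorSpan (n := k) (by simpa using hF)
    rwa [Subtype.range_coe_subtype, Finset.setOfPred_mem] at this
  set V := vectorSpan ℝ (F : Set (Vec d)) with hV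
  set e := (stdOrthonormalBasis ℝ V).repr with he
  -- The affine span of the face is an isometric copy of ℝ^k, on which the normalized Hausdorff
  -- measure is Lebesgue measure.
  obtain ⟨φ, hφ⟩ : ∃ φ : EuclideanSpace ℝ (Fin k) → Vec d, Isometry φ ∧
      ∀ x, x - v ∈ V → ∃ y, φ y = x := by
    rw [← hfin]
    refine ⟨fun y => (e.symm y : Vec d) + v, ?_, fun x hx => ⟨e ⟨x - v, hx⟩, by simp⟩⟩
    refine Isometry.of_dist_eq fun x y => ?_
    rw [dist_add_right, ← e.symm.dist_map x y]
    rfl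
  obtain ⟨hφ, hsurj⟩ := hφ
  have hvF : v ∈ hull F := subset_hull hv
  obtain ⟨y₀, hy₀⟩ := hsurj v (by rw [sub_self]; exact V.zero_mem)
  have hsub : hull F ⊆ φ '' Metric.ball y₀ (2 * h) := by
    intro x hx
    have h1 : x - v ∈ V := by
      have := AffineSubspace.vsub_mem_direction (convexHull_subset_affineSpan _ hx)
        (convexHull_subset_affineSpan _ hvF)
      rwa [direction_affineSpan] at this
    obtain ⟨y, rfl⟩ := hsurj x h1
    refine ⟨y, ?_, rfl⟩
    rw [Metric.mem_ball, ← hφ.dist_eq, hy₀]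
    linarith [hdiam _ hx v hvF]
  refine (measure_mono hsub).trans ?_
  rw [hφ.euclideanHausdorffMeasure_image, EuclideanSpace.euclideanHausdorffMeasure_eq_volume,
    volume_ball _ (by linarith)]

/-- The right-hand side is an essential supremum. A larger value at t would persist by continuity on
an open set meeting the interior of S, which has positive measure. -/
lemma enorm_le_eLpNorm_top {F : Type*} [NormedAddCommGroup F] {f : Vec d → F} {S : Set (Vec d)}
    {t : Vec d} (hf : ContinuousAt f t) (ht : t ∈ closure (interior S)) :
    ‖f t‖ₑ ≤ eLpNorm f ∞ (volume.restrict S) := by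
  by_contra hlt
  rw [not_le] at hlt
  have hev : ∀ᶠ x in 𝓝 t, eLpNorm f ∞ (volume.restrict S) < ‖f x‖ₑ :=
    (hf.enorm).eventually (lt_mem_nhds hlt)
  obtain ⟨U, hU, hUo, htU⟩ := eventually_nhds_iff.1 hev
  have hne : (U ∩ interior S).Nonempty := mem_closure_iff.1 ht U hUo htU
  have h1 : ∀ᵐ x ∂(volume.restrict S), ‖f x‖ₑ ≤ eLpNorm f ∞ (volume.restrict S) := by
    rw [eLpNorm_exponent_top]
    exact ae_le_eLpNormEssSup
  refine (hUo.inter isOpen_interior).measure_ne_zero volume hne ?_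
  have h2 : ∀ᵐ x ∂(volume.restrict (U ∩ interior S)), False := by
    filter_upwards [ae_mono (Measure.restrict_mono
      (Set.inter_subset_right.trans interior_subset) le_rfl) h1,
      ae_restrict_mem (hUo.inter isOpen_interior).measurableSet] with x hx hxU
    exact absurd (hU x hxU.1) (not_lt.2 hx)
  rwa [eventually_false_iff_eq_bot, ae_eq_bot, Measure.restrict_eq_zero] at h2

/-! ### Residual, divergence and jump terms on one element. -/

section terms

variable {M : Mesh Ω} {T : Finset (Vec d)} (hT : T ∈ M.elements)

include hT

/-- Δz + ∇r is constant on T, so only the volume of T enters. -/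
lemma residual_term_le {z P : Vec d → Vec d} {r : Vec d → ℝ} {A : Vec d →L[ℝ] Vec d}
    {B : Vec d →L[ℝ] Vec d →L[ℝ] Vec d} {c : ℝ} {b : Vec d} (hz : IsQuadOn (hull T) z P A B)
    (hr : ∀ x ∈ hull T, r x = c + ⟪b, x⟫_ℝ) (hh : 0 < hSize T) {q : ℝ}
    (hq : ‖strongResidual B b‖ ≤ q) :
    wL2Sq unitWeight (hull T) (fun x =>
        InnerProductSpace.laplacianWithin z (hull T) x + gradientWithin r (hull T) x) ≤
      ENNReal.ofReal (q ^ 2 * (unitBallVol d * (2 * hSize T) ^ d)) := by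
  have hq0 : 0 ≤ q := (norm_nonneg _).trans hq
  have hU := (M.isSimplex hT).uniqueDiffOn
  obtain ⟨w, hw⟩ := (M.isSimplex hT).interior_nonempty
  rw [ENNReal.ofReal_mul (by positivity), wL2Sq]
  calc _ ≤ ∫⁻ x in hull T, ENNReal.ofReal (q ^ 2) := by
        refine setLIntegral_mono measurable_const fun x hx => ?_
        rw [hz.laplacianWithin_eq hU hx, gradientWithin_eq_of_affine hr hU hx, unitWeight,
          ENNReal.ofReal_one, mul_one, ENNReal.ofReal_pow hq0, ← ofReal_norm]
        gcongr
        exact hq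
    _ = ENNReal.ofReal (q ^ 2) * volume (hull T) := setLIntegral_const _ _
    _ ≤ _ := by
        gcongr
        exact volume_le_of_dist_le hh fun x hx => dist_le_hSize hx (interior_subset hw)

/-- No bumps are involved: almost everywhere div z_T is minus the trace of the gradient error, so
the bound holds pointwise and keeps the weight. -/
lemma div_term_le (hΩ : IsLipschitzDomain Ω) {z : Vec d → Vec d} {eG : Vec d → Tens d}
    (htr : ∀ᵐ x ∂(volume.restrict Ω), tr (grad z x) = - tr (eG x)) :
    wL2Sq (rho Ω D α) (hull T) (fun x => tr (gradWithin z (hull T) x)) ≤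
      ENNReal.ofReal (d ^ 2) * wL2Sq (rho Ω D α) (M.star T) eG := by
  have hsub : interior (hull T) ⊆ Ω := by
    rw [← hΩ.interior_closure]; exact interior_mono (M.hull_subset_closure hT)
  have htr' : ∀ᵐ x : Vec d, x ∈ Ω → tr (grad z x) = - tr (eG x) :=
    (ae_restrict_iff' hΩ.isOpen.measurableSet).1 htr
  calc wL2Sq (rho Ω D α) (hull T) (fun x => tr (gradWithin z (hull T) x))
      ≤ ∫⁻ x in hull T, ENNReal.ofReal (d ^ 2) *
          (‖eG x‖ₑ ^ 2 * ENNReal.ofReal (rho Ω D α x)) := by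
        refine lintegral_mono_ae ?_
        filter_upwards [ae_restrict_of_ae htr', ae_restrict_of_ae M.ae_mem_interior,
          ae_restrict_mem (isCompact_hull T).isClosed.measurableSet] with x hx hxi hxT
        have hxT := hxi T hT hxT
        have h1 : gradWithin z (hull T) x = grad z x := by
          rw [gradWithin, grad, fderivWithin_of_mem_nhds (mem_interior_iff_mem_nhds.1 hxT)]
        rw [h1, hx (hsub hxT), ← mul_assoc, enorm_neg]
        gcongr
        rw [ENNReal.ofReal_pow (by positivity), ← mul_pow, ← ofReal_norm, ← ofReal_norm,
          ← ENNReal.ofReal_mul (by positivity)]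
        gcongr
        exact abs_tr_le _
    _ = ENNReal.ofReal (d ^ 2) * wL2Sq (rho Ω D α) (hull T) eG :=
        lintegral_const_mul' _ _ ENNReal.ofReal_ne_top
    _ ≤ _ := by
        gcongr
        exact lintegral_mono_set (Mesh.hull_subset_star (Mesh.self_mem_touching hT))

-- The jump is bounded pointwise on each side, a side has surface of order h_T^(d-1), and the number
-- of sides is at most that of touching elements.
open Classical in
lemma jump_term_le (hd : 2 ≤ d) {σ : ℝ} (hσ : 1 ≤ σ) (hM : M.IsShapeRegular σ) {s n : ℝ}
    (hs : 0 < s) (hsT : 6 * d * σ * sizeRatio d σ * s = hSize T) {z : Vec d → Vec d}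
    {r : Vec d → ℝ} (hz : M.InV z) (hr : M.InQ r)
    (hX : IsPatchControlled Ω z r s n (M.patch T)) :
    M.jumpSq z T ≤ ENNReal.ofReal (touchBound d σ * ((jumpConst d σ * n) ^ 2 *
      (unitBallVol (d - 1) * (2 * hSize T) ^ (d - 1)))) := by
  obtain ⟨P, A, B, c, b, hP⟩ := Mesh.exists_pieces hz hr
  have hh := Mesh.hSize_pos hd hM hT
  have hn : 0 ≤ n := (by positivity : 0 ≤ s * ‖strongResidual (B T) (b T)‖).trans
    ((Mesh.Chain.refl (M := M) (T := T)).norm_strongResidual_le hd hσ hM hT hs hsT hP hX)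
  have hj := jumpConst_pos (d := d) hσ
  have hterm : ∀ T' ∈ M.neighbors T, ∫⁻ x in hull (T ∩ T'), ‖normalJump z T T' x‖ₑ ^ 2 ∂μHE[d - 1] ≤
      ENNReal.ofReal ((jumpConst d σ * n) ^ 2 *
        (unitBallVol (d - 1) * (2 * hSize T) ^ (d - 1))) := by
    intro T' hT'
    have hch : M.Chain T T' 1 :=
      Mesh.Chain.refl.step (Mesh.neighbors_subset_touching (by omega) hT') hT'
    obtain ⟨ν, hν, hn₂, hn₁, hjump⟩ :=
      Mesh.Chain.refl.neighbor_jump_le hd hσ hM hT hs hsT hP hX hch hT'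
    have hT'm := hch.mem_elements hT
    have hl : hull (T ∩ T') ⊆ hull T := convexHull_mono (by simp)
    have hr : hull (T ∩ T') ⊆ hull T' := convexHull_mono (by simp)
    have hcard := (Mesh.mem_neighbors.1 hT').2.2
    rw [ENNReal.ofReal_mul (by positivity)]
    calc _ ≤ ∫⁻ x in hull (T ∩ T'), ENNReal.ofReal ((jumpConst d σ * n) ^ 2) ∂μHE[d - 1] := by
          refine setLIntegral_mono measurable_const fun x hx => ?_
          have h1 : normalJump z T T' x = (A T' + B T' x) ν - (A T + B T x) ν := by
            rw [normalJump, hn₁, hn₂,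
              (hP T hT).1.fderivWithin_eq (M.isSimplex hT).uniqueDiffOn (hl hx),
              (hP T' hT'm).1.fderivWithin_eq (M.isSimplex hT'm).uniqueDiffOn (hr hx), map_neg]
            abel
          have h2 := (hjump x (Mesh.hull_subset_patch Mesh.Chain.refl (hl hx))).1 ν
          rw [hν, mul_one] at h2
          rw [h1, ENNReal.ofReal_pow (by positivity), ← ofReal_norm]
          gcongr
      _ = ENNReal.ofReal ((jumpConst d σ * n) ^ 2) * μHE[d - 1] (hull (T ∩ T')) :=
          setLIntegral_const _ _
      _ ≤ _ := by
          gcongr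
          refine surface_hull_le (k := d - 1) (by rw [hcard]; omega) ?_ hh
            fun x hx y hy => dist_le_hSize (hl hx) (hl hy)
          exact (M.affineIndependent T hT).mono (by simp)
  calc M.jumpSq z T ≤ (M.neighbors T).card • ENNReal.ofReal ((jumpConst d σ * n) ^ 2 *
        (unitBallVol (d - 1) * (2 * hSize T) ^ (d - 1))) := Finset.sum_le_card_nsmul _ _ _ hterm
    _ ≤ _ := by
        rw [nsmul_eq_mul, ENNReal.ofReal_mul (p := (touchBound d σ : ℝ)) (by positivity),
          ENNReal.ofReal_natCast]
        gcongr
        refine (Finset.card_le_card fun T' h => ?_).trans (M.card_touching_le (by omega) hσ hM hT)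
        exact Mesh.neighbors_subset_touching (by omega) h

end terms

end

section

/-! ### Local efficiency -/

variable {Ω : Set (Vec d)} {D : Finset (Vec d)} {α : ℝ}

/-- The ratio of the radius of the control balls to the size of the element. -/
def controlRatio (d : ℕ) (σ : ℝ) : ℝ := (6 * d * σ * sizeRatio d σ)⁻¹

/-- The balance of powers behind the indicator: n is proportional to E / (h^(d/2) Δ^(α/2)). So h²
Δ^α (n/h)² h^d and h Δ^α n² h^(d-1), the sizes of the residual and jump terms, are both multiples of
E². -/
lemma control_sq {C h Δ E θ Λ c₀ : ℝ} (hd : 0 < d) (hh : 0 < h) (hΔ : 0 < Δ) (hθ : 0 < θ)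
    (hΛ : 0 < Λ) (hc₀ : 0 < c₀) :
    (2 * d * C * √(unitBallVol d * (θ * h) ^ d / (c₀ * (Δ / Λ) ^ α)) * E /
      ((θ * h) ^ d * bumpInt d)) ^ 2 * (h ^ d * Δ ^ α) =
    4 * d ^ 2 * C ^ 2 * unitBallVol d * Λ ^ α / (bumpInt d ^ 2 * c₀ * θ ^ d) * E ^ 2 := by
  have hω := unitBallVol_pos (d := d)
  have hI : 0 < bumpInt d := bumpInt_pos
  have hΔα : 0 < Δ ^ α := by positivity
  have hΛα : 0 < Λ ^ α := by positivity
  rw [div_pow, mul_pow, mul_pow, Real.sq_sqrt (by positivity), Real.div_rpow hΔ.le hΛ.le]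
  field_simp
  ring

/-- Both terms with n scale like h^(d-1) n, and h^(α+2-d) (h^(d-1) n)² = h^(α+d) n² is bounded
through h^α ≤ 2^α Δ^α. The last term scales like h^((d-α)/2 - 1) E, which h^(α+2-d) compensates
exactly. The leading 4 comes from squaring a sum of four terms. -/
lemma load_sq_le {h Δ θ θ₂ n I A₂ A₃ K₂ c₀ E Cn e Z : ℝ} (hα : 0 ≤ α) (hh : 0 < h)
    (hΔ : h ≤ 2 * Δ) (hθ : 0 < θ) (hθ₂ : 0 < θ₂) (hc₀ : 0 < c₀) (hK₂ : 0 ≤ K₂)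
    (hn : n ^ 2 * (h ^ d * Δ ^ α) = Cn * E ^ 2) (hZ0 : 0 ≤ Z)
    (hZ : Z ≤ e + (θ₂ * h) ^ d * I * (n / (θ * h)) + A₂ * n * ((θ₂ * h) ^ d / (θ₂ * h)) +
      A₃ / (θ₂ * h) * √(c₀⁻¹ * (K₂ * ((θ₂ * h) ^ (-α) * (θ₂ * h) ^ d))) * E) :
    h ^ (α + 2 - d) * Z ^ 2 ≤ 4 * (h ^ (α + 2 - d) * e ^ 2) +
      4 * (((θ₂ ^ d * I / θ) ^ 2 + (A₂ * (θ₂ ^ d / θ₂)) ^ 2) * (2 ^ α * Cn) +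
        A₃ ^ 2 * (c₀⁻¹ * (K₂ * (θ₂ ^ (-α) * θ₂ ^ d))) / θ₂ ^ 2) * E ^ 2 := by
  have hγ : h ^ (α + 2 - d) = h ^ α * h ^ 2 / h ^ d := by
    rw [Real.rpow_sub hh, Real.rpow_add hh, Real.rpow_natCast, Real.rpow_two]
  have ha : 0 < h ^ α := by positivity
  have hb : 0 < θ₂ ^ (-α) := by positivity
  have hn2 : n ^ 2 * (h ^ d * h ^ α) ≤ 2 ^ α * Cn * E ^ 2 := by
    have h1 : h ^ α ≤ 2 ^ α * Δ ^ α := by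
      rw [← Real.mul_rpow two_pos.le (by linarith)]
      exact Real.rpow_le_rpow hh.le hΔ hα
    calc n ^ 2 * (h ^ d * h ^ α) ≤ n ^ 2 * (h ^ d * (2 ^ α * Δ ^ α)) := by gcongr
      _ = 2 ^ α * (n ^ 2 * (h ^ d * Δ ^ α)) := by ring
      _ = _ := by rw [hn]; ring
  set g₁ := (θ₂ * h) ^ d * I * (n / (θ * h)) with hg₁
  set g₂ := A₂ * n * ((θ₂ * h) ^ d / (θ₂ * h)) with hg₂
  set g₃ := A₃ / (θ₂ * h) * √(c₀⁻¹ * (K₂ * ((θ₂ * h) ^ (-α) * (θ₂ * h) ^ d))) * E with hg₃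
  have e1 : h ^ (α + 2 - d) * g₁ ^ 2 = (θ₂ ^ d * I / θ) ^ 2 * (n ^ 2 * (h ^ d * h ^ α)) := by
    rw [hγ, hg₁, mul_pow θ₂ h]; field_simp
  have e2 : h ^ (α + 2 - d) * g₂ ^ 2 =
      (A₂ * (θ₂ ^ d / θ₂)) ^ 2 * (n ^ 2 * (h ^ d * h ^ α)) := by
    rw [hγ, hg₂, mul_pow θ₂ h]; field_simp
  have e3 : h ^ (α + 2 - d) * g₃ ^ 2 =
      A₃ ^ 2 * (c₀⁻¹ * (K₂ * (θ₂ ^ (-α) * θ₂ ^ d))) / θ₂ ^ 2 * E ^ 2 := by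
    rw [hγ, hg₃, mul_pow _ E, mul_pow _ (√_), Real.sq_sqrt (by positivity),
      Real.mul_rpow hθ₂.le hh.le, Real.rpow_neg hh.le, mul_pow θ₂ h]
    field_simp
  have hsq : Z ^ 2 ≤ 4 * (e ^ 2 + g₁ ^ 2 + g₂ ^ 2 + g₃ ^ 2) := by
    have h1 : Z ^ 2 ≤ (e + g₁ + g₂ + g₃) ^ 2 := pow_le_pow_left₀ hZ0 hZ 2
    nlinarith [sq_nonneg (e - g₁), sq_nonneg (e - g₂), sq_nonneg (e - g₃), sq_nonneg (g₁ - g₂),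
      sq_nonneg (g₁ - g₃), sq_nonneg (g₂ - g₃)]
  have hγ0 : 0 < h ^ (α + 2 - d) := by positivity
  calc h ^ (α + 2 - d) * Z ^ 2 ≤ h ^ (α + 2 - d) * (4 * (e ^ 2 + g₁ ^ 2 + g₂ ^ 2 + g₃ ^ 2)) := by
        gcongr
    _ = 4 * (h ^ (α + 2 - d) * e ^ 2) + 4 * (h ^ (α + 2 - d) * g₁ ^ 2 + h ^ (α + 2 - d) * g₂ ^ 2 +
          h ^ (α + 2 - d) * g₃ ^ 2) := by ring
    _ ≤ 4 * (h ^ (α + 2 - d) * e ^ 2) + 4 * ((θ₂ ^ d * I / θ) ^ 2 * (2 ^ α * Cn * E ^ 2) +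
          (A₂ * (θ₂ ^ d / θ₂)) ^ 2 * (2 ^ α * Cn * E ^ 2) +
          A₃ ^ 2 * (c₀⁻¹ * (K₂ * (θ₂ ^ (-α) * θ₂ ^ d))) / θ₂ ^ 2 * E ^ 2) := by
        rw [e1, e2, e3]; gcongr
    _ = _ := by ring

/-- The error of a solution of the optimality system satisfies the error equations. -/
lemma isErrorPair (hd : 0 < d) (hΩ : IsLipschitzDomain Ω)
    (hD : D.Nonempty) (hDΩ : (D : Set (Vec d)) ⊆ Ω) (hα : 0 < α) (hα' : α < d)
    {lam : ℝ} {lo up : Vec d} {yd y : Vec d → Vec d} {Gy : Vec d → Tens d} {p : Vec d → ℝ}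
    {z : Vec d → Vec d} {Gz : Vec d → Tens d} {r : Vec d → ℝ} {u : Vec d → Vec d}
    (hopt : IsOptimal Ω D α lam lo up yd y Gy p z Gz r u) {M : Mesh Ω} {zT : Vec d → Vec d}
    {rT : Vec d → ℝ} (hz : M.InV zT) (hr : M.InQ rT) {C : ℝ}
    (hC : ∀ y : Vec d, bumpKer y * ‖y‖ ≤ C) :
    IsErrorPair Ω D C (fun t => y t - yd t) (fun x => Gz x - grad zT x) (fun x => r x - rT x)
      zT rT where
  grad_integrable := hopt.z_mem.1.2.1.1.sub (locallyIntegrableOn_of_inV hz)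
  pressure_integrable := hopt.r_mem.1.sub (locallyIntegrableOn_of_inQ hΩ.isOpen hr)
  tr_eq := by
    filter_upwards [tr_eq_zero_ae hd hΩ.isOpen hΩ.isBounded hD hDΩ hα hopt.z_mem.1.2.1
      hopt.adjoint_div] with x hx
    rw [tr_sub, hx]; ring
  residual_le := fun _ _ _ hs hball => abs_residual_le hd hΩ.isOpen hΩ.isBounded hD hDΩ hα hα' hopt
    (locallyIntegrableOn_of_inV hz) (locallyIntegrableOn_of_inQ hΩ.isOpen hr) hC hs hball

lemma exists_ball_subset (hΩ : IsOpen Ω) (hDΩ : (D : Set (Vec d)) ⊆ Ω) :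
    ∃ δ : ℝ, 0 < δ ∧ ∀ t ∈ D, Metric.ball t δ ⊆ Ω := by
  obtain ⟨δ, hδ, h⟩ := D.finite_toSet.isCompact.exists_thickening_subset_open hΩ hDΩ
  exact ⟨δ, hδ, fun t ht => (Metric.ball_subset_thickening ht δ).trans h⟩

-- The four terms of the squared indicator are estimated one by one and the constants added. They
-- are built from d, σ, α, the bounds for the weight, and a radius δ for which the balls about 𝒟 lie
-- in Ω. The case σ ≥ 1 makes powers of σ increasing.
set_option maxHeartbeats 1000000 in
theorem local_efficiency (hd : 2 ≤ d) (hΩ : IsLipschitzDomain Ω) (hD : D.Nonempty)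
    (hDΩ : (D : Set (Vec d)) ⊆ Ω) (hα : 0 < α) (hα' : α < d) {σ : ℝ} (hσ : 1 ≤ σ) :
    ∃ C : ℝ≥0, 0 < C ∧
      ∀ (lam : ℝ) (lo up : Vec d) (yd : Vec d → Vec d) (M : Mesh Ω), M.IsShapeRegular σ →
      (∀ T ∈ M.elements, (M.star T ∩ (D : Set (Vec d))).ncard ≤ 1) →
      ∀ (y : Vec d → Vec d) (Gy : Vec d → Tens d) (p : Vec d → ℝ)
        (z : Vec d → Vec d) (Gz : Vec d → Tens d) (r : Vec d → ℝ) (u : Vec d → Vec d),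
      IsOptimal Ω D α lam lo up yd y Gy p z Gz r u →
      ∀ (yT : Vec d → Vec d) (zT : Vec d → Vec d) (rT : Vec d → ℝ),
      M.InV yT → M.InV zT → M.InQ rT →
      ∀ T ∈ M.elements,
        M.adIndicator D α yd zT rT yT T ^ 2 ≤
          C * (wL2Sq (rho Ω D α) (M.star T) (fun x => Gz x - grad zT x) +
            wL2Sq (rho Ω D α) (M.star T) (fun x => r x - rT x) +
            ((hull T ∩ (D : Set (Vec d))).ncard : ℝ≥0∞) *
              ENNReal.ofReal (hSize T ^ (α + 2 - d)) *
              eLpNorm (fun x => y x - yT x) ∞ (volume.restrict (hull T)) ^ 2) := by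
  have hd0 : 0 < d := by omega
  obtain ⟨c₀, R, hc₀, hR, hdist, hρ, -⟩ := exists_rho_bounds (α := α) hΩ.isBounded hD hDΩ hα
  obtain ⟨K₂, hK₂, hsing⟩ := exists_lintegral_rpow hd0 hα'
  obtain ⟨C₀, -, hC₀⟩ := exists_bumpKer_le (d := d)
  obtain ⟨δ, hδ, hδΩ⟩ := exists_ball_subset hΩ.isOpen hDΩ
  set C := max C₀ 1 with hCdef
  have hC1 : 1 ≤ C := le_max_right _ _
  have hC : ∀ y : Vec d, bumpKer y * ‖y‖ ≤ C := fun y => (hC₀ y).trans (le_max_left _ _)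
  have hK : 0 < sizeRatio d σ := one_pos.trans_le (one_le_sizeRatio hσ)
  have hω := unitBallVol_pos (d := d)
  have hω' := unitBallVol_pos (d := d - 1)
  have hI : 0 < bumpInt d := bumpInt_pos
  have hκ := jumpConst_pos (d := d) hσ
  set K := sizeRatio d σ with hKdef
  set θ := controlRatio d σ with hθdef
  have hθ : 0 < θ := by rw [hθdef, controlRatio]; positivity
  -- Chosen so that s + 2Kh = Λs for s = θh.
  set Λ := 1 + 2 * K / θ with hΛdef
  have hΛ : 0 < Λ := by positivity
  -- The first entry puts the ball of radius 2θ₂h about t into the patch, the second into Ω, since h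
  -- ≤ R.
  set θ₂ := min (4 * σ * K)⁻¹ (δ / (2 * R)) with hθ₂def
  have hθ₂ : 0 < θ₂ := by positivity
  set Cn := 4 * d ^ 2 * C ^ 2 * unitBallVol d * Λ ^ α / (bumpInt d ^ 2 * c₀ * θ ^ d) with hCn
  have hCn0 : 0 ≤ Cn := by positivity
  set C₁ := θ⁻¹ ^ 2 * unitBallVol d * 2 ^ d * Cn with hC₁
  set C₃ := touchBound d σ * jumpConst d σ ^ 2 * unitBallVol (d - 1) * 2 ^ (d - 1) * Cn with hC₃
  set A₂ := 2 * d * C * unitBallVol d * (touchBound d σ * jumpConst d σ) with hA₂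
  set A₃ := 2 * d * C with hA₃
  set C₄ := 4 * (((θ₂ ^ d * bumpInt d / θ) ^ 2 + (A₂ * (θ₂ ^ d / θ₂)) ^ 2) * (2 ^ α * Cn) +
        A₃ ^ 2 * (c₀⁻¹ * (K₂ * (θ₂ ^ (-α) * θ₂ ^ d))) / θ₂ ^ 2) with hC₄
  have hC₁0 : 0 ≤ C₁ := by positivity
  have hC₃0 : 0 ≤ C₃ := by positivity
  have hC₄0 : 0 ≤ C₄ := by positivity
  refine ⟨(C₁ + d ^ 2 + C₃ + C₄ + 4).toNNReal, Real.toNNReal_pos.2 (by positivity), ?_⟩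
  intro lam lo up yd M hM hcard y Gy p z Gz r u hopt yT zT rT hyT hzT hrT T hT
  set eG := fun x => Gz x - grad zT x with heG
  set er := fun x => r x - rT x with her
  set e₁ := wL2Sq (rho Ω D α) (M.star T) eG with he₁
  set e₂ := wL2Sq (rho Ω D α) (M.star T) er with he₂
  set e₃ := ((hull T ∩ (D : Set (Vec d))).ncard : ℝ≥0∞) * ENNReal.ofReal (hSize T ^ (α + 2 - d)) *
    eLpNorm (fun x => y x - yT x) ∞ (volume.restrict (hull T)) ^ 2 with he₃
  change _ ≤ ENNReal.ofReal _ * _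
  -- An infinite error makes the right-hand side infinite, as the constant is positive. Otherwise E²
  -- is the sum of the two squared errors.
  by_cases htop : e₁ + e₂ = ∞
  · rw [htop, top_add, ENNReal.mul_top]
    · exact le_top
    · exact (ENNReal.ofReal_pos.2 (by positivity)).ne'
  set E := √(e₁ + e₂).toReal with hE
  have hE0 : 0 ≤ E := Real.sqrt_nonneg _
  have hE2 : ENNReal.ofReal (E ^ 2) = e₁ + e₂ := by
    rw [hE, Real.sq_sqrt ENNReal.toReal_nonneg, ENNReal.ofReal_toReal htop]
  have hEG : e₁ ≤ ENNReal.ofReal (E ^ 2) := by rw [hE2]; exact le_self_add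
  have hEr : e₂ ≤ ENNReal.ofReal (E ^ 2) := by rw [hE2]; exact le_add_self
  set h := hSize T with hhdef
  have hh : 0 < h := Mesh.hSize_pos hd hM hT
  set Δ := obsDist D T with hΔdef
  have hΔ2 : h ≤ 2 * Δ := hSize_le_obsDist hD T
  have hΔ : 0 < Δ := by linarith
  have hΔα : 0 < Δ ^ α := by positivity
  have hs : 0 < θ * h := by positivity
  have hsT : 6 * d * σ * K * (θ * h) = h := by
    rw [hθdef, controlRatio, ← hKdef]; field_simp
  have hΛs : θ * h + 2 * K * h ≤ Λ * (θ * h) := by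
    rw [hΛdef]; apply le_of_eq; field_simp
  have hpair := isErrorPair hd0 hΩ hD hDΩ hα hα' hopt hzT hrT hC
  have hX := hpair.isPatchControlled hd hΩ hD hα.le hC1 hσ hM hT (hcard T hT) hE0 hEG hEr hc₀ hρ hs
    hΛs rfl
  have hnsq := control_sq (α := α) (C := C) (E := E) hd0 hh hΔ hθ hΛ hc₀
  set n := 2 * d * C * √(unitBallVol d * (θ * h) ^ d / (c₀ * (Δ / Λ) ^ α)) * E /
    ((θ * h) ^ d * bumpInt d) with hn
  have hn0 : 0 ≤ n := by positivity
  change n ^ 2 * (h ^ d * Δ ^ α) = Cn * E ^ 2 at hnsq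
  clear_value n Cn
  obtain ⟨P, A, B, c, b, hP⟩ := Mesh.exists_pieces hzT hrT
  have hq : ‖strongResidual (B T) (b T)‖ ≤ n / (θ * h) := by
    rw [le_div_iff₀ hs, mul_comm]
    exact (Mesh.Chain.refl (M := M) (T := T)).norm_strongResidual_le hd hσ hM hT hs hsT hP hX
  have t1 : ENNReal.ofReal (h ^ 2 * Δ ^ α) * wL2Sq unitWeight (hull T) (fun x =>
        InnerProductSpace.laplacianWithin zT (hull T) x + gradientWithin rT (hull T) x) ≤
      ENNReal.ofReal C₁ * (e₁ + e₂) := by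
    rw [← hE2, ← ENNReal.ofReal_mul hC₁0]
    refine (mul_le_mul_right (residual_term_le hT (hP T hT).1 (hP T hT).2 hh hq) _).trans ?_
    rw [← ENNReal.ofReal_mul (by positivity)]
    refine ENNReal.ofReal_le_ofReal (le_of_eq ?_)
    rw [hC₁, mul_assoc _ Cn, ← hnsq, mul_pow, ← hhdef]
    field_simp
  have t2 : wL2Sq (rho Ω D α) (hull T) (fun x => tr (gradWithin zT (hull T) x)) ≤
      ENNReal.ofReal (d ^ 2) * (e₁ + e₂) :=
    (div_term_le hT hΩ hpair.tr_eq).trans (by gcongr; exact le_self_add)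
  have t3 : ENNReal.ofReal (h * Δ ^ α) * M.jumpSq zT T ≤ ENNReal.ofReal C₃ * (e₁ + e₂) := by
    rw [← hE2, ← ENNReal.ofReal_mul hC₃0]
    refine (mul_le_mul_right (jump_term_le hT hd hσ hM hs hsT hzT hrT hX) _).trans ?_
    rw [← ENNReal.ofReal_mul (by positivity)]
    refine ENNReal.ofReal_le_ofReal (le_of_eq ?_)
    have hpow : h ^ d = h * h ^ (d - 1) := by
      rw [← pow_succ']; congr 1; omega
    rw [hC₃, mul_assoc _ Cn, ← hnsq, hpow, mul_pow 2]
    ring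
  have t4 : ∑ t ∈ D, (open Classical in if t ∈ hull T then
      ENNReal.ofReal (h ^ (α + 2 - d)) * ‖yT t - yd t‖ₑ ^ 2 else 0) ≤
      4 * e₃ + ENNReal.ofReal C₄ * (e₁ + e₂) := by
    classical
    -- Because the star has at most one observation point, the sum has at most one nonzero term, and
    -- the cardinality on the right is 0 or 1.
    by_cases hex : ∃ t ∈ D, t ∈ hull T
    swap
    · push Not at hex
      rw [Finset.sum_eq_zero fun t ht => if_neg (hex t ht)]
      exact zero_le
    obtain ⟨t, ht, htT⟩ := hex
    have hfin : (M.star T ∩ (D : Set (Vec d))).Finite := D.finite_toSet.inter_of_right _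
    have hTs := Mesh.hull_subset_star (Mesh.self_mem_touching hT)
    have huniq : ∀ t' ∈ D, t' ∈ hull T → t' = t := fun t' ht' htT' =>
      (Set.ncard_le_one hfin).1 (hcard T hT) t' ⟨hTs htT', ht'⟩ t ⟨hTs htT, ht⟩
    have hncard : (hull T ∩ (D : Set (Vec d))).ncard = 1 := by
      rw [Set.ncard_eq_one]
      exact ⟨t, Set.eq_singleton_iff_unique_mem.2 ⟨⟨htT, ht⟩, fun t' h' => huniq t' h'.2 h'.1⟩⟩
    rw [Finset.sum_eq_single_of_mem t ht fun t' ht' hne => if_neg fun h' => hne (huniq t' ht' h'),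
      if_pos htT, he₃, hncard, Nat.cast_one, one_mul]
    have hℓ : 0 < θ₂ * h := by positivity
    have hhR : h ≤ R := Metric.diam_le_of_forall_dist_le hR.le fun x hx x' hx' =>
      hdist x (M.hull_subset_closure hT hx) x' (M.hull_subset_closure hT hx')
    have hℓ1 : 4 * σ * K * (θ₂ * h) ≤ h := by
      have h1 : 4 * σ * K * θ₂ ≤ 1 := by
        calc 4 * σ * K * θ₂ ≤ 4 * σ * K * (4 * σ * K)⁻¹ := by gcongr; exact min_le_left _ _
          _ = 1 := by field_simp
      nlinarith
    have hℓ2 : 2 * (θ₂ * h) ≤ δ := by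
      calc 2 * (θ₂ * h) ≤ 2 * (δ / (2 * R) * R) := by gcongr; exact min_le_right _ _
        _ = δ := by field_simp
    have hload := hpair.norm_load_le hd hΩ.isOpen hD hC1 hC hσ hM hT (hcard T hT) hE0 hEG hEr hc₀ hρ
      hK₂.le hsing hs hsT hzT hrT hX ht htT hℓ hℓ1
      ((Metric.ball_subset_ball hℓ2).trans (hδΩ t ht)) (y t - yT t)
    -- With e = ȳ(t) - ȳ_T(t), the difference (ȳ(t) - y_t) - e is the discrete load ȳ_T(t) - y_t.
    rw [sub_sub_sub_cancel_left] at hload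
    have hsq := load_sq_le (α := α) (I := bumpInt d) (A₂ := A₂) (A₃ := A₃) (E := E) hα.le hh hΔ2
      hθ hθ₂ hc₀ hK₂.le hnsq (norm_nonneg _) (hload.trans (le_of_eq (by rw [hA₂, hA₃]; ring)))
    have hcont : ContinuousAt (fun x => y x - yT x) t := by
      have hΩt := hΩ.isOpen.mem_nhds (hDΩ ht)
      exact (hopt.y_cont.continuousAt hΩt).sub ((hyT.1.1.mono subset_closure).continuousAt hΩt)
    have hcl : t ∈ closure (interior (hull T)) := by
      rw [(convex_hull' T).closure_interior_eq_closure_of_nonempty_interior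
        (M.isSimplex hT).interior_nonempty]
      exact subset_closure htT
    have hsup := enorm_le_eLpNorm_top hcont hcl
    rw [← hE2, ← ENNReal.ofReal_mul hC₄0, ← ofReal_norm, ← ENNReal.ofReal_pow (norm_nonneg _),
      ← ENNReal.ofReal_mul (by positivity)]
    refine (ENNReal.ofReal_le_ofReal hsq).trans ?_
    rw [ENNReal.ofReal_add (by positivity) (by positivity), ENNReal.ofReal_mul (by positivity),
      ENNReal.ofReal_mul (by positivity), ENNReal.ofReal_pow (norm_nonneg _), ofReal_norm]
    gcongr
    simp
  rw [Mesh.adIndicator, ← ENNReal.rpow_natCast, ← ENNReal.rpow_mul]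
  norm_num only [Nat.cast_ofNat, ENNReal.rpow_one]
  calc _ ≤ ENNReal.ofReal C₁ * (e₁ + e₂) + ENNReal.ofReal (d ^ 2) * (e₁ + e₂) +
        ENNReal.ofReal C₃ * (e₁ + e₂) + (4 * e₃ + ENNReal.ofReal C₄ * (e₁ + e₂)) := by
        gcongr
    _ = (ENNReal.ofReal C₁ + ENNReal.ofReal (d ^ 2) + ENNReal.ofReal C₃ + ENNReal.ofReal C₄) *
          (e₁ + e₂) + 4 * e₃ := by ring
    _ ≤ ENNReal.ofReal (C₁ + d ^ 2 + C₃ + C₄ + 4) * (e₁ + e₂) +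
          ENNReal.ofReal (C₁ + d ^ 2 + C₃ + C₄ + 4) * e₃ := by
        rw [← ENNReal.ofReal_add hC₁0 (by positivity), ← ENNReal.ofReal_add (by positivity) hC₃0,
          ← ENNReal.ofReal_add (by positivity) hC₄0]
        have hd2 : (0 : ℝ) ≤ d ^ 2 := by positivity
        refine add_le_add (mul_le_mul' (ENNReal.ofReal_le_ofReal (by linarith)) le_rfl)
          (mul_le_mul' ?_ le_rfl)
        rw [← ENNReal.ofReal_ofNat 4]
        exact ENNReal.ofReal_le_ofReal (by linarith)
    _ = _ := by rw [← mul_add]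

end

end StokesTracking

end

open StokesTracking in
theorem mainTheorem7 (d : ℕ) (hd : d = 2 ∨ d = 3)
    (Ω : Set (Vec d)) (hΩ : IsLipschitzDomain Ω)
    (D : Finset (Vec d)) (hD : D.Nonempty) (hDΩ : (D : Set (Vec d)) ⊆ Ω)
    (α : ℝ) (hα : (d : ℝ) - 2 < α) (hα' : α < d) (σ : ℝ) :
    ∃ C : ℝ≥0, 0 < C ∧
      ∀ (lam : ℝ) (lo up : Vec d) (yd : Vec d → Vec d), 0 < lam → (∀ i, lo i < up i) →
      ∀ M : Mesh Ω, M.IsShapeRegular σ →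
      (∀ T ∈ M.elements, (M.star T ∩ (D : Set (Vec d))).ncard ≤ 1) →
      ∀ (y : Vec d → Vec d) (Gy : Vec d → Tens d) (p : Vec d → ℝ)
        (z : Vec d → Vec d) (Gz : Vec d → Tens d) (r : Vec d → ℝ) (u : Vec d → Vec d),
      IsOptimal Ω D α lam lo up yd y Gy p z Gz r u →
      ∀ (yT : Vec d → Vec d) (pT : Vec d → ℝ) (zT : Vec d → Vec d) (rT : Vec d → ℝ)
        (uT : Vec d → Vec d),
      M.IsDiscreteOptimal D lam lo up yd yT pT zT rT uT →
      ∀ T ∈ M.elements,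
        M.adIndicator D α yd zT rT yT T ^ 2 ≤
          C * (wL2Sq (rho Ω D α) (M.star T) (fun x => Gz x - grad zT x) +
            wL2Sq (rho Ω D α) (M.star T) (fun x => r x - rT x) +
            ((hull T ∩ (D : Set (Vec d))).ncard : ℝ≥0∞) *
              ENNReal.ofReal (hSize T ^ (α + 2 - d)) *
              eLpNorm (fun x => y x - yT x) ∞ (volume.restrict (hull T)) ^ 2) := by
  have hd2 : 2 ≤ d := by omega
  have hα0 : 0 < α := by
    have : (2 : ℝ) ≤ d := by exact_mod_cast hd2
    linarith
  -- Shape regularity persists when σ is enlarged to max σ 1, and α > d - 2 ≥ 0 gives the positivity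
  -- of α.
  obtain ⟨C, hC, h⟩ := local_efficiency hd2 hΩ hD hDΩ hα0 hα' (le_max_right σ 1)
  refine ⟨C, hC, fun lam lo up yd _ _ M hM hcard y Gy p z Gz r u hopt yT pT zT rT uT hdis T hT => ?_⟩
  exact h lam lo up yd M (hM.mono (le_max_left σ 1)) hcard y Gy p z Gz r u hopt yT zT rT hdis.y_mem
    hdis.z_mem hdis.r_mem T hT
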